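/- Let $S$ be a stationary point process of intensity $1$ in $\mathbb{R}^2$ with Palm version $S^\circ$ (that is, $\mathcal P(S^\circ\in A)=\mathcal E\,\#\{x\in S\cap[0,1)^2: S-x\in A\}$). The Voronoi cell of $s\in\mathbf s$ is $\mathrm{Vor}(s,\mathbf s)=\{x:|x-s|\le|x-t|\ \forall t\in\mathbf s\}$. Two distinct points $s,t\in\mathbf s$ are neighbors, $a(s,t)=1$, if $\mathrm{Vor}(s)\cap\mathrm{Vor}(t)$ has dimension $1$; otherwise $a(s,t)=0$. $\mathrm{Cen}(x)$ is the point of $\mathbf s$ whose cell contains $x$ (ties are broken lexicographically). Assume: - the law of $S$ is mixing; - almost surely no circle contains $4$ or more points of $S$; - the number of neighbors of $0$ in $S^\circ$ has a finite positive exponential moment; - the length of $\partial\mathrm{Vor}(0,S^\circ)$ has finite second moment; - $\mathcal E\sum_{s\in S^\circ}a(0,s)|s|^r<\infty$ for some $r>4$; - $S$ is almost surely not periodic. For a surface $\eta(s,\mathbf s)$, $s\in\mathbf s$, let $\nabla\eta(s,t,\mathbf s)=a(s,t)[\eta(t,\mathbf s)-\eta(s,\mathbf s)]$. We say that $\nabla\eta\in\mathcal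 H$ if it is measurable, almost surely covariant, that is $\nabla\eta(t-s,u-s,S^\circ-s)=\nabla\eta(t,u,S^\circ)$ for all $s,t,u\in S^\circ$, and $\tfrac12\mathcal E\sum_{s\in S^\circ}a(0,s)|\nabla\eta(0,s)|^2<\infty$. The surface $\eta$ has tilt $v\in\mathbb{R}^2$ if almost surely, for $i=1,2$ and almost every $x\in\mathbb{R}^2$, $[\eta(\mathrm{Cen}(x+Ke_i))-\eta(\mathrm{Cen}(x))]/K\to v_i$ as $K\to+\infty$ and as $K\to-\infty$. A deformation is a map $G:S^\circ\to\mathbb{R}^2$ with $G(0)=0$ whose $i$-th coordinate has tilt $e_i$, $i=1,2$ (so the corrector $G(s)-s$ is sublinear along lines). The harmonic deformation $H$ of the Delaunay triangulation of $S$ is the deformation whose coordinates $h_i$ have $\nabla h_i\in\mathcal H$ and are harmonic: $\sum_{t}a(s,t)[h_i(t)-h_i(s)]=0$ for all $s\in S^\circ$, almost surely. For neighbors $s,s'$ let $\alpha_+(s,s')$ be the first common neighbor of $s$ and $s'$ in the clockwise direction from $s'-s$. Then $H$ minimizes $$\mathcal E\sum_{s\in S^\circ}a(0,s)\,\big[G(s)\cdot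 G(\alpha_+(0,s))\big]$$ among the deformations $G$ such that the coordinates of the corrector $G(s)-s$ have gradient in $\mathcal H$: $H$ itself belongs to this class, the random sum is integrable for every $G$ in the class, and its expectation is smallest for $G=H$. -/

import Mathlib

open MeasureTheory ProbabilityTheory Filter Topology
open scoped ENNReal

noncomputable section

namespace HarmonicDeformation

/-- The Euclidean plane. -/
abbrev Plane : Type := EuclideanSpace ℝ (Fin 2)

/-- Locally finite point configurations of the plane. -/
@[ext] structure Config where
  carrier : Set Plane
  finite_inter : ∀ B : Set Plane, Bornology.IsBounded B → (carrier ∩ B).Finite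

namespace Config

instance : SetLike Config Plane where
  coe := Config.carrier
  coe_injective := fun _ _ h => Config.ext h

lemma finite_inter_coe (s : Config) {B : Set Plane} (hB : Bornology.IsBounded B) :
    ((s : Set Plane) ∩ B).Finite := s.finite_inter B hB

/-- The sigma-algebra generated by the numbers of points in bounded Borel sets. -/
instance : MeasurableSpace Config :=
  MeasurableSpace.generateFrom
    {A | ∃ B : Set Plane, Bornology.IsBounded B ∧ MeasurableSet B ∧
      ∃ k : ℕ, A = {s : Config | ((s : Set Plane) ∩ B).ncard = k}}

/-- The translated configuration `{y - x : y ∈ s}`. -/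
def shift (x : Plane) (s : Config) : Config where
  carrier := {z | z + x ∈ s}
  finite_inter B hB := by
    have hB' : Bornology.IsBounded ((fun z => z + x) '' B) := by
      obtain ⟨r, hr⟩ := hB.subset_closedBall 0
      refine (Metric.isBounded_closedBall (x := x) (r := r)).subset ?_
      rintro _ ⟨z, hz, rfl⟩
      simpa using hr hz
    refine Set.Finite.of_finite_image (f := fun z => z + x)
      ((s.finite_inter_coe hB').subset ?_) (add_left_injective x).injOn
    rintro _ ⟨z, ⟨hz, hzB⟩, rfl⟩
    exact ⟨hz, z, hzB, rfl⟩

lemma mem_shift {x z : Plane} {s : Config} : z ∈ shift x s ↔ z + x ∈ s := Iff.rfl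

/-- The counting measure carried by the points of a configuration. -/
def points (s : Config) : Measure Plane := Measure.sum fun x : s => Measure.dirac (x : Plane)

lemma points_apply (s : Config) {B : Set Plane} (hB : MeasurableSet B) :
    s.points B = ((s : Set Plane) ∩ B).encard := by
  rw [points, Measure.sum_apply _ hB]
  simp only [Measure.dirac_apply' _ hB]
  refine (tsum_subtype (s : Set Plane) (fun x => B.indicator (1 : Plane → ℝ≥0∞) x)).trans ?_
  rw [Set.indicator_indicator, ← ENNReal.tsum_set_one]
  exact (tsum_subtype ((s : Set Plane) ∩ B) fun _ => (1 : ℝ≥0∞)).symm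

lemma measurable_ncard {B : Set Plane} (hb : Bornology.IsBounded B) (hB : MeasurableSet B) :
    Measurable fun s : Config => ((s : Set Plane) ∩ B).ncard :=
  measurable_to_countable' fun k =>
    MeasurableSpace.measurableSet_generateFrom ⟨B, hb, hB, k, rfl⟩

lemma points_apply_bounded (s : Config) {B : Set Plane} (hb : Bornology.IsBounded B)
    (hB : MeasurableSet B) : s.points B = (((s : Set Plane) ∩ B).ncard : ℝ≥0∞) := by
  rw [points_apply s hB, ← (s.finite_inter_coe hb).cast_ncard_eq]; simp

lemma measurable_points : Measurable points := by
  refine Measure.measurable_of_measurable_coe _ fun B hB => ?_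
  have hU : B = ⋃ n : ℕ, B ∩ Metric.closedBall 0 (n : ℝ) := by
    rw [← Set.inter_iUnion, Metric.iUnion_closedBall_nat, Set.inter_univ]
  have hm : Monotone fun n : ℕ => B ∩ Metric.closedBall (0 : Plane) (n : ℝ) := fun a b hab =>
    Set.inter_subset_inter_right _ (Metric.closedBall_subset_closedBall (by exact_mod_cast hab))
  have hs : ∀ s : Config, s.points B = ⨆ n : ℕ, s.points (B ∩ Metric.closedBall 0 (n : ℝ)) := by
    intro s
    conv_lhs => rw [hU]
    exact hm.measure_iUnion
  simp only [hs]
  refine Measurable.iSup fun n => ?_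
  have hb : Bornology.IsBounded (B ∩ Metric.closedBall (0 : Plane) (n : ℝ)) :=
    Metric.isBounded_closedBall.subset Set.inter_subset_right
  have hB' : MeasurableSet (B ∩ Metric.closedBall (0 : Plane) (n : ℝ)) :=
    hB.inter measurableSet_closedBall
  simp only [points_apply_bounded _ hb hB']
  exact (measurable_from_top (f := fun k : ℕ => (k : ℝ≥0∞))).comp (measurable_ncard hb hB')

/-- `points` as a kernel. -/
def pointsKernel : Kernel Config Plane := ⟨points, measurable_points⟩

/-- The part of the plane at distance between `n` and `n + 1` from the origin. -/
def annulus (n : ℕ) : Set Plane := {x | ⌊‖x‖⌋₊ = n}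

lemma measurableSet_annulus (n : ℕ) : MeasurableSet (annulus n) :=
  (Nat.measurable_floor.comp measurable_norm) (measurableSet_singleton n)

lemma isBounded_annulus (n : ℕ) : Bornology.IsBounded (annulus n) := by
  refine (Metric.isBounded_closedBall (x := (0 : Plane)) (r := n + 1)).subset fun x hx => ?_
  have := Nat.lt_floor_add_one ‖x‖
  rw [show ⌊‖x‖⌋₊ = n from hx] at this
  simpa using this.le

instance : IsSFiniteKernel pointsKernel := by
  classical
  have hA : ∀ n k : ℕ, MeasurableSet {s : Config | ((s : Set Plane) ∩ annulus n).ncard = k} :=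
    fun n k => measurable_ncard (isBounded_annulus n) (measurableSet_annulus n)
      (measurableSet_singleton k)
  let κ : ℕ × ℕ → Kernel Config Plane := fun p =>
    Kernel.piecewise (hA p.1 p.2) (pointsKernel.restrict (measurableSet_annulus p.1)) 0
  have hfin : ∀ p, IsFiniteKernel (κ p) := by
    intro p
    refine ⟨⟨(p.2 : ℝ≥0∞), ENNReal.natCast_lt_top _, fun s => ?_⟩⟩
    simp only [κ, Kernel.piecewise_apply]
    split_ifs with h
    · rw [Kernel.restrict_apply, Measure.restrict_apply_univ]
      change s.points _ ≤ _
      rw [points_apply_bounded s (isBounded_annulus _) (measurableSet_annulus _)]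
      exact le_of_eq (by rw [show _ = p.2 from h])
    · simp
  have hsum : pointsKernel = Kernel.sum κ := by
    ext s B hB
    rw [Kernel.sum_apply' _ _ hB, ENNReal.tsum_prod']
    have h1 : ∀ n : ℕ, ∑' k : ℕ, κ (n, k) s B = s.points (B ∩ annulus n) := by
      intro n
      rw [tsum_eq_single ((s : Set Plane) ∩ annulus n).ncard]
      · simp only [κ, Kernel.piecewise_apply]
        rw [if_pos (by simp), Kernel.restrict_apply, Measure.restrict_apply hB]
        rfl
      · intro k hk
        simp only [κ, Kernel.piecewise_apply]
        rw [if_neg (by simpa using hk.symm)]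
        simp
    simp only [h1]
    rw [← measure_iUnion]
    · rw [← Set.inter_iUnion]
      have : ⋃ n, annulus n = Set.univ := Set.eq_univ_of_forall fun x => by
        simp [annulus]
      rw [this, Set.inter_univ]; rfl
    · intro m n hmn
      refine Set.disjoint_left.2 fun x hx hy => hmn ?_
      exact hx.2.symm.trans hy.2
    · exact fun n => hB.inter (measurableSet_annulus n)
  rw [hsum]
  infer_instance

lemma measurable_shift : Measurable fun p : Plane × Config => shift p.1 p.2 := by
  refine measurable_generateFrom ?_
  rintro _ ⟨B, hb, hB, k, rfl⟩
  have hK : ∀ p : Plane × Config,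
      (((shift p.1 p.2 : Config) : Set Plane) ∩ B).ncard
        = (∫⁻ y, B.indicator 1 (y - p.1) ∂(pointsKernel.prodMkLeft Plane p)).toNNReal := by
    intro p
    have hpre : MeasurableSet ((fun y : Plane => y - p.1) ⁻¹' B) :=
      (measurable_id.sub_const p.1) hB
    have h1 : (∫⁻ y, B.indicator 1 (y - p.1) ∂(pointsKernel.prodMkLeft Plane p))
        = p.2.points ((fun y => y - p.1) ⁻¹' B) := by
      rw [← lintegral_indicator_one hpre]
      rfl
    have h2 : (p.2 : Set Plane) ∩ ((fun y => y - p.1) ⁻¹' B)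
        = (fun z => z + p.1) '' (((shift p.1 p.2 : Config) : Set Plane) ∩ B) := by
      ext y
      constructor
      · rintro ⟨hy, hyB⟩
        refine ⟨y - p.1, ⟨?_, hyB⟩, by simp⟩
        change y - p.1 + p.1 ∈ p.2
        simpa using hy
      · rintro ⟨z, ⟨hz, hzB⟩, rfl⟩
        exact ⟨hz, by simpa using hzB⟩
    rw [h1, points_apply _ hpre, h2,
      (add_left_injective p.1).encard_image, ← ((shift p.1 p.2).finite_inter_coe hb).cast_ncard_eq]
    simp
  have hmeas : Measurable fun p : Plane × Config =>
      (∫⁻ y, B.indicator (1 : Plane → ℝ≥0∞) (y - p.1) ∂(pointsKernel.prodMkLeft Plane p)).toNNReal :=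
    (Measurable.lintegral_kernel_prod_right'
      (κ := pointsKernel.prodMkLeft Plane)
      (f := fun q : (Plane × Config) × Plane => B.indicator 1 (q.2 - q.1.1))
      ((measurable_one.indicator hB).comp
        (measurable_snd.sub (measurable_fst.comp measurable_fst)))).ennreal_toNNReal
  have : (fun p : Plane × Config => shift p.1 p.2) ⁻¹'
      {s : Config | ((s : Set Plane) ∩ B).ncard = k}
      = (fun p : Plane × Config => (∫⁻ y, B.indicator (1 : Plane → ℝ≥0∞) (y - p.1)
          ∂(pointsKernel.prodMkLeft Plane p)).toNNReal) ⁻¹' {(k : NNReal)} := by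
    ext p
    simp only [Set.mem_preimage, Set.mem_ofPred_eq, Set.mem_singleton_iff, ← hK p]
    exact Nat.cast_inj.symm
  rw [this]
  exact hmeas (measurableSet_singleton _)

end Config

open Config

/-! ### The Palm version -/

/-- The unit square `[0,1)²`. -/
def unitSquare : Set Plane := {x | ∀ i, 0 ≤ x i ∧ x i < 1}

lemma measurableSet_unitSquare : MeasurableSet unitSquare := by
  have : unitSquare = ⋂ i : Fin 2, (fun x : Plane => x i) ⁻¹' Set.Ico 0 1 := by
    ext x; simp [unitSquare]
  rw [this]
  exact MeasurableSet.iInter fun i =>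
    measurableSet_Ico.preimage (EuclideanSpace.proj (𝕜 := ℝ) i).continuous.measurable

/-- The Palm measure of the law `P` of a stationary point process of intensity one:
`P°(A) = 𝔼 ∑_{x ∈ S ∩ [0,1)²} 1_A(S - x)`; see `palm_apply`. -/
def palm (P : Measure Config) : Measure Config :=
  P.bind fun s => (s.points.restrict unitSquare).map fun x => shift x s

lemma measurable_shift_left (s : Config) : Measurable fun x => shift x s :=
  measurable_shift.comp (measurable_id.prodMk measurable_const)

lemma palmKernel_apply (s : Config) {A : Set Config} (hA : MeasurableSet A) :
    ((s.points.restrict unitSquare).map fun x => shift x s) A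
      = s.points ({x | shift x s ∈ A} ∩ unitSquare) := by
  rw [Measure.map_apply (measurable_shift_left s) hA,
    Measure.restrict_apply (measurable_shift_left s hA)]
  rfl

lemma measurable_palmKernel :
    Measurable fun s : Config => (s.points.restrict unitSquare).map fun x => shift x s := by
  refine Measure.measurable_of_measurable_coe _ fun A hA => ?_
  simp only [palmKernel_apply _ hA]
  have hm : MeasurableSet {p : Config × Plane | shift p.2 p.1 ∈ A ∧ p.2 ∈ unitSquare} :=
    ((measurable_shift.comp measurable_swap) hA).inter (measurable_snd measurableSet_unitSquare)
  have h := Kernel.measurable_kernel_prodMk_left (κ := pointsKernel) hm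
  have he : (fun s : Config => pointsKernel s (Prod.mk s ⁻¹'
      {p : Config × Plane | shift p.2 p.1 ∈ A ∧ p.2 ∈ unitSquare}))
      = fun s : Config => s.points ({x | shift x s ∈ A} ∩ unitSquare) := by
    funext s
    exact congrArg s.points (Set.ext fun x => Iff.rfl)
  rwa [he] at h

theorem palm_apply (P : Measure Config) {A : Set Config} (hA : MeasurableSet A) :
    palm P A = ∫⁻ s : Config,
      (((s : Set Plane) ∩ ({x | shift x s ∈ A} ∩ unitSquare)).encard : ℝ≥0∞) ∂P := by
  rw [palm, Measure.bind_apply hA measurable_palmKernel.aemeasurable]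
  refine lintegral_congr fun s => ?_
  rw [palmKernel_apply s hA, points_apply]
  exact (measurable_shift_left s hA).inter measurableSet_unitSquare

/-! ### Voronoi cells and the Delaunay graph -/

/-- The Voronoi cell of the point `s` of the configuration `S`. -/
def vor (s : Plane) (S : Config) : Set Plane := {x | ∀ t ∈ S, dist x s ≤ dist x t}

/-- Two points of `S` are Voronoi neighbors if their cells intersect in a set of dimension one
(this set is convex, and its dimension is that of its affine span). -/
def IsNeighbor (s t : Plane) (S : Config) : Prop :=
  s ∈ S ∧ t ∈ S ∧ s ≠ t ∧ Module.finrank ℝ (vectorSpan ℝ (vor s S ∩ vor t S)) = 1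

open Classical in
/-- The conductances: the indicator that `s` and `t` are Voronoi neighbors in `S`. -/
def cond (s t : Plane) (S : Config) : ℝ := if IsNeighbor s t S then 1 else 0

/-- The number of neighbors of the origin. -/
def degreeZero (S : Config) : ℝ := ∑' t : S, cond 0 (t : Plane) S

/-- `c` is the lexicographically smallest among the points of `S` whose cell contains `x`. -/
def IsCenter (x : Plane) (S : Config) (c : Plane) : Prop :=
  c ∈ S ∧ x ∈ vor c S ∧
    ∀ t ∈ S, x ∈ vor t S → toLex (c 0, c 1) ≤ toLex (t 0, t 1)

open Classical in
/-- The center of the Voronoi cell containing `x`; ties are broken lexicographically. -/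
def cen (x : Plane) (S : Config) : Plane :=
  if h : ∃ c, IsCenter x S c then h.choose else 0

/-- The clockwise angle in `[0, 2π)` from the nonzero vector `v` to the nonzero vector `w`. -/
def cwAngle (v w : Plane) : ℝ :=
  if 0 ≤ Complex.arg (⟨v 0, v 1⟩ / ⟨w 0, w 1⟩) then Complex.arg (⟨v 0, v 1⟩ / ⟨w 0, w 1⟩)
  else Complex.arg (⟨v 0, v 1⟩ / ⟨w 0, w 1⟩) + 2 * Real.pi

/-- `t` is the first common neighbor of `s` and `s'` in the clockwise direction from `s' - s`. -/
def IsFirstCommonNeighbor (s s' : Plane) (S : Config) (t : Plane) : Prop :=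
  IsNeighbor s t S ∧ IsNeighbor s' t S ∧
    ∀ u, IsNeighbor s u S → IsNeighbor s' u S → cwAngle (s' - s) (t - s) ≤ cwAngle (s' - s) (u - s)

open Classical in
/-- The point `α₊(s, s')`; the value `s` is used only where there is no common neighbor. -/
def alphaPlus (s s' : Plane) (S : Config) : Plane :=
  if h : ∃ t, IsFirstCommonNeighbor s s' S t then h.choose else s

/-! ### Surfaces, fields and the space `𝓗` -/

/-- Surfaces `η(s, S)`; only the values with `s ∈ S` matter. -/
abbrev Surface : Type := Plane → Config → ℝ

/-- Fields `ζ(s, s', S)`; only the values with `s, s' ∈ S` matter. -/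
abbrev Field : Type := Plane → Plane → Config → ℝ

/-- The gradient of a surface. -/
def grad (η : Surface) : Field := fun s t S => cond s t S * (η t S - η s S)

/-- The Laplacian of a surface. -/
def laplacian (η : Surface) (s : Plane) (S : Config) : ℝ :=
  ∑' t : S, cond s (t : Plane) S * (η t S - η s S)

/-- `ζ` is covariant on the configuration `S`. -/
def IsCovariantOn (ζ : Field) (S : Config) : Prop :=
  ∀ s ∈ S, ∀ t ∈ S, ∀ u ∈ S, ζ (t - s) (u - s) (shift s S) = ζ t u S

/-- The mean `𝓒(ζ) = ½ 𝓔 ∑_{s ∈ S°} a(0, s) ζ(0, s)` of a nonnegative field. -/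
def campbell (P : Measure Config) (ζ : Plane → Plane → Config → ℝ≥0∞) : ℝ≥0∞ :=
  2⁻¹ * ∫⁻ S, ∑' t : S, ENNReal.ofReal (cond 0 (t : Plane) S) * ζ 0 t S ∂(palm P)

/-- `ζ` belongs to `𝓗 = L²(𝓒)` and is its covariant representative. The first clause is
measurability of the values on the edges at the origin, up to a null set. -/
structure MemH (P : Measure Config) (ζ : Field) : Prop where
  measurable : ∃ ζ' : Plane × Config → ℝ, Measurable ζ' ∧
    ∀ᵐ S : Config ∂(palm P), ∀ t, IsNeighbor 0 t S → ζ 0 t S = ζ' (t, S)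
  covariant : ∀ᵐ S : Config ∂(palm P), IsCovariantOn ζ S
  sq_integrable : campbell P (fun s t S => ENNReal.ofReal (ζ s t S ^ 2)) < ∞

/-- The surface `η` has tilt `v` on the configuration `S`: the increments of `η` along the
line through `x` in each coordinate direction, in both senses, have slope `v`, for almost every
site `x`. -/
def HasTilt (η : Surface) (S : Config) (v : Plane) : Prop :=
  ∀ᵐ x : Plane, ∀ i : Fin 2,
    Tendsto (fun K : ℝ =>
      (η (cen (x + K • EuclideanSpace.single i (1 : ℝ)) S) S - η (cen x S) S) / K)
      atTop (𝓝 (v i)) ∧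
    Tendsto (fun K : ℝ =>
      (η (cen (x + K • EuclideanSpace.single i (1 : ℝ)) S) S - η (cen x S) S) / K)
      atBot (𝓝 (v i))

/-! ### The point process -/

/-- `P` is the law of a stationary point process of intensity one that satisfies the
standing assumptions: mixing, general position (no four points on a circle), exponential moments of
the degree, second moment of the length of the boundary of the Voronoi cell, more than four moments
of the lengths of the edges, and aperiodicity. -/
structure StandingAssumptions (P : Measure Config) : Prop where
  prob : IsProbabilityMeasure P
  stationary : ∀ x, MeasurePreserving (shift x) P P
  intensity_one : ∫⁻ S : Config, (((S : Set Plane) ∩ unitSquare).encard : ℝ≥0∞) ∂P = 1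
  mixing : ∀ A B : Set Config, MeasurableSet A → MeasurableSet B →
    Tendsto (fun x : Plane => P (A ∩ shift x ⁻¹' B)) (cocompact Plane) (𝓝 (P A * P B))
  general_position : ∀ᵐ S : Config ∂P, ∀ (c : Plane) (r : ℝ),
    ((S : Set Plane) ∩ Metric.sphere c r).encard < 4
  degree_finite : ∀ᵐ S : Config ∂(palm P), {t | IsNeighbor 0 t S}.Finite
  degree_moment : ∃ β : ℝ, 0 < β ∧
    ∫⁻ S, ENNReal.ofReal (Real.exp (β * degreeZero S)) ∂(palm P) < ∞
  boundary_moment : ∫⁻ S, (μH[1] (frontier (vor 0 S))) ^ 2 ∂(palm P) < ∞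
  edge_moment : ∃ r : ℝ, 4 < r ∧
    ∫⁻ S, ∑' t : S, ENNReal.ofReal (cond 0 (t : Plane) S * ‖(t : Plane)‖ ^ r) ∂(palm P) < ∞
  aperiodic : ∀ᵐ S : Config ∂P, ∀ x : Plane, x ≠ 0 → shift x S ≠ S

/-! ### Deformations -/

/-- The `i`-th coordinate of a deformation, as a surface. -/
def coord (G : Plane → Config → Plane) (i : Fin 2) : Surface := fun s S => G s S i

/-- The `i`-th coordinate of the corrector `G(s) - s`. -/
def correctorCoord (G : Plane → Config → Plane) (i : Fin 2) : Surface := fun s S => (G s S - s) i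

/-- The `i`-th coordinate of `G` has tilt `e_i`, almost surely: the corrector is sublinear along
lines. -/
def HasIdentityTilt (P : Measure Config) (G : Plane → Config → Plane) : Prop :=
  ∀ᵐ S : Config ∂(palm P), ∀ i, HasTilt (coord G i) S (EuclideanSpace.single i (1 : ℝ))

/-- The competitors: deformations fixing the origin, with sublinear corrector whose coordinates
have gradient in `𝓗`. -/
structure IsDeformation (P : Measure Config) (G : Plane → Config → Plane) : Prop where
  zero : ∀ᵐ S : Config ∂(palm P), G 0 S = 0
  corrector : ∀ i, MemH P (grad (correctorCoord G i))
  tilt : HasIdentityTilt P G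

/-- `H` is the harmonic deformation of the Delaunay triangulation: it fixes the origin, and its
`i`-th coordinate is a harmonic surface with tilt `e_i` and with gradient in `𝓗`. -/
structure IsHarmonicDeformation (P : Measure Config) (H : Plane → Config → Plane) : Prop where
  zero : ∀ᵐ S : Config ∂(palm P), H 0 S = 0
  harmonic : ∀ᵐ S : Config ∂(palm P), ∀ s ∈ S, ∀ i, laplacian (coord H i) s S = 0
  gradient : ∀ i, MemH P (grad (coord H i))
  tilt : HasIdentityTilt P H

/-- The sum `∑_{s ∈ S} a(0, s) [G(s) · G(α₊(0, s))]`. -/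
def starSum (G : Plane → Config → Plane) (S : Config) : ℝ :=
  ∑' s : S, cond 0 (s : Plane) S * inner ℝ (G s S) (G (alphaPlus 0 s S) S)

end HarmonicDeformation

end

open HarmonicDeformation

/-! The argument has two halves: the mean star sum of a deformation is its Dirichlet energy, and the
harmonic deformation minimizes that energy.

Energy. Almost surely the points are in general position and every open half plane contains some.
Then each neighbor `s` of `0` spans with `α₊(0, s)` the Delaunay triangle on the clockwise side of
the edge, and `s ↦ α₊(0, s)` permutes the neighbors of `0`. Writing `x · y = ½(|x|² + |y|² - |x -
y|²)` and summing, the star sum becomes `∑ |G(s)|² - ½ ∑ |G(α₊(0, s)) - G(s)|²`. The second sum runs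
over the edges opposite to the origin. The Palm law with a marked point is invariant under
exchanging that point with the origin (`mass_transport`, `lintegral_exchange`), so both sums have
the same mean (`opposite_sq`), and the mean star sum is `½ 𝓔 ∑ a(0, s) |G(s)|²`
(`integral_starSum`).

Minimality. For a competitor `G` the field `f = ∇(g_i - h_i)` has zero tilt, and by Pythagoras it is
enough that it be orthogonal to `∇h_i` (`integral_mul_eq_zero`). A harmonic gradient is divergence
free and odd under the exchange, hence orthogonal to the gradients `Φ(S - t) - Φ(S)` of bounded
functions `Φ` of the configuration (`integral_mul_gradient`). The field `f` is a limit of such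
gradients in the sense needed. Averaging over `|y| < 1` the increments of its potential from the
cell of `n y` to the origin, truncated at `±ε n`, gives a bounded `Φ_n` whose gradient is `f`, up to
a constant factor, with two errors (`enorm_sub_smoothed_le`). One comes from truncation and vanishes
as `n → ∞`, because the potential is sublinear on average; the other comes from displacing the
cutoff by `t / n` and is of order `ε |t|`.

Sublinearity on average (`tendsto_badFraction`) follows from the tilt along lines: a far site is
reached from the origin by one leg along each axis, and by stationarity each leg has increment
`o(n)` in probability. Membership in `𝓗` makes only the values of a gradient on edges at the origin
measurable, so the potential is rebuilt measurably from them by sums over paths in the connected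
Delaunay graph (`potential_eq`). -/

namespace HarmonicDeformation
open Config

/-! ### Plane geometry of Voronoi cells -/

lemma dist_sq (x y : Plane) : dist x y ^ 2 = (x 0 - y 0) ^ 2 + (x 1 - y 1) ^ 2 := by
  rw [EuclideanSpace.dist_eq, Real.sq_sqrt (by positivity)]
  simp [Fin.sum_univ_two, Real.dist_eq, sq_abs]

lemma dist_le_iff {x y z w : Plane} : dist x y ≤ dist z w ↔
    (x 0 - y 0) ^ 2 + (x 1 - y 1) ^ 2 ≤ (z 0 - w 0) ^ 2 + (z 1 - w 1) ^ 2 := by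
  rw [← dist_sq, ← dist_sq]
  exact (pow_le_pow_iff_left₀ dist_nonneg dist_nonneg two_ne_zero).symm

lemma dist_eq_iff {x y z w : Plane} : dist x y = dist z w ↔
    (x 0 - y 0) ^ 2 + (x 1 - y 1) ^ 2 = (z 0 - w 0) ^ 2 + (z 1 - w 1) ^ 2 := by
  rw [le_antisymm_iff, le_antisymm_iff, dist_le_iff, dist_le_iff]

lemma dist_lt_iff {x y z w : Plane} : dist x y < dist z w ↔
    (x 0 - y 0) ^ 2 + (x 1 - y 1) ^ 2 < (z 0 - w 0) ^ 2 + (z 1 - w 1) ^ 2 := by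
  rw [← not_le, ← not_le, dist_le_iff]

lemma plane_ext {x y : Plane} (h0 : x 0 = y 0) (h1 : x 1 = y 1) : x = y := by
  ext i; fin_cases i <;> assumption

/-- The scalar product, in coordinates. -/
def dot (v w : Plane) : ℝ := v 0 * w 0 + v 1 * w 1

/-- The cross product, in coordinates. -/
def cross (v w : Plane) : ℝ := v 0 * w 1 - v 1 * w 0

/-- No four points of `S` lie on a circle. -/
def GeneralPosition (S : Config) : Prop :=
  ∀ (c : Plane) (r : ℝ), ((S : Set Plane) ∩ Metric.sphere c r).encard < 4

/-- Every open half plane meets `S`. -/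
def Spread (S : Config) : Prop :=
  ∀ (d : Plane) (c : ℝ), d ≠ 0 → ∃ x ∈ S, c < dot d x

lemma GeneralPosition.false_of_four {S : Config} (hS : GeneralPosition S) {x a b c d : Plane}
    (ha : a ∈ S) (hb : b ∈ S) (hc : c ∈ S) (hd : d ∈ S)
    (hab : dist x b = dist x a) (hac : dist x c = dist x a) (had : dist x d = dist x a)
    (h1 : a ≠ b) (h2 : a ≠ c) (h3 : a ≠ d) (h4 : b ≠ c) (h5 : b ≠ d) (h6 : c ≠ d) : False := by
  have hsub : ({a, b, c, d} : Set Plane) ⊆ (S : Set Plane) ∩ Metric.sphere x (dist x a) := by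
    rintro y (rfl | rfl | rfl | rfl)
    · exact ⟨ha, by rw [Metric.mem_sphere, dist_comm]⟩
    · exact ⟨hb, by rw [Metric.mem_sphere, dist_comm, hab]⟩
    · exact ⟨hc, by rw [Metric.mem_sphere, dist_comm, hac]⟩
    · exact ⟨hd, by rw [Metric.mem_sphere, dist_comm, had]⟩
  have h := (Set.encard_le_encard hsub).trans_lt (hS x (dist x a))
  rw [Set.encard_insert_of_notMem (by simp [h1, h2, h3]),
    Set.encard_insert_of_notMem (by simp [h4, h5]), Set.encard_pair h6] at h
  norm_num at h

/-- Local finiteness: only finitely many points lie within `r + 1` of `x`, so their distances cannot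
accumulate at `r` from above. -/
lemma exists_margin {S : Config} (x : Plane) (r : ℝ) :
    ∃ δ : ℝ, 0 < δ ∧ ∀ v ∈ S, r < dist x v → r + δ ≤ dist x v := by
  have hfin := S.finite_inter_coe (Metric.isBounded_closedBall (x := x) (r := r + 1))
  have key : ∀ F : Set Plane, F.Finite → ∃ δ : ℝ, 0 < δ ∧ ∀ v ∈ F, r < dist x v → r + δ ≤ dist x v := by
    intro F hF
    induction F, hF using Set.Finite.induction_on with
    | empty => exact ⟨1, one_pos, by simp⟩
    | @insert a F _ _ ih =>
      obtain ⟨δ, hδ, h⟩ := ih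
      by_cases ha : r < dist x a
      · refine ⟨min δ (dist x a - r), lt_min hδ (by linarith), ?_⟩
        rintro v (rfl | hv) hr
        · linarith [min_le_right δ (dist x v - r)]
        · linarith [min_le_left δ (dist x a - r), h v hv hr]
      · refine ⟨δ, hδ, ?_⟩
        rintro v (rfl | hv) hr
        · exact absurd hr ha
        · exact h v hv hr
  obtain ⟨δ, hδ, h⟩ := key _ hfin
  refine ⟨min δ 1, lt_min hδ one_pos, fun v hv hr => ?_⟩
  by_cases hv1 : dist x v ≤ r + 1
  · have := h v ⟨hv, by simpa [dist_comm] using hv1⟩ hr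
    linarith [min_le_left δ 1]
  · linarith [min_le_right δ 1]

/-- A point of a cell can be moved in a direction that does not approach any competitor on its
circle. -/
lemma exists_move {S : Config} {s x d : Plane} (hx : x ∈ vor s S)
    (h : ∀ v ∈ S, dist x v = dist x s → dot d (v - s) ≤ 0) :
    ∃ ε : ℝ, 0 < ε ∧ x + ε • d ∈ vor s S := by
  obtain ⟨δ, hδ, hm⟩ := exists_margin (S := S) x (dist x s)
  have hd : 0 < ‖d‖ + 1 := by positivity
  -- The displacement has length at most `δ / 2`, so a competitor farther than `s` by `δ` stays at
  -- least as far; the `+ 1` allows `d = 0`.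
  refine ⟨δ / 2 / (‖d‖ + 1), by positivity, fun v hv => ?_⟩
  set ε := δ / 2 / (‖d‖ + 1) with hε
  have hε0 : 0 < ε := by positivity
  have hxy : dist x (x + ε • d) ≤ δ / 2 := by
    rw [dist_self_add_right, norm_smul, Real.norm_of_nonneg hε0.le, hε, div_mul_eq_mul_div,
      div_le_iff₀ hd]
    nlinarith [norm_nonneg d]
  rcases (hx v hv).eq_or_lt with he | hl
  · have h1 := h v hv he.symm
    have h2 := dist_eq_iff.1 he
    rw [dist_le_iff]
    simp only [dot, PiLp.sub_apply, PiLp.add_apply, PiLp.smul_apply, smul_eq_mul] at *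
    nlinarith
  · have := hm v hv hl
    have t1 := dist_triangle (x + ε • d) x s
    have t2 := dist_triangle x (x + ε • d) v
    rw [dist_comm (x + ε • d) x] at t1
    linarith

lemma isClosed_vor (s : Plane) (S : Config) : IsClosed (vor s S) := by
  have : vor s S = ⋂ t ∈ S, {x | dist x s ≤ dist x t} := by ext; simp [vor]
  rw [this]
  exact isClosed_biInter fun t _ =>
    isClosed_le (continuous_id.dist continuous_const) (continuous_id.dist continuous_const)

/-- On leaving a cell along a ray one meets a competitor in front. -/
lemma exists_exit {S : Config} {s p d : Plane} (hp : p ∈ vor s S) {l : ℝ} (hl : 0 ≤ l)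
    (hout : p + l • d ∉ vor s S) :
    ∃ m, 0 ≤ m ∧ m < l ∧ p + m • d ∈ vor s S ∧
      ∃ w ∈ S, dist (p + m • d) w = dist (p + m • d) s ∧ 0 < dot d (w - s) := by
  set A : Set ℝ := {m | p + m • d ∈ vor s S} with hA
  have hAc : IsClosed A := (isClosed_vor s S).preimage (by fun_prop)
  have hK : IsCompact (A ∩ Set.Icc 0 l) := isCompact_Icc.inter_left hAc
  obtain ⟨m, ⟨hmA, hm0, hml⟩, hmax⟩ := hK.exists_isGreatest
    ⟨0, by simpa [hA] using hp, le_rfl, hl⟩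
  have hml' : m < l := hml.lt_of_ne fun h => hout (h ▸ hmA)
  refine ⟨m, hm0, hml', hmA, ?_⟩
  by_contra! hcon
  -- If no equidistant competitor lay in front, the last point of the ray in the cell could be moved
  -- forward. Convexity of the cell lets the move be shortened to stay before `l`, which contradicts
  -- maximality of `m`.
  have hconv : ∀ ε : ℝ, 0 < ε → p + m • d + ε • d ∈ vor s S → ∀ e : ℝ, 0 ≤ e → e ≤ ε →
      p + m • d + e • d ∈ vor s S := by
    intro ε hε h e he heε v hv
    have h1 := dist_le_iff.1 (h v hv)
    have h2 := dist_le_iff.1 (hmA v hv)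
    rw [dist_le_iff]
    simp only [PiLp.add_apply, PiLp.smul_apply, smul_eq_mul] at *
    have h3 := mul_le_mul_of_nonneg_left h1 he
    have h4 := mul_le_mul_of_nonneg_left h2 (sub_nonneg.2 heε)
    refine le_of_mul_le_mul_left ?_ hε
    nlinarith
  obtain ⟨ε, hε, hmem⟩ := exists_move hmA hcon
  have hmin : 0 < min ε (l - m) := lt_min hε (by linarith)
  have := hconv ε hε hmem (min ε (l - m)) hmin.le (min_le_left _ _)
  rw [add_assoc, ← add_smul] at this
  have := hmax ⟨this, by linarith, by linarith [min_le_right ε (l - m)]⟩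
  linarith

/-- In general position, two cells that meet are neighbors. -/
lemma GeneralPosition.isNeighbor {S : Config} (hS : GeneralPosition S) {s w x : Plane}
    (hs : s ∈ S) (hw : w ∈ S) (hne : s ≠ w) (hxs : x ∈ vor s S) (hxw : x ∈ vor w S) :
    IsNeighbor s w S := by
  refine ⟨hs, hw, hne, ?_⟩
  have heq : dist x s = dist x w := le_antisymm (hxs w hw) (hxw s hs)
  -- The direction of the bisector of `s` and `w`, on which both cells can only meet.
  set d₀ : Plane := !₂[w 1 - s 1, -(w 0 - s 0)] with hd₀
  have hd00 : d₀ 0 = w 1 - s 1 := by simp [hd₀]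
  have hd01 : d₀ 1 = -(w 0 - s 0) := by simp [hd₀]
  have hd0 : d₀ ≠ 0 := by
    intro h
    apply hne
    have a0 : d₀ 0 = 0 := by simp [h]
    have a1 : d₀ 1 = 0 := by simp [h]
    exact plane_ext (by linarith) (by linarith)
  have hsign : ∃ d : Plane, (d = d₀ ∨ d = -d₀) ∧
      ∀ v ∈ S, dist x v = dist x s → dot d (v - s) ≤ 0 := by
    -- If both senses along the bisector are blocked, the blocking points lie strictly on opposite
    -- sides of the line through `s` and `w`, and give with `s` and `w` four points on one circle.
    by_contra! hcon
    obtain ⟨v, hv, hvx, hv0⟩ := hcon d₀ (Or.inl rfl)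
    obtain ⟨u, hu, hux, hu0⟩ := hcon (-d₀) (Or.inr rfl)
    simp only [dot, PiLp.sub_apply, PiLp.neg_apply, hd00, hd01] at hv0 hu0
    refine hS.false_of_four hs hw hv hu heq.symm hvx hux hne ?_ ?_ ?_ ?_ ?_
    · rintro rfl; linarith
    · rintro rfl; linarith
    · rintro rfl; nlinarith
    · rintro rfl; nlinarith
    · rintro rfl; linarith
  obtain ⟨d, hd, hdv⟩ := hsign
  obtain ⟨ε, hε, hmove⟩ := exists_move hxs hdv
  have hdw : dot d (w - s) = 0 := by
    rcases hd with rfl | rfl <;> simp only [dot, PiLp.sub_apply, PiLp.neg_apply, hd00, hd01] <;> ring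
  have hmovew : x + ε • d ∈ vor w S := by
    intro v hv
    refine le_trans (le_of_eq ?_) (hmove v hv)
    rw [dist_eq_iff] at heq ⊢
    simp only [dot, PiLp.sub_apply, PiLp.add_apply, PiLp.smul_apply, smul_eq_mul] at *
    linear_combination -heq - 2 * ε * hdw
  have hdne : d ≠ 0 := by rcases hd with rfl | rfl <;> simpa using hd0
  have hspan : vectorSpan ℝ (vor s S ∩ vor w S) = Submodule.span ℝ {d} := by
    refine le_antisymm ?_ ?_
    · rw [vectorSpan_def, Submodule.span_le]
      rintro _ ⟨y, hy, z, hz, rfl⟩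
      have ey := dist_eq_iff.1 (le_antisymm (hy.1 w hw) (hy.2 s hs))
      have ez := dist_eq_iff.1 (le_antisymm (hz.1 w hw) (hz.2 s hs))
      have hmem : ∀ q : Plane, q 0 * (w 0 - s 0) + q 1 * (w 1 - s 1) = 0 →
          q ∈ Submodule.span ℝ {d₀} := by
        intro q hq
        rw [Submodule.mem_span_singleton]
        have hpos : (w 0 - s 0) ^ 2 + (w 1 - s 1) ^ 2 ≠ 0 := by
          intro h
          apply hne
          exact plane_ext (by nlinarith) (by nlinarith)
        refine ⟨(q 0 * (w 1 - s 1) - q 1 * (w 0 - s 0)) /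
          ((w 0 - s 0) ^ 2 + (w 1 - s 1) ^ 2), plane_ext ?_ ?_⟩
        · simp only [PiLp.smul_apply, smul_eq_mul, hd00]
          field_simp
          linear_combination -(w 0 - s 0) * hq
        · simp only [PiLp.smul_apply, smul_eq_mul, hd01]
          field_simp
          linear_combination -(w 1 - s 1) * hq
      have hsp : Submodule.span ℝ {d} = Submodule.span ℝ {d₀} := by
        rcases hd with rfl | rfl
        · rfl
        · rw [← Set.neg_singleton, Submodule.span_neg]
      rw [SetLike.mem_coe, hsp]
      apply hmem
      simp only [vsub_eq_sub, PiLp.sub_apply]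
      linarith
    · rw [Submodule.span_singleton_le_iff_mem]
      have := vsub_mem_vectorSpan ℝ (s := vor s S ∩ vor w S) ⟨hmove, hmovew⟩ ⟨hxs, hxw⟩
      rw [vsub_eq_sub, add_sub_cancel_left] at this
      have h2 := Submodule.smul_mem _ ε⁻¹ this
      rwa [smul_smul, inv_mul_cancel₀ hε.ne', one_smul] at h2
  rw [hspan, finrank_span_singleton hdne]

lemma IsNeighbor.exists_mem {S : Config} {s t : Plane} (h : IsNeighbor s t S) :
    ∃ x, x ∈ vor s S ∧ x ∈ vor t S := by
  by_contra! hcon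
  have : vor s S ∩ vor t S = ∅ := by
    ext x; simpa using hcon x
  have h4 := h.2.2.2
  rw [this, vectorSpan_empty, finrank_bot] at h4
  exact zero_ne_one h4

lemma IsNeighbor.symm {S : Config} {s t : Plane} (h : IsNeighbor s t S) : IsNeighbor t s S :=
  ⟨h.2.1, h.1, h.2.2.1.symm, by rw [Set.inter_comm]; exact h.2.2.2⟩

/-- Greedy routing: some neighbor of `s` is closer to the target. -/
lemma GeneralPosition.exists_closer {S : Config} (hS : GeneralPosition S) {s t : Plane}
    (hs : s ∈ S) (ht : t ∈ S) (hne : s ≠ t) :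
    ∃ w, IsNeighbor s w S ∧ dist w t < dist s t := by
  have hp : s ∈ vor s S := fun v _ => by simp
  have hout : s + (1 : ℝ) • (t - s) ∉ vor s S := by
    intro h
    have := h t ht
    simp only [one_smul, add_sub_cancel, dist_self] at this
    exact hne (dist_le_zero.1 this).symm
  obtain ⟨m, hm0, hm1, hmem, w, hw, hwd, hwp⟩ := exists_exit hp zero_le_one hout
  have hne' : s ≠ w := by
    rintro rfl
    simp [dot] at hwp
  refine ⟨w, hS.isNeighbor hs hw hne' hmem fun v hv => hwd.trans_le (hmem v hv), ?_⟩
  -- At the exit point `s` and `w` are equidistant; over the remaining fraction `1 - m` of the way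
  -- to `t` the squared distance to `w` minus that to `s` drops by `2 (1 - m) d · (w - s) > 0`, with
  -- `d = t - s`.
  rw [dist_eq_iff] at hwd
  rw [dist_lt_iff]
  simp only [dot, PiLp.sub_apply, PiLp.add_apply, PiLp.smul_apply, smul_eq_mul] at *
  nlinarith [mul_pos (sub_pos.2 hm1) hwp]

/-- Greedy routing terminates: each step to a neighbor closer to `t` strictly decreases the finite
number of points nearer to `t` than the current one. -/
lemma GeneralPosition.connected {S : Config} (hS : GeneralPosition S) {s t : Plane}
    (hs : s ∈ S) (ht : t ∈ S) : Relation.ReflTransGen (fun a b => IsNeighbor a b S) s t := by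
  have hfin : ∀ r, ((S : Set Plane) ∩ Metric.ball t r).Finite := fun r =>
    S.finite_inter_coe Metric.isBounded_ball
  induction hn : ((S : Set Plane) ∩ Metric.ball t (dist s t)).ncard using Nat.strong_induction_on
    generalizing s with
  | _ n ih =>
    by_cases hne : s = t
    · exact hne ▸ Relation.ReflTransGen.refl
    obtain ⟨w, hsw, hlt⟩ := hS.exists_closer hs ht hne
    refine Relation.ReflTransGen.head hsw (ih _ ?_ hsw.2.1 rfl)
    rw [← hn]
    refine Set.ncard_lt_ncard ⟨?_, ?_⟩ (hfin _)
    · exact Set.inter_subset_inter_right _ (Metric.ball_subset_ball hlt.le)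
    · intro h
      have := (h ⟨hsw.2.1, hlt⟩).2
      simp at this

/-! ### Delaunay triangles -/

/-- The circumcenter of a nondegenerate triangle, in coordinates. -/
noncomputable def circumcenter (s t u : Plane) : Plane :=
  !₂[s 0 + ((u 1 - s 1) * ((t 0 - s 0) ^ 2 + (t 1 - s 1) ^ 2)
        - (t 1 - s 1) * ((u 0 - s 0) ^ 2 + (u 1 - s 1) ^ 2)) / (2 * cross (t - s) (u - s)),
     s 1 + ((t 0 - s 0) * ((u 0 - s 0) ^ 2 + (u 1 - s 1) ^ 2)
        - (u 0 - s 0) * ((t 0 - s 0) ^ 2 + (t 1 - s 1) ^ 2)) / (2 * cross (t - s) (u - s))]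

lemma dist_circumcenter {s t u : Plane} (h : cross (t - s) (u - s) ≠ 0) :
    dist (circumcenter s t u) t = dist (circumcenter s t u) s ∧
      dist (circumcenter s t u) u = dist (circumcenter s t u) s := by
  have h0 : circumcenter s t u 0 = s 0 + ((u 1 - s 1) * ((t 0 - s 0) ^ 2 + (t 1 - s 1) ^ 2)
        - (t 1 - s 1) * ((u 0 - s 0) ^ 2 + (u 1 - s 1) ^ 2)) / (2 * cross (t - s) (u - s)) := by
    simp [circumcenter]
  have h1 : circumcenter s t u 1 = s 1 + ((t 0 - s 0) * ((u 0 - s 0) ^ 2 + (u 1 - s 1) ^ 2)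
        - (u 0 - s 0) * ((t 0 - s 0) ^ 2 + (t 1 - s 1) ^ 2)) / (2 * cross (t - s) (u - s)) := by
    simp [circumcenter]
  have hc : cross (t - s) (u - s) =
    (t 0 - s 0) * (u 1 - s 1) - (t 1 - s 1) * (u 0 - s 0) := by simp [cross]
  rw [dist_eq_iff, dist_eq_iff]
  generalize circumcenter s t u = c at *
  generalize cross (t - s) (u - s) = D at *
  have e0 : 2 * D * (c 0 - s 0) = (u 1 - s 1) * ((t 0 - s 0) ^ 2 + (t 1 - s 1) ^ 2)
        - (t 1 - s 1) * ((u 0 - s 0) ^ 2 + (u 1 - s 1) ^ 2) := by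
    rw [h0, add_sub_cancel_left, mul_div_cancel₀ _ (mul_ne_zero two_ne_zero h)]
  have e1 : 2 * D * (c 1 - s 1) = (t 0 - s 0) * ((u 0 - s 0) ^ 2 + (u 1 - s 1) ^ 2)
        - (u 0 - s 0) * ((t 0 - s 0) ^ 2 + (t 1 - s 1) ^ 2) := by
    rw [h1, add_sub_cancel_left, mul_div_cancel₀ _ (mul_ne_zero two_ne_zero h)]
  constructor <;> refine mul_left_cancel₀ h ?_
  · linear_combination -(t 0 - s 0) * e0 - (t 1 - s 1) * e1 +
      ((t 0 - s 0) ^ 2 + (t 1 - s 1) ^ 2) * hc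
  · linear_combination -(u 0 - s 0) * e0 - (u 1 - s 1) * e1 +
      ((u 0 - s 0) ^ 2 + (u 1 - s 1) ^ 2) * hc

/-- Equidistance from three points is a linear system of determinant proportional to the cross
product; the coefficients below are those of Cramer's rule. -/
lemma eq_circumcenter {s t u x : Plane} (h : cross (t - s) (u - s) ≠ 0)
    (ht : dist x t = dist x s) (hu : dist x u = dist x s) : x = circumcenter s t u := by
  obtain ⟨h1, h2⟩ := dist_circumcenter h
  rw [dist_eq_iff] at *
  generalize circumcenter s t u = c at *
  simp only [cross, PiLp.sub_apply] at h
  refine plane_ext (mul_left_cancel₀ h ?_) (mul_left_cancel₀ h ?_)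
  · linear_combination (-(u 1 - s 1) * (ht - h1) + (t 1 - s 1) * (hu - h2)) / 2
  · linear_combination ((u 0 - s 0) * (ht - h1) - (t 0 - s 0) * (hu - h2)) / 2

/-- `s, t, u` are, in clockwise order, the vertices of a Delaunay triangle of `S`. -/
def Tri (s t u : Plane) (S : Config) : Prop :=
  s ∈ S ∧ t ∈ S ∧ u ∈ S ∧ cross (t - s) (u - s) < 0 ∧ circumcenter s t u ∈ vor s S

lemma tri_of_equidistant {S : Config} {s t u x : Plane} (hs : s ∈ S) (ht : t ∈ S) (hu : u ∈ S)
    (hc : cross (t - s) (u - s) < 0) (hx : x ∈ vor s S)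
    (hxt : dist x t = dist x s) (hxu : dist x u = dist x s) : Tri s t u S :=
  ⟨hs, ht, hu, hc, eq_circumcenter hc.ne hxt hxu ▸ hx⟩

lemma cross_rotate (s t u : Plane) : cross (u - t) (s - t) = cross (t - s) (u - s) := by
  simp only [cross, PiLp.sub_apply]; ring

lemma Tri.rotate {S : Config} {s t u : Plane} (h : Tri s t u S) : Tri t u s S := by
  obtain ⟨hs, ht, hu, hc, hx⟩ := h
  obtain ⟨h1, h2⟩ := dist_circumcenter hc.ne
  refine tri_of_equidistant ht hu hs ((cross_rotate s t u).trans_lt hc)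
    (x := circumcenter s t u) ?_ (h2.trans h1.symm) h1.symm
  intro v hv
  exact h1.trans_le (hx v hv)

lemma Tri.isNeighbor {S : Config} (hS : GeneralPosition S) {s t u : Plane} (h : Tri s t u S) :
    IsNeighbor s t S := by
  obtain ⟨hs, ht, hu, hc, hx⟩ := h
  obtain ⟨h1, h2⟩ := dist_circumcenter hc.ne
  refine hS.isNeighbor hs ht ?_ hx fun v hv => h1.trans_le (hx v hv)
  rintro rfl
  simp [cross] at hc

/-- From a common point of the two cells, follow the bisector towards the clockwise side. A point
far in that direction eventually becomes closer than `s`, so the ray leaves the cell of `s`. The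
competitor met at the exit is cocircular with `s` and `t`, hence is the third vertex. -/
lemma Spread.exists_tri {S : Config} (hS : Spread S) {s t : Plane} (h : IsNeighbor s t S) :
    ∃ u, Tri s t u S := by
  obtain ⟨p, hps, hpt⟩ := h.exists_mem
  obtain ⟨hs, ht, hne, -⟩ := h
  have heq : dist p s = dist p t := le_antisymm (hps t ht) (hpt s hs)
  set d : Plane := !₂[t 1 - s 1, -(t 0 - s 0)] with hd
  have hd0 : d 0 = t 1 - s 1 := by simp [hd]
  have hd1 : d 1 = -(t 0 - s 0) := by simp [hd]
  have hdne : d ≠ 0 := by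
    intro h
    have a0 : d 0 = 0 := by simp [h]
    have a1 : d 1 = 0 := by simp [h]
    exact hne (plane_ext (by linarith) (by linarith))
  obtain ⟨v, hv, hvs⟩ := hS d (dot d s) hdne
  obtain ⟨l, hl0, hl⟩ : ∃ l : ℝ, 0 ≤ l ∧ p + l • d ∉ vor s S := by
    have hpos : 0 < dot d v - dot d s := by linarith
    have hpv := hps v hv
    set C := (p 0 - v 0) ^ 2 + (p 1 - v 1) ^ 2 - ((p 0 - s 0) ^ 2 + (p 1 - s 1) ^ 2) with hC
    have hC0 : 0 ≤ C := by rw [dist_le_iff] at hpv; linarith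
    -- The excess of the squared distance to `v` over that to `s` is `C` at `p` and `C - 2 l (d · v
    -- - d · s)` after a displacement `l d`; this choice makes it `-C - 2 < 0`.
    refine ⟨(C + 1) / (dot d v - dot d s), by positivity, fun hcon => ?_⟩
    have h1 := hcon v hv
    rw [dist_le_iff] at h1
    set l := (C + 1) / (dot d v - dot d s) with hl
    have h2 : l * (dot d v - dot d s) = C + 1 := div_mul_cancel₀ _ hpos.ne'
    simp only [dot, PiLp.add_apply, PiLp.smul_apply, smul_eq_mul] at *
    linarith
  obtain ⟨m, -, -, hmem, w, hw, hwd, hwp⟩ := exists_exit hps hl0 hl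
  refine ⟨w, tri_of_equidistant hs ht hw ?_ hmem ?_ hwd⟩
  · simp only [dot, cross, PiLp.sub_apply, hd0, hd1] at *
    linarith
  · rw [dist_eq_iff] at heq ⊢
    simp only [PiLp.add_apply, PiLp.smul_apply, smul_eq_mul, hd0, hd1] at *
    linear_combination -heq

/-- No Delaunay edge leaves a vertex of a Delaunay triangle into its opposite side. -/
lemma Tri.not_inside {S : Config} (hS : GeneralPosition S) {s t u v : Plane} (h : Tri s t u S)
    (hv : IsNeighbor s v S) (hvt : v ≠ t) (hvu : v ≠ u)
    (h1 : cross (v - s) (u - s) ≤ 0) (h2 : cross (t - s) (v - s) ≤ 0) : False := by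
  have hst := h.isNeighbor hS
  have htu := h.rotate.isNeighbor hS
  have hus := h.rotate.rotate.isNeighbor hS
  obtain ⟨c, hcs, hcv⟩ := hv.exists_mem
  obtain ⟨hs, ht, hu, hc, hx⟩ := h
  obtain ⟨e1, e2⟩ := dist_circumcenter hc.ne
  generalize circumcenter s t u = x at *
  have k1 := dist_le_iff.1 (hcs t ht)
  have k2 := dist_le_iff.1 (hcs u hu)
  have k3 := dist_le_iff.1 (hcv s hs)
  have k4 := dist_le_iff.1 (hx v hv.2.1)
  have e1' := dist_eq_iff.1 e1
  have e2' := dist_eq_iff.1 e2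
  refine hS.false_of_four hs ht hu hv.2.1 e1 e2 (le_antisymm ?_ (hx v hv.2.1))
    hst.2.2.1 hus.2.2.1.symm hv.2.2.1 htu.2.2.1 hvt.symm hvu.symm
  rw [dist_le_iff]
  simp only [cross, PiLp.sub_apply] at hc h1 h2
  -- By Cramer `D (v - s) = A (t - s) + B (u - s)`, so the signs place `v` in the cone spanned by
  -- the two sides at `s`.
  obtain ⟨D, hD⟩ : ∃ D, D = (t 0 - s 0) * (u 1 - s 1) - (t 1 - s 1) * (u 0 - s 0) := ⟨_, rfl⟩
  obtain ⟨A, hA⟩ : ∃ A, A = (v 0 - s 0) * (u 1 - s 1) - (v 1 - s 1) * (u 0 - s 0) := ⟨_, rfl⟩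
  obtain ⟨B, hB⟩ : ∃ B, B = (t 0 - s 0) * (v 1 - s 1) - (t 1 - s 1) * (v 0 - s 0) := ⟨_, rfl⟩
  rw [← hD] at hc
  rw [← hA] at h1
  rw [← hB] at h2
  have m1 : A * (((c 0 - t 0) ^ 2 + (c 1 - t 1) ^ 2) - ((c 0 - s 0) ^ 2 + (c 1 - s 1) ^ 2)) ≤ 0 :=
    mul_nonpos_of_nonpos_of_nonneg h1 (by linarith)
  have m2 : B * (((c 0 - u 0) ^ 2 + (c 1 - u 1) ^ 2) - ((c 0 - s 0) ^ 2 + (c 1 - s 1) ^ 2)) ≤ 0 :=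
    mul_nonpos_of_nonpos_of_nonneg h2 (by linarith)
  have m3 : D * (((c 0 - s 0) ^ 2 + (c 1 - s 1) ^ 2) - ((c 0 - v 0) ^ 2 + (c 1 - v 1) ^ 2)) ≤ 0 :=
    mul_nonpos_of_nonpos_of_nonneg hc.le (by linarith)
  -- Put `F_z(q) = |z - q|² - |z - s|²`. The difference `F_c - F_x` is linear in `q - s`, and `F_x`
  -- vanishes at `t` and `u`; hence `D (F_c(v) - F_x(v)) = A F_c(t) + B F_c(u)`. The signs force
  -- `F_x(v) ≤ F_c(v) ≤ 0`, so `v` lies on the empty circle through `s`, `t`, `u`.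
  have key : D * (((c 0 - v 0) ^ 2 + (c 1 - v 1) ^ 2) - ((c 0 - s 0) ^ 2 + (c 1 - s 1) ^ 2)
      - (((x 0 - v 0) ^ 2 + (x 1 - v 1) ^ 2) - ((x 0 - s 0) ^ 2 + (x 1 - s 1) ^ 2)))
    = A * (((c 0 - t 0) ^ 2 + (c 1 - t 1) ^ 2) - ((c 0 - s 0) ^ 2 + (c 1 - s 1) ^ 2))
      + B * (((c 0 - u 0) ^ 2 + (c 1 - u 1) ^ 2) - ((c 0 - s 0) ^ 2 + (c 1 - s 1) ^ 2)) := by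
    subst hD hA hB
    linear_combination (-((v 0 - s 0) * (u 1 - s 1) - (v 1 - s 1) * (u 0 - s 0))) * e1' +
      (-((t 0 - s 0) * (v 1 - s 1) - (t 1 - s 1) * (v 0 - s 0))) * e2'
  refine le_of_mul_le_mul_left ?_ (neg_pos.2 hc)
  linarith

/-- Two triangles on the same side of `s t` would have nested angles at `s`, so an edge of one would
enter the other. -/
lemma Tri.unique {S : Config} (hS : GeneralPosition S) {s t u v : Plane} (h : Tri s t u S)
    (h' : Tri s t v S) : v = u := by
  by_contra hne
  have hsv := (h'.rotate.rotate.isNeighbor hS).symm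
  have hsu := (h.rotate.rotate.isNeighbor hS).symm
  have htv := h'.rotate.isNeighbor hS
  have htu := h.rotate.isNeighbor hS
  rcases le_total (cross (v - s) (u - s)) 0 with h0 | h0
  · exact h.not_inside hS hsv htv.2.2.1.symm hne h0 h'.2.2.2.1.le
  · refine h'.not_inside hS hsu htu.2.2.1.symm (Ne.symm hne) ?_ h.2.2.2.1.le
    simp only [cross] at *; linarith

/-! ### Clockwise angles and the first common neighbor -/

/-- The clockwise angle from `a` to `b` lies in `(0, π)`, and the excluded condition on `c`
describes the closed cone between `a` and `b`. If the argument for `c` is negative, its angle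
exceeds `π`; otherwise the sine of the difference of the two arguments is positive. -/
lemma cwAngle_lt {a b c : Plane} (hb : cross a b < 0)
    (hc : ¬ (cross c b ≤ 0 ∧ cross a c ≤ 0)) (hc0 : c ≠ 0) : cwAngle a b < cwAngle a c := by
  set z : ℂ := ⟨a 0, a 1⟩ / ⟨b 0, b 1⟩ with hz
  set w : ℂ := ⟨a 0, a 1⟩ / ⟨c 0, c 1⟩ with hw
  have hb0 : b ≠ 0 := by rintro rfl; simp [cross] at hb
  have hn : ∀ q : Plane, q ≠ 0 → 0 < q 0 * q 0 + q 1 * q 1 := by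
    intro q hq
    by_contra! h
    exact hq (plane_ext (by simp; nlinarith [mul_self_nonneg (q 0), mul_self_nonneg (q 1)])
      (by simp; nlinarith [mul_self_nonneg (q 0), mul_self_nonneg (q 1)]))
  have hnb := hn b hb0
  have hnc := hn c hc0
  have hzim : z.im = -cross a b / (b 0 * b 0 + b 1 * b 1) := by
    rw [hz, Complex.div_im]; simp only [Complex.normSq_mk, cross]; ring
  have hzre : z.re = dot a b / (b 0 * b 0 + b 1 * b 1) := by
    rw [hz, Complex.div_re]; simp only [Complex.normSq_mk, dot]; ring
  have hwim : w.im = -cross a c / (c 0 * c 0 + c 1 * c 1) := by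
    rw [hw, Complex.div_im]; simp only [Complex.normSq_mk, cross]; ring
  have hwre : w.re = dot a c / (c 0 * c 0 + c 1 * c 1) := by
    rw [hw, Complex.div_re]; simp only [Complex.normSq_mk, dot]; ring
  have hzpos : 0 < z.im := by rw [hzim]; exact div_pos (by linarith) hnb
  have hz0 : 0 ≤ z.arg := Complex.arg_nonneg_iff.2 hzpos.le
  have hzpi : z.arg < Real.pi := by
    refine (Complex.arg_le_pi z).lt_of_ne fun h => ?_
    exact hzpos.ne' (Complex.arg_eq_pi_iff.1 h).2
  have e1 : cwAngle a b = z.arg := by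
    rw [cwAngle, if_pos hz0]
  rw [e1, cwAngle]
  change z.arg < if 0 ≤ w.arg then w.arg else w.arg + 2 * Real.pi
  split_ifs with hw0
  swap
  · have := Complex.neg_pi_lt_arg w
    linarith
  have hwim0 := Complex.arg_nonneg_iff.1 hw0
  have hac : cross a c ≤ 0 := by
    rw [hwim] at hwim0
    by_contra! h
    exact absurd hwim0 (not_le.2 (div_neg_of_neg_of_pos (by linarith) hnc))
  have hcb : 0 < cross c b := by
    by_contra! h
    exact hc ⟨h, hac⟩
  have ha0 : a ≠ 0 := by rintro rfl; simp [cross] at hb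
  have hna := hn a ha0
  -- Up to positive factors this determinant is `cross c b`, and it is also the sine of `w.arg -
  -- z.arg`.
  have hdet : 0 < w.im * z.re - w.re * z.im := by
    rw [hwim, hwre, hzim, hzre]
    have : -cross a c / (c 0 * c 0 + c 1 * c 1) * (dot a b / (b 0 * b 0 + b 1 * b 1)) -
      dot a c / (c 0 * c 0 + c 1 * c 1) * (-cross a b / (b 0 * b 0 + b 1 * b 1)) =
      (a 0 * a 0 + a 1 * a 1) * cross c b /
        ((c 0 * c 0 + c 1 * c 1) * (b 0 * b 0 + b 1 * b 1)) := by
      field_simp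
      simp only [cross, dot]
      ring
    rw [this]
    positivity
  have hsin : 0 < ‖w‖ * ‖z‖ * Real.sin (w.arg - z.arg) := by
    rw [Real.sin_sub]
    have a1 := Complex.norm_mul_cos_arg w
    have a2 := Complex.norm_mul_sin_arg w
    have a3 := Complex.norm_mul_cos_arg z
    have a4 := Complex.norm_mul_sin_arg z
    rw [← a1, ← a2, ← a3, ← a4] at hdet
    linarith
  by_contra! hle
  have := Real.sin_nonpos_of_nonpos_of_neg_pi_le (x := w.arg - z.arg) (by linarith) (by linarith)
  exact absurd hsin (not_lt.2 (mul_nonpos_of_nonneg_of_nonpos (by positivity) this))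

lemma Tri.cwAngle_lt {S : Config} (hS : GeneralPosition S) {s t u v : Plane} (h : Tri s t u S)
    (hs : IsNeighbor s v S) (ht : IsNeighbor t v S) (hvu : v ≠ u) :
    cwAngle (t - s) (u - s) < cwAngle (t - s) (v - s) :=
  HarmonicDeformation.cwAngle_lt h.2.2.2.1
    (fun hc => h.not_inside hS hs ht.2.2.1.symm hvu hc.1 hc.2)
    (sub_ne_zero.2 hs.2.2.1.symm)

/-- No edge at `s` enters the triangle, so every other common neighbor of `s` and `t` comes later in
the clockwise order than the third vertex. -/
lemma Tri.alphaPlus_eq {S : Config} (hS : GeneralPosition S) {s t u : Plane} (h : Tri s t u S) :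
    alphaPlus s t S = u := by
  have hsu := (h.rotate.rotate.isNeighbor hS).symm
  have htu := h.rotate.isNeighbor hS
  have hex : IsFirstCommonNeighbor s t S u := by
    refine ⟨hsu, htu, fun v hsv htv => ?_⟩
    by_cases hvu : v = u
    · rw [hvu]
    · exact (h.cwAngle_lt hS hsv htv hvu).le
  have hE : ∃ u, IsFirstCommonNeighbor s t S u := ⟨u, hex⟩
  rw [alphaPlus, dif_pos hE]
  by_contra hne
  have hsp := hE.choose_spec
  exact absurd (hsp.2.2 u hsu htu) (not_le.2 (h.cwAngle_lt hS hsp.1 hsp.2.1 hne))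

lemma tri_alphaPlus {S : Config} (hS : GeneralPosition S) (hS' : Spread S) {s t : Plane}
    (h : IsNeighbor s t S) : Tri s t (alphaPlus s t S) S := by
  obtain ⟨u, hu⟩ := hS'.exists_tri h
  rwa [hu.alphaPlus_eq hS]

/-! ### Covariance -/

lemma mem_shift_sub {S : Config} {s z : Plane} : s - z ∈ shift z S ↔ s ∈ S := by
  rw [mem_shift, sub_add_cancel]

lemma shift_shift (x y : Plane) (S : Config) : shift x (shift y S) = shift (x + y) S := by
  ext z
  change z + x + y ∈ S ↔ z + (x + y) ∈ S
  rw [add_assoc]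

lemma shift_zero (S : Config) : shift 0 S = S := by
  ext z
  change z + 0 ∈ S ↔ z ∈ S
  rw [add_zero]

lemma mem_vor_shift {S : Config} {x s z : Plane} : x - z ∈ vor (s - z) (shift z S) ↔ x ∈ vor s S := by
  constructor
  · intro h t ht
    have := h (t - z) (mem_shift_sub.2 ht)
    simpa using this
  · intro h t ht
    have := h (t + z) ht
    have e : dist (x - z) t = dist x (t + z) := by
      rw [← dist_sub_right x (t + z) z, add_sub_cancel_right]
    simpa [e] using this

lemma vor_shift (s z : Plane) (S : Config) :
    vor (s - z) (shift z S) = (fun x => x - z) '' vor s S := by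
  ext x
  constructor
  · intro h
    refine ⟨x + z, ?_, by simp⟩
    rw [← mem_vor_shift (z := z)]; simpa using h
  · rintro ⟨y, hy, rfl⟩
    exact mem_vor_shift.2 hy

lemma isNeighbor_shift {S : Config} {s t z : Plane} :
    IsNeighbor (s - z) (t - z) (shift z S) ↔ IsNeighbor s t S := by
  have hv : vectorSpan ℝ (vor (s - z) (shift z S) ∩ vor (t - z) (shift z S)) =
      vectorSpan ℝ (vor s S ∩ vor t S) := by
    rw [vor_shift, vor_shift, ← Set.image_inter (sub_left_injective)]
    rw [vectorSpan_def, vectorSpan_def]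
    congr 1
    ext q
    constructor
    · rintro ⟨_, ⟨a, ha, rfl⟩, _, ⟨b, hb, rfl⟩, rfl⟩
      exact ⟨a, ha, b, hb, by simp⟩
    · rintro ⟨a, ha, b, hb, rfl⟩
      exact ⟨_, ⟨a, ha, rfl⟩, _, ⟨b, hb, rfl⟩, by simp⟩
  unfold IsNeighbor
  rw [hv, mem_shift_sub, mem_shift_sub, ne_eq, sub_left_inj]

lemma cond_shift (s t z : Plane) (S : Config) : cond (s - z) (t - z) (shift z S) = cond s t S := by
  classical
  simp only [cond, isNeighbor_shift]

lemma tri_shift {S : Config} {s t u z : Plane} :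
    Tri (s - z) (t - z) (u - z) (shift z S) ↔ Tri s t u S := by
  have hc : circumcenter (s - z) (t - z) (u - z) = circumcenter s t u - z := by
    apply plane_ext
    · simp [circumcenter]; ring
    · simp [circumcenter]; ring
  simp only [Tri, mem_shift_sub, hc, mem_vor_shift, sub_sub_sub_cancel_right]

lemma GeneralPosition.shift {S : Config} (hS : GeneralPosition S) (z : Plane) :
    GeneralPosition (shift z S) := by
  intro c r
  refine lt_of_le_of_lt ?_ (hS (c + z) r)
  rw [← (add_left_injective z).encard_image]
  refine Set.encard_le_encard ?_
  rintro _ ⟨y, ⟨hy, hyr⟩, rfl⟩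
  refine ⟨hy, ?_⟩
  simpa using hyr

lemma Spread.shift {S : Config} (hS : Spread S) (z : Plane) : Spread (shift z S) := by
  intro d c hd
  obtain ⟨x, hx, hxc⟩ := hS d (c + dot d z) hd
  refine ⟨x - z, mem_shift_sub.2 hx, ?_⟩
  simp only [dot, PiLp.sub_apply] at *
  linarith

/-! ### Sums over the points of a configuration -/

lemma lintegral_points (S : Config) (f : Plane → ℝ≥0∞) :
    ∫⁻ x, f x ∂S.points = ∑' x : S, f x := by
  rw [points, lintegral_sum_measure]
  simp only [lintegral_dirac]

lemma countable_coe (S : Config) : (S : Set Plane).Countable := by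
  have : (S : Set Plane) = ⋃ n : ℕ, (S : Set Plane) ∩ Metric.closedBall 0 (n : ℝ) := by
    rw [← Set.inter_iUnion, Metric.iUnion_closedBall_nat, Set.inter_univ]
  rw [this]
  exact Set.countable_iUnion fun n => (S.finite_inter_coe Metric.isBounded_closedBall).countable

instance (S : Config) : SFinite S.points := inferInstanceAs (SFinite (pointsKernel S))

instance (S : Config) : Countable S := (countable_coe S).to_subtype

lemma ae_points_iff {S : Config} {p : Plane → Prop} :
    (∀ᵐ x ∂S.points, p x) ↔ ∀ x ∈ S, p x := by
  rw [points, Measure.ae_sum_iff]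
  simp only [ae_dirac_eq, eventually_pure]
  exact Subtype.forall

lemma lintegral_points_shift (S : Config) (z : Plane) (f : Plane → ℝ≥0∞) :
    ∫⁻ x, f x ∂(shift z S).points = ∫⁻ x, f (x - z) ∂S.points := by
  rw [lintegral_points, lintegral_points]
  let e : S ≃ shift z S :=
    { toFun := fun x => ⟨x - z, mem_shift_sub.2 x.2⟩
      invFun := fun x => ⟨x + z, x.2⟩
      left_inv := fun x => by simp
      right_inv := fun x => by simp }
  rw [← e.tsum_eq]
  rfl

/-! ### Measurable dependence on the configuration -/

/-- The counting measures as a kernel over a space mapped to the configurations. -/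
noncomputable def pointsComp {α : Type*} [MeasurableSpace α] (T : α → Config) (hT : Measurable T) :
    Kernel α Plane := pointsKernel.comap T hT

noncomputable instance {α : Type*} [MeasurableSpace α] (T : α → Config) (hT : Measurable T) :
    IsSFiniteKernel (pointsComp T hT) := by unfold pointsComp; infer_instance

lemma _root_.Measurable.lintegral_points {α : Type*} [MeasurableSpace α] {T : α → Config}
    (hT : Measurable T) {F : α → Plane → ℝ≥0∞} (hF : Measurable fun p : α × Plane => F p.1 p.2) :
    Measurable fun a => ∫⁻ x, F a x ∂(T a).points :=
  Measurable.lintegral_kernel_prod_right' (κ := pointsComp T hT) hF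

lemma _root_.Measurable.integral_points {α : Type*} [MeasurableSpace α] {T : α → Config}
    (hT : Measurable T) {E : Type*} [NormedAddCommGroup E] [NormedSpace ℝ E] [MeasurableSpace E]
    [BorelSpace E] [SecondCountableTopology E]
    {F : α → Plane → E} (hF : Measurable fun p : α × Plane => F p.1 p.2) :
    Measurable fun a => ∫ x, F a x ∂(T a).points :=
  (StronglyMeasurable.integral_kernel_prod_right' (κ := pointsComp T hT)
    hF.stronglyMeasurable).measurable

/-- A point with the property exists exactly when the counting measure of the set of such sites is
nonzero, and that measure depends measurably on the parameter. -/
lemma _root_.Measurable.exists_mem {α : Type*} [MeasurableSpace α] {T : α → Config}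
    (hT : Measurable T) {p : α → Plane → Prop} (hp : MeasurableSet {q : α × Plane | p q.1 q.2}) :
    MeasurableSet {a | ∃ x ∈ T a, p a x} := by
  have h := (Kernel.measurable_kernel_prodMk_left (κ := pointsComp T hT) hp)
    (measurableSet_singleton (0 : ℝ≥0∞)).compl
  convert h using 1
  ext a
  have : (pointsComp T hT) a (Prod.mk a ⁻¹' {q : α × Plane | p q.1 q.2}) = 0 ↔
      ∀ x ∈ T a, ¬ p a x := by
    rw [← ae_points_iff, ae_iff]
    simp only [not_not]
    exact Iff.rfl
  simp only [Set.mem_preimage, Set.mem_compl_iff, Set.mem_singleton_iff, this]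
  simp

lemma _root_.Measurable.forall_mem {α : Type*} [MeasurableSpace α] {T : α → Config}
    (hT : Measurable T) {p : α → Plane → Prop} (hp : MeasurableSet {q : α × Plane | p q.1 q.2}) :
    MeasurableSet {a | ∀ x ∈ T a, p a x} := by
  have := (hT.exists_mem (p := fun a x => ¬ p a x) hp.compl).compl
  convert this using 1
  ext a
  simp

lemma _root_.Measurable.mem_config {α : Type*} [MeasurableSpace α] {T : α → Config}
    (hT : Measurable T) {f : α → Plane} (hf : Measurable f) : MeasurableSet {a | f a ∈ T a} := by
  have := hT.exists_mem (p := fun a x => x = f a)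
    (measurableSet_eq_fun measurable_snd (hf.comp measurable_fst))
  simpa using this

lemma _root_.Measurable.shift {α : Type*} [MeasurableSpace α] {T : α → Config}
    (hT : Measurable T) {f : α → Plane} (hf : Measurable f) :
    Measurable fun a => Config.shift (f a) (T a) :=
  measurable_shift.comp (hf.prodMk hT)

lemma measurable_coord (i : Fin 2) : Measurable fun x : Plane => x i :=
  (EuclideanSpace.proj (𝕜 := ℝ) i).continuous.measurable

lemma _root_.Measurable.plane_apply {α : Type*} [MeasurableSpace α] {f : α → Plane}
    (hf : Measurable f) (i : Fin 2) : Measurable fun a => f a i :=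
  (measurable_coord i).comp hf

lemma measurable_plane_mk {α : Type*} [MeasurableSpace α] {f g : α → ℝ}
    (hf : Measurable f) (hg : Measurable g) : Measurable fun a => (!₂[f a, g a] : Plane) := by
  refine (WithLp.measurable_toLp 2 (Fin 2 → ℝ)).comp (measurable_pi_lambda _ fun i => ?_)
  fin_cases i
  · exact hf
  · exact hg

lemma measurableSet_vor {α : Type*} [MeasurableSpace α] {T : α → Config} (hT : Measurable T)
    {f g : α → Plane} (hf : Measurable f) (hg : Measurable g) :
    MeasurableSet {a | f a ∈ vor (g a) (T a)} :=
  hT.forall_mem (p := fun a x => dist (f a) (g a) ≤ dist (f a) x)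
    (measurableSet_le ((hf.comp measurable_fst).dist (hg.comp measurable_fst))
      ((hf.comp measurable_fst).dist measurable_snd))

lemma measurableSet_tri {α : Type*} [MeasurableSpace α] {T : α → Config} (hT : Measurable T)
    {f g h : α → Plane} (hf : Measurable f) (hg : Measurable g) (hh : Measurable h) :
    MeasurableSet {a | Tri (f a) (g a) (h a) (T a)} := by
  have f0 := hf.plane_apply 0
  have f1 := hf.plane_apply 1
  have g0 := hg.plane_apply 0
  have g1 := hg.plane_apply 1
  have h0 := hh.plane_apply 0
  have h1 := hh.plane_apply 1
  have hc : Measurable fun a => cross (g a - f a) (h a - f a) := by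
    simp only [cross, PiLp.sub_apply]
    fun_prop
  refine (hT.mem_config hf).inter ((hT.mem_config hg).inter ((hT.mem_config hh).inter
    ((measurableSet_lt hc measurable_const).inter (measurableSet_vor hT ?_ hf))))
  unfold circumcenter
  apply measurable_plane_mk <;> fun_prop

/-! ### Stationarity and the Palm measure -/

lemma volume_unitSquare : volume unitSquare = 1 := by
  have h := (EuclideanSpace.volume_preserving_symm_measurableEquiv_toLp (Fin 2)).measure_preimage
    (s := Set.univ.pi fun _ => Set.Ico (0 : ℝ) 1)
    (MeasurableSet.univ_pi fun _ => measurableSet_Ico).nullMeasurableSet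
  rw [Real.volume_pi_Ico] at h
  have e : (MeasurableEquiv.toLp 2 (Fin 2 → ℝ)).symm ⁻¹' (Set.univ.pi fun _ => Set.Ico (0 : ℝ) 1)
      = unitSquare := by
    ext x
    simp [unitSquare, Set.mem_pi]
  rw [e] at h
  simpa using h

lemma lintegral_unitSquare_sub (x : Plane) :
    ∫⁻ z, unitSquare.indicator (1 : Plane → ℝ≥0∞) (x - z) = 1 := by
  rw [lintegral_sub_left_eq_self, lintegral_indicator_one measurableSet_unitSquare,
    volume_unitSquare]

lemma lintegral_unitSquare_add (x : Plane) :
    ∫⁻ z, unitSquare.indicator (1 : Plane → ℝ≥0∞) (x + z) = 1 := by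
  rw [lintegral_add_left_eq_self, lintegral_indicator_one measurableSet_unitSquare,
    volume_unitSquare]

lemma lintegral_palm (P : Measure Config) {F : Config → ℝ≥0∞} (hF : Measurable F) :
    ∫⁻ S, F S ∂palm P =
      ∫⁻ S, ∫⁻ x, unitSquare.indicator 1 x * F (shift x S) ∂S.points ∂P := by
  rw [palm, Measure.lintegral_bind measurable_palmKernel.aemeasurable hF.aemeasurable]
  refine lintegral_congr fun S => ?_
  rw [lintegral_map hF (measurable_shift_left S), ← lintegral_indicator measurableSet_unitSquare]
  refine lintegral_congr fun x => ?_
  by_cases hx : x ∈ unitSquare <;> simp [hx]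

/-- The law of a stationary point process of intensity one. -/
structure IsStationary (P : Measure Config) : Prop where
  prob : IsProbabilityMeasure P
  stationary : ∀ x, MeasurePreserving (shift x) P P
  intensity_one : ∫⁻ S : Config, (((S : Set Plane) ∩ unitSquare).encard : ℝ≥0∞) ∂P = 1

lemma StandingAssumptions.isStationary {P : Measure Config} (hP : StandingAssumptions P) :
    IsStationary P := ⟨hP.prob, hP.stationary, hP.intensity_one⟩

variable {P : Measure Config}

lemma IsStationary.lintegral_shift (hP : IsStationary P) (z : Plane) {F : Config → ℝ≥0∞}
    (hF : Measurable F) : ∫⁻ S, F (shift z S) ∂P = ∫⁻ S, F S ∂P :=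
  (hP.stationary z).lintegral_comp hF

lemma measurable_indicator_unitSquare {α : Type*} [MeasurableSpace α] {f : α → Plane}
    (hf : Measurable f) :
    Measurable fun a => unitSquare.indicator (1 : Plane → ℝ≥0∞) (f a) :=
  (measurable_one.indicator measurableSet_unitSquare).comp hf

lemma measurable_palm_sum {F : Config → ℝ≥0∞} (hF : Measurable F) :
    Measurable fun S : Config =>
      ∫⁻ x, unitSquare.indicator (1 : Plane → ℝ≥0∞) x * F (shift x S) ∂S.points :=
  measurable_id.lintegral_points
    (F := fun S x => unitSquare.indicator (1 : Plane → ℝ≥0∞) x * F (shift x S))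
    ((measurable_indicator_unitSquare measurable_snd).mul
      (hF.comp (measurable_fst.shift measurable_snd)))

lemma lintegral_points_unitSquare (S : Config) :
    ∫⁻ x, unitSquare.indicator (1 : Plane → ℝ≥0∞) x ∂S.points =
      (((S : Set Plane) ∩ unitSquare).encard : ℝ≥0∞) := by
  rw [lintegral_indicator_one measurableSet_unitSquare, points_apply _ measurableSet_unitSquare]

lemma IsStationary.palm_prob (hP : IsStationary P) : IsProbabilityMeasure (palm P) := by
  constructor
  rw [← lintegral_one, lintegral_palm P measurable_const]
  simp only [mul_one, lintegral_points_unitSquare]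
  exact hP.intensity_one

lemma lintegral_palm_eq_zero_iff {F : Config → ℝ≥0∞} (hF : Measurable F) :
    ∫⁻ S, F S ∂palm P = 0 ↔ ∀ᵐ S ∂P, ∀ x ∈ S, x ∈ unitSquare → F (shift x S) = 0 := by
  rw [lintegral_palm P hF, lintegral_eq_zero_iff (measurable_palm_sum hF)]
  refine eventually_congr (Eventually.of_forall fun S => ?_)
  beta_reduce
  rw [Pi.zero_apply, lintegral_points, ENNReal.tsum_eq_zero]
  refine Subtype.forall.trans (forall₂_congr fun x hx => ?_)
  by_cases h : x ∈ unitSquare <;> simp [h]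

lemma ae_zero_mem_palm : ∀ᵐ S ∂palm P, (0 : Plane) ∈ S := by
  have hm : MeasurableSet {S : Config | (0 : Plane) ∈ S} := measurable_id.mem_config measurable_const
  rw [ae_iff, ← lintegral_indicator_one (by exact hm.compl),
    lintegral_palm_eq_zero_iff (measurable_one.indicator (by exact hm.compl))]
  refine Eventually.of_forall fun S x hx _ => ?_
  rw [Set.indicator_of_notMem]
  simpa [mem_shift] using hx

/-- Almost sure translation invariant properties are almost sure under the Palm measure. -/
lemma IsStationary.ae_palm_of_ae (hP : IsStationary P) {p : Config → Prop}
    (hp : ∀ z S, p S → p (shift z S)) (h : ∀ᵐ S ∂P, p S) : ∀ᵐ S ∂palm P, p S := by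
  have := hP.prob
  obtain ⟨N, hN, hNm, hN0⟩ := exists_measurable_superset_of_null (ae_iff.1 h)
  have hmeas : Measurable fun q : Config × Plane => N.indicator (1 : Config → ℝ≥0∞) (shift q.2 q.1) :=
    (measurable_one.indicator hNm).comp (measurable_fst.shift measurable_snd)
  have hmeas' : Measurable fun q : Config × Plane =>
      Nᶜ.indicator (1 : Config → ℝ≥0∞) (shift q.2 q.1) :=
    (measurable_one.indicator hNm.compl).comp (measurable_fst.shift measurable_snd)
  -- Since `p` need not be measurable, its failure is enlarged to `M`: the configurations almost all
  -- of whose translates lie in `N`. This set is measurable and translation invariant.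
  set M : Set Config := {S | ∫⁻ x, Nᶜ.indicator (1 : Config → ℝ≥0∞) (shift x S) = 0} with hM
  have hMm : MeasurableSet M := (hmeas'.lintegral_prod_right') (measurableSet_singleton 0)
  have hMshift : ∀ z S, S ∈ M → shift z S ∈ M := by
    intro z S hS
    simp only [hM, Set.mem_ofPred_eq, shift_shift] at hS ⊢
    rwa [lintegral_add_right_eq_self (fun x => Nᶜ.indicator (1 : Config → ℝ≥0∞) (shift x S)) z]
  have hpM : ∀ S, ¬ p S → S ∈ M := by
    intro S hS
    have : ∀ x, Nᶜ.indicator (1 : Config → ℝ≥0∞) (shift x S) = 0 := by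
      intro x
      refine Set.indicator_of_notMem (fun (hx : shift x S ∈ Nᶜ) =>
        hx (hN (show ¬ p (shift x S) from fun hpx => ?_))) _
      have := hp (-x) _ hpx
      rw [shift_shift, neg_add_cancel, shift_zero] at this
      exact hS this
    simp [hM, this]
  have hMnull : ∀ᵐ S ∂P, S ∉ M := by
    -- By stationarity and Fubini almost every configuration has almost no translate in `N`, whereas
    -- one in `M` has almost all of them there.
    have h0 : ∫⁻ S, ∫⁻ x, N.indicator (1 : Config → ℝ≥0∞) (shift x S) ∂volume ∂P = 0 := by
      rw [lintegral_lintegral_swap hmeas.aemeasurable]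
      have : ∀ x, ∫⁻ S, N.indicator (1 : Config → ℝ≥0∞) (shift x S) ∂P = 0 := fun x => by
        rw [hP.lintegral_shift x (measurable_one.indicator hNm), lintegral_indicator_one hNm, hN0]
      simp [this]
    rw [lintegral_eq_zero_iff hmeas.lintegral_prod_right'] at h0
    filter_upwards [h0] with S hS hSM
    have h2 : ∫⁻ x : Plane, (1 : ℝ≥0∞) = 0 := by
      have : ∀ x, (1 : ℝ≥0∞) = N.indicator (1 : Config → ℝ≥0∞) (shift x S) +
          Nᶜ.indicator (1 : Config → ℝ≥0∞) (shift x S) := by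
        intro x
        by_cases hx : shift x S ∈ N <;> simp [hx]
      rw [lintegral_congr this]
      have hmS : Measurable fun x => N.indicator (1 : Config → ℝ≥0∞) (shift x S) :=
        (measurable_one.indicator hNm).comp (measurable_shift_left S)
      rw [lintegral_add_left hmS]
      rw [show ∫⁻ x, N.indicator (1 : Config → ℝ≥0∞) (shift x S) = 0 from hS,
        show ∫⁻ x, Nᶜ.indicator (1 : Config → ℝ≥0∞) (shift x S) = 0 from hSM, add_zero]
    simp at h2
  have hMpalm : ∀ᵐ S ∂palm P, S ∉ M := by
    rw [ae_iff]
    simp only [not_not, Set.ofPred_mem_eq]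
    rw [← lintegral_indicator_one hMm,
      lintegral_palm_eq_zero_iff (measurable_one.indicator hMm)]
    filter_upwards [hMnull] with S hS x _ _
    refine Set.indicator_of_notMem (fun hx => hS ?_) _
    have := hMshift (-x) _ hx
    rwa [shift_shift, neg_add_cancel, shift_zero] at this
  filter_upwards [hMpalm] with S hS
  by_contra hpS
  exact hS (hpM S hpS)

/-- Palm almost sure properties hold almost surely as seen from every point. -/
lemma IsStationary.ae_forall_shift (hP : IsStationary P) {p : Config → Prop}
    (h : ∀ᵐ S ∂palm P, p S) : ∀ᵐ S ∂P, ∀ s ∈ S, p (shift s S) := by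
  have := hP.prob
  obtain ⟨N, hN, hNm, hN0⟩ := exists_measurable_superset_of_null (ae_iff.1 h)
  set F := N.indicator (1 : Config → ℝ≥0∞) with hF
  have hFm : Measurable F := measurable_one.indicator hNm
  rw [← lintegral_indicator_one hNm, lintegral_palm P hFm] at hN0
  -- Stationarity allows the unit square in the Palm formula to be moved by any `z`; integrating
  -- over `z` then removes the square and reaches all points at once.
  have hz : ∀ z : Plane, ∫⁻ S, ∫⁻ x, unitSquare.indicator 1 (x - z) * F (shift x S) ∂S.points ∂P
      = 0 := by
    intro z
    rw [← hP.lintegral_shift z (measurable_palm_sum hFm)] at hN0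
    rw [← hN0]
    refine lintegral_congr fun S => ?_
    rw [lintegral_points_shift]
    simp only [shift_shift, sub_add_cancel]
  have hq : Measurable fun q : Plane × Config =>
      ∫⁻ x, unitSquare.indicator 1 (x - q.1) * F (shift x q.2) ∂q.2.points :=
    measurable_snd.lintegral_points
      (F := fun (q : Plane × Config) x => unitSquare.indicator 1 (x - q.1) * F (shift x q.2))
      ((measurable_indicator_unitSquare
        (measurable_snd.sub (measurable_fst.comp measurable_fst))).mul
        (hFm.comp ((measurable_snd.comp measurable_fst).shift measurable_snd)))
  have h1 : ∫⁻ S, ∫⁻ x, F (shift x S) ∂S.points ∂P = 0 := by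
    calc ∫⁻ S, ∫⁻ x, F (shift x S) ∂S.points ∂P
        = ∫⁻ S, ∫⁻ z : Plane, ∫⁻ x, unitSquare.indicator 1 (x - z) * F (shift x S)
            ∂S.points ∂volume ∂P := by
          refine lintegral_congr fun S => ?_
          rw [lintegral_lintegral_swap]
          · refine lintegral_congr fun x => ?_
            have hmx : Measurable fun z => unitSquare.indicator (1 : Plane → ℝ≥0∞) (x - z) :=
              measurable_indicator_unitSquare (measurable_id.const_sub x)
            rw [lintegral_mul_const _ hmx, lintegral_unitSquare_sub, one_mul]
          · exact ((measurable_indicator_unitSquare (measurable_snd.sub measurable_fst)).mul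
              (hFm.comp ((measurable_shift_left S).comp measurable_snd))).aemeasurable
      _ = ∫⁻ z : Plane, ∫⁻ S, ∫⁻ x, unitSquare.indicator 1 (x - z) * F (shift x S)
            ∂S.points ∂P := by
          rw [lintegral_lintegral_swap]
          exact (hq.comp measurable_swap).aemeasurable
      _ = 0 := by simp [hz]
  have hm : Measurable fun S : Config => ∫⁻ x, F (shift x S) ∂S.points :=
    measurable_id.lintegral_points (F := fun S x => F (shift x S))
      (hFm.comp (measurable_fst.shift measurable_snd))
  rw [lintegral_eq_zero_iff hm] at h1
  filter_upwards [h1] with S hS s hs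
  beta_reduce at hS
  rw [Pi.zero_apply, lintegral_points, ENNReal.tsum_eq_zero] at hS
  by_contra hps
  have := hS ⟨s, hs⟩
  rw [hF, Set.indicator_of_mem (hN hps)] at this
  simp at this

lemma IsStationary.ae_palm_forall_shift (hP : IsStationary P) {p : Config → Prop}
    (h : ∀ᵐ S ∂palm P, p S) : ∀ᵐ S ∂palm P, ∀ s ∈ S, p (shift s S) := by
  refine hP.ae_palm_of_ae (p := fun S => ∀ s ∈ S, p (shift s S)) ?_ (hP.ae_forall_shift h)
  intro z S hS s hs
  rw [shift_shift]
  exact hS _ hs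

/-! ### Mass transport -/

/-- The law of a configuration together with two of its points. -/
noncomputable def pairMeasure (P : Measure Config) : Measure (Config × (Plane × Plane)) :=
  P ⊗ₘ (pointsKernel ×ₖ pointsKernel)

lemma lintegral_pairMeasure [SFinite P] {F : Config × (Plane × Plane) → ℝ≥0∞} (hF : Measurable F) :
    ∫⁻ p, F p ∂pairMeasure P = ∫⁻ S, ∫⁻ x, ∫⁻ y, F (S, x, y) ∂S.points ∂S.points ∂P := by
  rw [pairMeasure, Measure.lintegral_compProd hF]
  refine lintegral_congr fun S => ?_
  exact Kernel.lintegral_prod _ _ _ (hF.comp measurable_prodMk_left)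

lemma measurable_pair_shift (z : Plane) : Measurable fun p : Config × (Plane × Plane) =>
    (shift z p.1, (p.2.1 - z, p.2.2 - z)) :=
  (measurable_fst.shift measurable_const).prodMk
    ((measurable_snd.fst.sub_const z).prodMk (measurable_snd.snd.sub_const z))

lemma measurable_lintegral_pair {F : Config × (Plane × Plane) → ℝ≥0∞} (hF : Measurable F) :
    Measurable fun S : Config => ∫⁻ x, ∫⁻ y, F (S, x, y) ∂S.points ∂S.points := by
  refine measurable_id.lintegral_points
    (F := fun S x => ∫⁻ y, F (S, x, y) ∂S.points) ?_
  exact measurable_fst.lintegral_points (F := fun (q : Config × Plane) y => F (q.1, q.2, y))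
    (hF.comp (measurable_fst.fst.prodMk (measurable_fst.snd.prodMk measurable_snd)))

lemma IsStationary.lintegral_pair_shift (hP : IsStationary P) (z : Plane)
    {F : Config × (Plane × Plane) → ℝ≥0∞} (hF : Measurable F) :
    ∫⁻ p, F (shift z p.1, (p.2.1 - z, p.2.2 - z)) ∂pairMeasure P = ∫⁻ p, F p ∂pairMeasure P := by
  have := hP.prob
  rw [lintegral_pairMeasure (F := fun p => F (shift z p.1, (p.2.1 - z, p.2.2 - z)))
    (hF.comp (measurable_pair_shift z)), lintegral_pairMeasure hF,
    ← hP.lintegral_shift z (measurable_lintegral_pair hF)]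
  refine lintegral_congr fun S => ?_
  rw [lintegral_points_shift]
  refine lintegral_congr fun x => ?_
  rw [lintegral_points_shift]

/-- Insert `1 = ∫ 1_Q(y + z) dz` for the second point `y` and the unit square `Q`, then translate
everything by `z`. The inserted factor becomes `1_Q(y)`, while the original `1_Q(x)` becomes `1_Q(x
- z)`, whose integral over `z` is one. -/
lemma IsStationary.mass_transport (hP : IsStationary P)
    {q : Config × (Plane × Plane) → ℝ≥0∞} (hq : Measurable q)
    (hinv : ∀ z p, q (shift z p.1, (p.2.1 - z, p.2.2 - z)) = q p) :
    ∫⁻ p, unitSquare.indicator 1 p.2.1 * q p ∂pairMeasure P =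
      ∫⁻ p, unitSquare.indicator 1 p.2.2 * q p ∂pairMeasure P := by
  have := hP.prob
  have : SFinite (pairMeasure P) := by unfold pairMeasure; infer_instance
  have h1 : Measurable fun r : (Config × (Plane × Plane)) × Plane =>
      unitSquare.indicator (1 : Plane → ℝ≥0∞) (r.1.2.2 + r.2) *
        (unitSquare.indicator 1 r.1.2.1 * q r.1) :=
    (measurable_indicator_unitSquare (measurable_fst.snd.snd.add measurable_snd)).mul
      ((measurable_indicator_unitSquare measurable_fst.snd.fst).mul (hq.comp measurable_fst))
  have h2 : Measurable fun r : (Config × (Plane × Plane)) × Plane =>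
      unitSquare.indicator (1 : Plane → ℝ≥0∞) (r.1.2.1 - r.2) *
        (unitSquare.indicator 1 r.1.2.2 * q r.1) :=
    (measurable_indicator_unitSquare (measurable_fst.snd.fst.sub measurable_snd)).mul
      ((measurable_indicator_unitSquare measurable_fst.snd.snd).mul (hq.comp measurable_fst))
  calc ∫⁻ p, unitSquare.indicator 1 p.2.1 * q p ∂pairMeasure P
      = ∫⁻ p, ∫⁻ z : Plane, unitSquare.indicator 1 (p.2.2 + z) *
          (unitSquare.indicator 1 p.2.1 * q p) ∂volume ∂pairMeasure P := by
        refine lintegral_congr fun p => ?_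
        have hm : Measurable fun z => unitSquare.indicator (1 : Plane → ℝ≥0∞) (p.2.2 + z) :=
          measurable_indicator_unitSquare (measurable_id.const_add _)
        rw [lintegral_mul_const _ hm, lintegral_unitSquare_add, one_mul]
    _ = ∫⁻ z : Plane, ∫⁻ p, unitSquare.indicator 1 (p.2.2 + z) *
          (unitSquare.indicator 1 p.2.1 * q p) ∂pairMeasure P := by
        rw [lintegral_lintegral_swap]
        exact h1.aemeasurable
    _ = ∫⁻ z : Plane, ∫⁻ p, unitSquare.indicator 1 (p.2.1 - z) *
          (unitSquare.indicator 1 p.2.2 * q p) ∂pairMeasure P := by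
        refine lintegral_congr fun z => ?_
        rw [← hP.lintegral_pair_shift z (F := fun p => unitSquare.indicator 1 (p.2.2 + z) *
          (unitSquare.indicator 1 p.2.1 * q p)) (h1.comp measurable_prodMk_right)]
        refine lintegral_congr fun p => ?_
        rw [hinv]
        simp only [sub_add_cancel]
        ring
    _ = ∫⁻ p, ∫⁻ z : Plane, unitSquare.indicator 1 (p.2.1 - z) *
          (unitSquare.indicator 1 p.2.2 * q p) ∂volume ∂pairMeasure P := by
        rw [lintegral_lintegral_swap]
        exact (h2.comp measurable_swap).aemeasurable
    _ = ∫⁻ p, unitSquare.indicator 1 p.2.2 * q p ∂pairMeasure P := by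
        refine lintegral_congr fun p => ?_
        have hm : Measurable fun z => unitSquare.indicator (1 : Plane → ℝ≥0∞) (p.2.1 - z) :=
          measurable_indicator_unitSquare (measurable_id.const_sub _)
        rw [lintegral_mul_const _ hm, lintegral_unitSquare_sub, one_mul]

/-- The law of the Palm version together with one of its points. -/
noncomputable def palmPair (P : Measure Config) : Measure (Config × Plane) :=
  palm P ⊗ₘ pointsKernel

/-- Exchange of the roles of the origin and of the marked point. -/
def exchange (p : Config × Plane) : Config × Plane := (shift p.2 p.1, -p.2)

lemma measurable_exchange : Measurable exchange :=
  (measurable_fst.shift measurable_snd).prodMk measurable_snd.neg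

lemma exchange_exchange (p : Config × Plane) : exchange (exchange p) = p := by
  simp [exchange, shift_shift, shift_zero]

lemma IsStationary.lintegral_palmPair (hP : IsStationary P) {F : Config × Plane → ℝ≥0∞}
    (hF : Measurable F) :
    ∫⁻ p, F p ∂palmPair P = ∫⁻ S, ∫⁻ t, F (S, t) ∂S.points ∂palm P := by
  have := hP.palm_prob
  rw [palmPair, Measure.lintegral_compProd hF]
  rfl

lemma measurable_palmPair_integrand {F : Config × Plane → ℝ≥0∞} (hF : Measurable F) :
    Measurable fun S : Config => ∫⁻ t, F (S, t) ∂S.points :=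
  measurable_id.lintegral_points (F := fun S t => F (S, t)) hF

lemma IsStationary.lintegral_palmPair_eq (hP : IsStationary P) {F : Config × Plane → ℝ≥0∞}
    (hF : Measurable F) :
    ∫⁻ p, F p ∂palmPair P =
      ∫⁻ p, unitSquare.indicator 1 p.2.1 * F (shift p.2.1 p.1, p.2.2 - p.2.1) ∂pairMeasure P := by
  have := hP.prob
  have hm : Measurable fun p : Config × (Plane × Plane) => F (shift p.2.1 p.1, p.2.2 - p.2.1) :=
    hF.comp ((measurable_fst.shift measurable_snd.fst).prodMk
      (measurable_snd.snd.sub measurable_snd.fst))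
  have hm2 : Measurable fun p : Config × (Plane × Plane) =>
      unitSquare.indicator (1 : Plane → ℝ≥0∞) p.2.1 * F (shift p.2.1 p.1, p.2.2 - p.2.1) :=
    (measurable_indicator_unitSquare measurable_snd.fst).mul hm
  rw [hP.lintegral_palmPair hF, lintegral_palm P (measurable_palmPair_integrand hF),
    lintegral_pairMeasure hm2]
  refine lintegral_congr fun S => lintegral_congr fun x => ?_
  have hmx : Measurable fun y => F (shift x S, y - x) :=
    hF.comp (measurable_const.prodMk (measurable_id.sub_const x))
  rw [lintegral_points_shift]
  exact (lintegral_const_mul _ hmx).symm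

/-- Reversibility of the Palm version: lifted to pairs of points, the exchange swaps the two points,
and mass transport moves the unit square from one to the other. -/
lemma IsStationary.lintegral_exchange (hP : IsStationary P) {F : Config × Plane → ℝ≥0∞}
    (hF : Measurable F) : ∫⁻ p, F (exchange p) ∂palmPair P = ∫⁻ p, F p ∂palmPair P := by
  have := hP.prob
  set q : Config × (Plane × Plane) → ℝ≥0∞ := fun p => F (shift p.2.1 p.1, p.2.2 - p.2.1) with hq
  have hqm : Measurable q := hF.comp ((measurable_fst.shift measurable_snd.fst).prodMk
      (measurable_snd.snd.sub measurable_snd.fst))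
  have hmt := hP.mass_transport hqm (by
    intro z p
    simp only [hq, shift_shift, sub_add_cancel, sub_sub_sub_cancel_right])
  rw [hP.lintegral_palmPair_eq hF, hP.lintegral_palmPair_eq (F := fun p => F (exchange p))
    (hF.comp measurable_exchange), hmt]
  have e : ∀ p : Config × (Plane × Plane),
      F (exchange (shift p.2.1 p.1, p.2.2 - p.2.1)) = q (p.1, p.2.swap) := by
    intro p
    simp only [exchange, hq, shift_shift, sub_add_cancel, neg_sub, Prod.fst_swap, Prod.snd_swap]
  have hm1 : Measurable fun p : Config × (Plane × Plane) =>
      unitSquare.indicator (1 : Plane → ℝ≥0∞) p.2.1 * q (p.1, p.2.swap) :=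
    (measurable_indicator_unitSquare measurable_snd.fst).mul
      (hqm.comp (measurable_fst.prodMk (measurable_swap.comp measurable_snd)))
  have hm2 : Measurable fun p : Config × (Plane × Plane) =>
      unitSquare.indicator (1 : Plane → ℝ≥0∞) p.2.2 * q p :=
    (measurable_indicator_unitSquare measurable_snd.snd).mul hqm
  simp only [e]
  rw [lintegral_pairMeasure hm1, lintegral_pairMeasure hm2]
  refine lintegral_congr fun S => ?_
  rw [lintegral_lintegral_swap]
  · rfl
  · exact (hm1.comp measurable_prodMk_left).aemeasurable

lemma IsStationary.measurePreserving_exchange (hP : IsStationary P) :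
    MeasurePreserving exchange (palmPair P) (palmPair P) := by
  refine ⟨measurable_exchange, ?_⟩
  ext A hA
  rw [Measure.map_apply measurable_exchange hA, ← lintegral_indicator_one hA,
    ← hP.lintegral_exchange (measurable_one.indicator hA),
    ← lintegral_indicator_one (measurable_exchange hA)]
  rfl

/-! ### General position and spread of the point process -/

lemma StandingAssumptions.ae_generalPosition (hP : StandingAssumptions P) :
    ∀ᵐ S ∂P, GeneralPosition S := hP.general_position

lemma StandingAssumptions.ae_nonempty (hP : StandingAssumptions P) :
    ∀ᵐ S ∂P, ∃ x, x ∈ S := by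
  filter_upwards [hP.aperiodic] with S hS
  by_contra! h
  obtain ⟨z, hz⟩ : ∃ z : Plane, z ≠ 0 := exists_ne 0
  refine hS z hz ?_
  ext y
  change y + z ∈ S ↔ y ∈ S
  simp [h]

/-- The quadrant with signs `e`, moved by `n` along its diagonal. -/
def quadrant (e : Plane) (n : ℝ) : Set Plane := {x | ∀ i, n ≤ e i * x i}

lemma measurableSet_quadrant (e : Plane) (n : ℝ) : MeasurableSet (quadrant e n) := by
  have : quadrant e n = ⋂ i, {x : Plane | n ≤ e i * x i} := by ext; simp [quadrant]
  rw [this]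
  exact MeasurableSet.iInter fun i =>
    measurableSet_le measurable_const ((measurable_coord i).const_mul _)

/-- By stationarity the probability of meeting a translated quadrant does not depend on the
translation. As the quadrants grow to the whole plane it tends to the probability of a nonempty
configuration, which is one. -/
lemma StandingAssumptions.ae_quadrant (hP : StandingAssumptions P) {e : Plane}
    (he : ∀ i, e i ^ 2 = 1) (n : ℝ) : ∀ᵐ S ∂P, ∃ x ∈ S, x ∈ quadrant e n := by
  have := hP.prob
  have hm : ∀ m, MeasurableSet {S : Config | ∃ x ∈ S, x ∈ quadrant e m} := fun m =>
    measurable_id.exists_mem (p := fun _ x => x ∈ quadrant e m)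
      (measurable_snd (measurableSet_quadrant e m))
  have hconst : ∀ m k : ℝ, P {S : Config | ∃ x ∈ S, x ∈ quadrant e m} =
      P {S : Config | ∃ x ∈ S, x ∈ quadrant e k} := by
    intro m k
    rw [← (hP.stationary ((k - m) • e)).measure_preimage (hm m).nullMeasurableSet]
    congr 1
    ext S
    have hi : ∀ (x : Plane) (i : Fin 2), e i * (x + (k - m) • e) i = e i * x i + (k - m) := by
      intro x i
      simp only [PiLp.add_apply, PiLp.smul_apply, smul_eq_mul]
      linear_combination (k - m) * he i
    constructor
    · rintro ⟨x, hx, hq⟩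
      refine ⟨x + (k - m) • e, hx, fun i => ?_⟩
      rw [hi]
      linarith [hq i]
    · rintro ⟨x, hx, hq⟩
      refine ⟨x - (k - m) • e, mem_shift_sub.2 hx, fun i => ?_⟩
      have := hi (x - (k - m) • e) i
      rw [sub_add_cancel] at this
      linarith [hq i]
  have hU : {S : Config | ∃ x, x ∈ S} = ⋃ m : ℕ, {S : Config | ∃ x ∈ S, x ∈ quadrant e (-m)} := by
    ext S
    simp only [Set.mem_ofPred_eq, Set.mem_iUnion]
    constructor
    · rintro ⟨x, hx⟩
      obtain ⟨m, hm⟩ := exists_nat_ge (max (-(e 0 * x 0)) (-(e 1 * x 1)))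
      refine ⟨m, x, hx, fun i => ?_⟩
      have := max_le_iff.1 hm
      fin_cases i
      · change -(m : ℝ) ≤ e 0 * x 0; linarith
      · change -(m : ℝ) ≤ e 1 * x 1; linarith
    · rintro ⟨m, x, hx, -⟩
      exact ⟨x, hx⟩
  have hmono : Monotone fun m : ℕ => {S : Config | ∃ x ∈ S, x ∈ quadrant e (-m)} := by
    rintro a b hab S ⟨x, hx, hq⟩
    refine ⟨x, hx, fun i => le_trans ?_ (hq i)⟩
    have : (a : ℝ) ≤ b := by exact_mod_cast hab
    linarith
  have h1 : P {S : Config | ∃ x, x ∈ S} = 1 := by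
    rw [← measure_univ (μ := P)]
    exact measure_congr (eventuallyEq_univ.2 hP.ae_nonempty)
  rw [hU, hmono.measure_iUnion] at h1
  have h2 : (⨆ m : ℕ, P {S : Config | ∃ x ∈ S, x ∈ quadrant e (-m)}) =
      P {S : Config | ∃ x ∈ S, x ∈ quadrant e n} := by
    simp only [fun m : ℕ => hconst (-m) n, ciSup_const]
  rw [h2] at h1
  exact (prob_compl_eq_zero_iff (hm n)).2 h1

lemma StandingAssumptions.ae_spread (hP : StandingAssumptions P) : ∀ᵐ S ∂P, Spread S := by
  have h : ∀ a b : Bool, ∀ n : ℕ, ∀ᵐ S ∂P, ∃ x ∈ S,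
      x ∈ quadrant (!₂[if a then 1 else -1, if b then 1 else -1]) n := by
    intro a b n
    refine hP.ae_quadrant ?_ _
    intro i
    fin_cases i <;> cases a <;> cases b <;> simp
  simp only [← ae_all_iff] at h
  filter_upwards [h] with S hS d c hd
  have hpos : 0 < |d 0| + |d 1| := by
    by_contra! hle
    have h0 := abs_nonneg (d 0)
    have h1 := abs_nonneg (d 1)
    exact hd (plane_ext (abs_eq_zero.1 (by linarith)) (abs_eq_zero.1 (by linarith)))
  -- On the quadrant with the signs of `d`, at height `n`, one has `d · x ≥ n (|d 0| + |d 1|)`.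
  obtain ⟨n, hn⟩ := exists_nat_gt (c / (|d 0| + |d 1|))
  rw [div_lt_iff₀ hpos] at hn
  obtain ⟨x, hx, hq⟩ := hS (0 ≤ d 0) (0 ≤ d 1) n
  refine ⟨x, hx, hn.trans_le ?_⟩
  have q0 := hq 0
  have q1 := hq 1
  simp only [decide_eq_true_eq, Matrix.cons_val_zero, Matrix.cons_val_one] at q0 q1
  have key : ∀ r y : ℝ, (n : ℝ) ≤ (if 0 ≤ r then 1 else -1) * y → |r| * n ≤ r * y := by
    intro r y h
    split_ifs at h with hr
    · rw [abs_of_nonneg hr]; nlinarith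
    · rw [abs_of_neg (not_le.1 hr)]; nlinarith
  have k0 := key _ _ q0
  have k1 := key _ _ q1
  simp only [dot]
  linarith

/-- The configurations to which the plane geometry applies. -/
structure Good (S : Config) : Prop where
  gp : GeneralPosition S
  spread : Spread S

lemma Good.shift {S : Config} (h : Good S) (z : Plane) : Good (shift z S) :=
  ⟨h.gp.shift z, h.spread.shift z⟩

lemma StandingAssumptions.ae_good (hP : StandingAssumptions P) : ∀ᵐ S ∂P, Good S := by
  filter_upwards [hP.ae_generalPosition, hP.ae_spread] with S h1 h2 using ⟨h1, h2⟩

lemma StandingAssumptions.ae_palm_good (hP : StandingAssumptions P) : ∀ᵐ S ∂palm P, Good S :=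
  hP.isStationary.ae_palm_of_ae (fun z _ h => h.shift z) hP.ae_good

/-! ### The measure carried by the edges at the origin -/

/-- The Delaunay edges at the origin. -/
def edgeSet : Set (Config × Plane) := {p | ∃ v ∈ p.1, Tri 0 p.2 v p.1}

lemma measurableSet_edgeSet : MeasurableSet edgeSet :=
  measurable_fst.exists_mem (p := fun (p : Config × Plane) v => Tri 0 p.2 v p.1)
    (measurableSet_tri measurable_fst.fst measurable_const measurable_fst.snd measurable_snd)

/-- Triangles, unlike the dimension of an intersection of cells, are defined by conditions whose
measurability is direct; they serve as a measurable substitute for the neighbor relation. -/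
lemma Good.mem_edgeSet {S : Config} (hS : Good S) {t : Plane} :
    (S, t) ∈ edgeSet ↔ IsNeighbor 0 t S := by
  constructor
  · rintro ⟨v, -, hv⟩
    exact hv.isNeighbor hS.gp
  · intro h
    obtain ⟨u, hu⟩ := hS.spread.exists_tri h
    exact ⟨u, hu.2.2.1, hu⟩

/-- The measure of the space `𝓗`: the law of the Palm version with an edge at the origin. -/
noncomputable def edgeMeasure (P : Measure Config) : Measure (Config × Plane) :=
  (palmPair P).restrict edgeSet

lemma ae_palmPair_of_ae {q : Config → Prop} (h : ∀ᵐ S ∂palm P, q S) :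
    ∀ᵐ p ∂palmPair P, q p.1 := by
  obtain ⟨N, hN, hNm, hN0⟩ := exists_measurable_superset_of_null (ae_iff.1 h)
  have : ∀ᵐ p ∂palmPair P, p.1 ∈ Nᶜ :=
    Measure.ae_compProd_of_ae_fst pointsKernel (p := fun S => S ∈ Nᶜ) hNm.compl
      (measure_eq_zero_iff_ae_notMem.1 hN0)
  filter_upwards [this] with p hp
  by_contra hq
  exact hp (hN hq)

lemma ae_edgeMeasure_of_ae {q : Config → Prop} (h : ∀ᵐ S ∂palm P, q S) :
    ∀ᵐ p ∂edgeMeasure P, q p.1 := ae_restrict_of_ae (ae_palmPair_of_ae h)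

/-- The almost sure regularity of the Palm version used below. -/
structure Regular (S : Config) : Prop where
  good : Good S
  finite : ∀ s ∈ S, {t | IsNeighbor s t S}.Finite

lemma Regular.shift {S : Config} (h : Regular S) (z : Plane) : Regular (shift z S) := by
  refine ⟨h.good.shift z, fun s hs => ?_⟩
  have := (h.finite (s + z) hs).image (fun t => t - z)
  refine this.subset ?_
  intro t ht
  refine ⟨t + z, ?_, by simp⟩
  rw [Set.mem_ofPred_eq, ← isNeighbor_shift (z := z)]
  simpa using ht

lemma StandingAssumptions.ae_palm_regular (hP : StandingAssumptions P) :
    ∀ᵐ S ∂palm P, Regular S := by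
  filter_upwards [hP.ae_palm_good, hP.isStationary.ae_palm_forall_shift hP.degree_finite]
    with S h1 h2
  refine ⟨h1, fun s hs => ?_⟩
  refine ((h2 s hs).image (fun t => t + s)).subset ?_
  intro t ht
  refine ⟨t - s, ?_, by simp⟩
  have := isNeighbor_shift (z := s).2 ht
  rwa [sub_self] at this

lemma StandingAssumptions.ae_edge (hP : StandingAssumptions P) :
    ∀ᵐ p ∂edgeMeasure P, Regular p.1 ∧ IsNeighbor 0 p.2 p.1 := by
  filter_upwards [ae_edgeMeasure_of_ae hP.ae_palm_regular,
    ae_restrict_mem measurableSet_edgeSet] with p h1 h2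
  exact ⟨h1, h1.good.mem_edgeSet.1 h2⟩

lemma StandingAssumptions.ae_edge_of_ae (hP : StandingAssumptions P) {q : Config → Plane → Prop}
    (h : ∀ᵐ S ∂palm P, ∀ t, IsNeighbor 0 t S → q S t) : ∀ᵐ p ∂edgeMeasure P, q p.1 p.2 := by
  filter_upwards [ae_edgeMeasure_of_ae h, hP.ae_edge] with p h1 h2 using h1 p.2 h2.2

open Classical in
/-- The neighbors of the origin. -/
noncomputable def nbrs (S : Config) : Finset Plane :=
  if h : {t | IsNeighbor 0 t S}.Finite then h.toFinset else ∅

lemma Regular.mem_nbrs {S : Config} (hS : Regular S) (h0 : 0 ∈ S) {t : Plane} :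
    t ∈ nbrs S ↔ IsNeighbor 0 t S := by
  rw [nbrs, dif_pos (hS.finite 0 h0)]
  simp

lemma points_singleton {S : Config} {x : Plane} (hx : x ∈ S) : S.points {x} = 1 := by
  rw [points_apply _ (measurableSet_singleton x),
    Set.inter_eq_self_of_subset_right (Set.singleton_subset_iff.2 hx)]
  simp

lemma Regular.indicator_eq {S : Config} (hS : Regular S) (h0 : 0 ∈ S) {E : Type*} [Zero E]
    (f : Plane → E) : (fun t => {t | (S, t) ∈ edgeSet}.indicator f t) =
      (nbrs S : Set Plane).indicator f := by
  have : {t | (S, t) ∈ edgeSet} = (nbrs S : Set Plane) := by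
    ext t
    rw [Set.mem_ofPred_eq, hS.good.mem_edgeSet, Finset.mem_coe, hS.mem_nbrs h0]
  rw [this]

lemma integral_points_finset {S : Config} {s : Finset Plane} (hs : ∀ x ∈ s, x ∈ S)
    {E : Type*} [NormedAddCommGroup E] [NormedSpace ℝ E] [CompleteSpace E] (f : Plane → E) :
    ∫ t, (s : Set Plane).indicator f t ∂S.points = ∑ t ∈ s, f t := by
  have hint : IntegrableOn f (s : Set Plane) S.points := by
    rw [← Set.biUnion_of_singleton (s : Set Plane), integrableOn_finite_biUnion s.finite_toSet]
    exact fun x hx => integrableOn_singleton (by simp)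
      ((points_singleton (hs x hx)).trans_lt ENNReal.one_lt_top)
  rw [integral_indicator s.measurableSet, setIntegral_finset s hint]
  refine Finset.sum_congr rfl fun x hx => ?_
  rw [measureReal_def, points_singleton (hs x hx)]
  simp

lemma Regular.integral_edges {S : Config} (hS : Regular S) (h0 : 0 ∈ S) {E : Type*}
    [NormedAddCommGroup E] [NormedSpace ℝ E] [CompleteSpace E] (f : Plane → E) :
    ∫ t, {t | (S, t) ∈ edgeSet}.indicator f t ∂S.points = ∑ t ∈ nbrs S, f t := by
  rw [hS.indicator_eq h0]
  exact integral_points_finset (fun x hx => ((hS.mem_nbrs h0).1 hx).2.1) f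

lemma Regular.lintegral_edges {S : Config} (hS : Regular S) (h0 : 0 ∈ S) (f : Plane → ℝ≥0∞) :
    ∫⁻ t, {t | (S, t) ∈ edgeSet}.indicator f t ∂S.points = ∑ t ∈ nbrs S, f t := by
  rw [hS.indicator_eq h0, lintegral_indicator (nbrs S).measurableSet, lintegral_finset]
  refine Finset.sum_congr rfl fun x hx => ?_
  rw [points_singleton ((hS.mem_nbrs h0).1 hx).2.1, mul_one]

lemma cond_of_isNeighbor {S : Config} {s t : Plane} (h : IsNeighbor s t S) : cond s t S = 1 := by
  classical
  exact if_pos h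

lemma cond_of_not {S : Config} {s t : Plane} (h : ¬ IsNeighbor s t S) : cond s t S = 0 := by
  classical
  exact if_neg h

lemma Regular.tsum_cond {S : Config} (hS : Regular S) (h0 : 0 ∈ S) (f : Plane → ℝ) :
    ∑' t : S, cond 0 (t : Plane) S * f t = ∑ t ∈ nbrs S, f t := by
  have h1 : ∀ t : Plane, t ∉ nbrs S → cond 0 t S * f t = 0 := by
    intro t ht
    rw [hS.mem_nbrs h0] at ht
    rw [cond_of_not ht, zero_mul]
  have h2 : (∑' t : S, cond 0 (t : Plane) S * f t) =
      ∑' t : Plane, (S : Set Plane).indicator (fun t => cond 0 t S * f t) t :=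
    tsum_subtype (S : Set Plane) (fun t => cond 0 t S * f t)
  rw [h2, tsum_eq_sum (s := nbrs S)]
  · refine Finset.sum_congr rfl fun t ht => ?_
    have ht' := (hS.mem_nbrs h0).1 ht
    rw [Set.indicator_of_mem (show t ∈ (S : Set Plane) from ht'.2.1), cond_of_isNeighbor ht',
      one_mul]
  · intro t ht
    by_cases hts : t ∈ (S : Set Plane)
    · rw [Set.indicator_of_mem hts, h1 t ht]
    · rw [Set.indicator_of_notMem hts]

lemma Regular.tsum_ofReal_cond {S : Config} (hS : Regular S) (h0 : 0 ∈ S) (f : Plane → ℝ≥0∞) :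
    ∑' t : S, ENNReal.ofReal (cond 0 (t : Plane) S) * f t = ∑ t ∈ nbrs S, f t := by
  rw [← lintegral_points S (fun t => ENNReal.ofReal (cond 0 t S) * f t),
    ← hS.lintegral_edges h0 f]
  refine lintegral_congr fun t => ?_
  by_cases ht : IsNeighbor 0 t S
  · rw [Set.indicator_of_mem (by exact hS.good.mem_edgeSet.2 ht), cond_of_isNeighbor ht]
    simp
  · rw [Set.indicator_of_notMem (by exact fun h => ht (hS.good.mem_edgeSet.1 h)), cond_of_not ht]
    simp

lemma StandingAssumptions.lintegral_edgeMeasure (hP : StandingAssumptions P)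
    {F : Config × Plane → ℝ≥0∞} (hF : Measurable F) :
    ∫⁻ p, F p ∂edgeMeasure P = ∫⁻ S, ∑ t ∈ nbrs S, F (S, t) ∂palm P := by
  rw [edgeMeasure, ← lintegral_indicator measurableSet_edgeSet,
    hP.isStationary.lintegral_palmPair (hF.indicator measurableSet_edgeSet)]
  refine lintegral_congr_ae ?_
  filter_upwards [hP.ae_palm_regular, ae_zero_mem_palm] with S hS h0
  rw [← hS.lintegral_edges h0]
  rfl

lemma StandingAssumptions.integral_edgeMeasure (hP : StandingAssumptions P)
    {F : Config × Plane → ℝ} (hF : Integrable F (edgeMeasure P)) :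
    Integrable (fun S => ∑ t ∈ nbrs S, F (S, t)) (palm P) ∧
      ∫ p, F p ∂edgeMeasure P = ∫ S, ∑ t ∈ nbrs S, F (S, t) ∂palm P := by
  have := hP.isStationary.palm_prob
  have hi : Integrable (edgeSet.indicator F) (palm P ⊗ₘ pointsKernel) :=
    (integrable_indicator_iff measurableSet_edgeSet).2 hF
  have hae : (fun S => ∫ t, edgeSet.indicator F (S, t) ∂pointsKernel S) =ᵐ[palm P]
      fun S => ∑ t ∈ nbrs S, F (S, t) := by
    filter_upwards [hP.ae_palm_regular, ae_zero_mem_palm] with S hS h0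
    exact hS.integral_edges h0 fun t => F (S, t)
  refine ⟨(Integrable.integral_compProd hi).congr hae, ?_⟩
  rw [edgeMeasure, ← integral_indicator measurableSet_edgeSet, palmPair,
    Measure.integral_compProd hi]
  exact integral_congr_ae hae

/-- `exchange` as a measurable equivalence. -/
noncomputable def exchangeEquiv : (Config × Plane) ≃ᵐ (Config × Plane) where
  toFun := exchange
  invFun := exchange
  left_inv := exchange_exchange
  right_inv := exchange_exchange
  measurable_toFun := measurable_exchange
  measurable_invFun := measurable_exchange

lemma isNeighbor_neg_shift {S : Config} {t : Plane} :
    IsNeighbor 0 (-t) (shift t S) ↔ IsNeighbor t 0 S := by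
  rw [← isNeighbor_shift (s := t) (t := 0) (z := t), sub_self, zero_sub]

/-- The exchange preserves the law of the marked Palm version, and the neighbor relation is
symmetric. -/
lemma StandingAssumptions.exchange_edge (hP : StandingAssumptions P) :
    MeasurePreserving exchange (edgeMeasure P) (edgeMeasure P) := by
  have h := hP.isStationary.measurePreserving_exchange.restrict_preimage measurableSet_edgeSet
  have he : exchange ⁻¹' edgeSet =ᵐ[palmPair P] edgeSet := by
    filter_upwards [ae_palmPair_of_ae hP.ae_palm_good] with p hp
    have h1 : (exchange p ∈ edgeSet) ↔ IsNeighbor 0 (-p.2) (shift p.2 p.1) :=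
      (hp.shift p.2).mem_edgeSet
    have h2 : p ∈ edgeSet ↔ IsNeighbor 0 p.2 p.1 := hp.mem_edgeSet
    rw [isNeighbor_neg_shift] at h1
    exact propext (h1.trans (Iff.trans ⟨IsNeighbor.symm, IsNeighbor.symm⟩ h2.symm))
  rw [Measure.restrict_congr_set he] at h
  exact h

/-! ### Representatives of fields -/

/-- `f` represents the values of the field `ζ` on the edges at the origin. -/
structure IsRep (P : Measure Config) (ζ : Field) (f : Config × Plane → ℝ) : Prop where
  measurable : Measurable f
  eq : ∀ᵐ S ∂palm P, ∀ t, IsNeighbor 0 t S → ζ 0 t S = f (S, t)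
  memLp : MemLp f 2 (edgeMeasure P)

lemma StandingAssumptions.campbell_eq (hP : StandingAssumptions P) {ζ : Field}
    {f : Config × Plane → ℝ} (hf : Measurable f)
    (h : ∀ᵐ S ∂palm P, ∀ t, IsNeighbor 0 t S → ζ 0 t S = f (S, t)) :
    campbell P (fun s t S => ENNReal.ofReal (ζ s t S ^ 2)) =
      2⁻¹ * ∫⁻ p, ENNReal.ofReal (f p ^ 2) ∂edgeMeasure P := by
  rw [campbell, hP.lintegral_edgeMeasure (hf.pow_const 2).ennreal_ofReal]
  congr 1
  refine lintegral_congr_ae ?_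
  filter_upwards [hP.ae_palm_regular, ae_zero_mem_palm, h] with S hS h0 hS2
  rw [hS.tsum_ofReal_cond h0 fun t => ENNReal.ofReal (ζ 0 t S ^ 2)]
  refine Finset.sum_congr rfl fun t ht => ?_
  rw [hS2 t ((hS.mem_nbrs h0).1 ht)]

lemma memLp_two_iff_lintegral {f : Config × Plane → ℝ} (hf : Measurable f) :
    MemLp f 2 (edgeMeasure P) ↔ ∫⁻ p, ENNReal.ofReal (f p ^ 2) ∂edgeMeasure P < ∞ := by
  rw [memLp_two_iff_integrable_sq hf.aestronglyMeasurable, Integrable,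
    hasFiniteIntegral_iff_ofReal (Eventually.of_forall fun p => sq_nonneg (f p))]
  exact and_iff_right (hf.pow_const 2).aestronglyMeasurable

lemma StandingAssumptions.exists_isRep (hP : StandingAssumptions P) {ζ : Field} (h : MemH P ζ) :
    ∃ f, IsRep P ζ f := by
  obtain ⟨ζ', hm, he⟩ := h.measurable
  have hm' : Measurable fun p : Config × Plane => ζ' p.swap := hm.comp measurable_swap
  refine ⟨fun p => ζ' p.swap, hm', he, ?_⟩
  have h2 := h.sq_integrable
  rw [hP.campbell_eq hm' he] at h2
  rw [memLp_two_iff_lintegral hm']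
  by_contra hcon
  rw [not_lt, top_le_iff] at hcon
  rw [hcon, ENNReal.mul_top (by simp)] at h2
  exact lt_irrefl _ h2

lemma StandingAssumptions.memH_of_isRep (hP : StandingAssumptions P) {ζ : Field}
    {f : Config × Plane → ℝ} (h : IsRep P ζ f) (hc : ∀ᵐ S ∂palm P, IsCovariantOn ζ S) :
    MemH P ζ := by
  refine ⟨⟨fun p => f p.swap, h.measurable.comp measurable_swap, h.eq⟩, hc, ?_⟩
  rw [hP.campbell_eq h.measurable h.eq]
  exact ENNReal.mul_lt_top (by simp) ((memLp_two_iff_lintegral h.measurable).1 h.memLp)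

lemma StandingAssumptions.isFiniteMeasure_edge (hP : StandingAssumptions P) :
    IsFiniteMeasure (edgeMeasure P) := by
  obtain ⟨β, hβ, hint⟩ := hP.degree_moment
  constructor
  rw [← lintegral_one, hP.lintegral_edgeMeasure measurable_const]
  have : ∫⁻ S, ∑ t ∈ nbrs S, (1 : ℝ≥0∞) ∂palm P ≤
      -- From `x ≤ β⁻¹ exp (β x)`, the exponential moment of the degree bounds its mean, which is
      -- the total mass.
      ∫⁻ S, ENNReal.ofReal β⁻¹ * ENNReal.ofReal (Real.exp (β * degreeZero S)) ∂palm P := by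
    refine lintegral_mono_ae ?_
    filter_upwards [hP.ae_palm_regular, ae_zero_mem_palm] with S hS h0
    have hd : degreeZero S = (nbrs S).card := by
      have := hS.tsum_cond h0 fun _ => 1
      simp only [mul_one, Finset.sum_const, nsmul_eq_mul] at this
      exact this
    rw [hd, ← ENNReal.ofReal_mul (by positivity), Finset.sum_const, nsmul_eq_mul, mul_one,
      ← ENNReal.ofReal_natCast]
    refine ENNReal.ofReal_le_ofReal ?_
    have := Real.add_one_le_exp (β * (nbrs S).card)
    rw [inv_mul_eq_div, le_div_iff₀ hβ]
    linarith
  refine this.trans_lt ?_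
  rw [lintegral_const_mul' _ _ (by simp)]
  exact ENNReal.mul_lt_top (by simp) hint

lemma StandingAssumptions.memLp_norm (hP : StandingAssumptions P) :
    MemLp (fun p : Config × Plane => ‖p.2‖) 2 (edgeMeasure P) := by
  have := hP.isFiniteMeasure_edge
  have hm : Measurable fun p : Config × Plane => ‖p.2‖ := measurable_snd.norm
  rw [memLp_two_iff_lintegral hm]
  obtain ⟨r, hr, hint⟩ := hP.edge_moment
  have hm2 : Measurable fun p : Config × Plane => ENNReal.ofReal (‖p.2‖ ^ r) :=
    (hm.pow_const r).ennreal_ofReal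
  have h1 : ∫⁻ p, ENNReal.ofReal (‖p.2‖ ^ r) ∂edgeMeasure P < ∞ := by
    rw [hP.lintegral_edgeMeasure hm2]
    refine lt_of_le_of_lt (le_of_eq (lintegral_congr_ae ?_)) hint
    filter_upwards [hP.ae_palm_regular, ae_zero_mem_palm] with S hS h0
    rw [← hS.tsum_ofReal_cond h0 fun t => ENNReal.ofReal (‖t‖ ^ r)]
    refine tsum_congr fun t => ?_
    rw [ENNReal.ofReal_mul]
    by_cases ht : IsNeighbor 0 (t : Plane) S
    · rw [cond_of_isNeighbor ht]; exact zero_le_one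
    · rw [cond_of_not ht]
  calc ∫⁻ p, ENNReal.ofReal (‖p.2‖ ^ 2) ∂edgeMeasure P
      ≤ ∫⁻ p, 1 + ENNReal.ofReal (‖p.2‖ ^ r) ∂edgeMeasure P := by
        refine lintegral_mono fun p => ?_
        rw [← ENNReal.ofReal_one, ← ENNReal.ofReal_add zero_le_one (by positivity)]
        refine ENNReal.ofReal_le_ofReal ?_
        rcases le_total ‖p.2‖ 1 with h | h
        · have h2 : ‖p.2‖ ^ 2 ≤ 1 := pow_le_one₀ (norm_nonneg _) h
          have : 0 ≤ ‖p.2‖ ^ r := by positivity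
          linarith
        · have : ‖p.2‖ ^ (2 : ℝ) ≤ ‖p.2‖ ^ r := Real.rpow_le_rpow_of_exponent_le h (by linarith)
          rw [Real.rpow_two] at this
          linarith
    _ < ∞ := by
        rw [lintegral_add_left measurable_const, lintegral_const, one_mul]
        exact ENNReal.add_lt_top.2 ⟨measure_lt_top _ _, h1⟩

lemma StandingAssumptions.memLp_coord (hP : StandingAssumptions P) (i : Fin 2) :
    MemLp (fun p : Config × Plane => p.2 i) 2 (edgeMeasure P) := by
  refine hP.memLp_norm.mono' (measurable_snd.plane_apply i).aestronglyMeasurable ?_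
  exact Eventually.of_forall fun p => PiLp.norm_apply_le p.2 i

lemma IsRep.eq_coord {G : Plane → Config → Plane} (i : Fin 2) {f : Config × Plane → ℝ}
    (h : IsRep P (grad (coord G i)) f) (h0 : ∀ᵐ S ∂palm P, G 0 S = 0) :
    ∀ᵐ S ∂palm P, ∀ t, IsNeighbor 0 t S → G t S i = f (S, t) := by
  filter_upwards [h.eq, h0] with S h1 h2 t ht
  rw [← h1 t ht, grad, cond_of_isNeighbor ht]
  simp [coord, h2]

lemma IsCovariantOn.congr_mul {ζ ξ : Field} {S : Config} (h : IsCovariantOn ζ S)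
    (hc : ∀ s t u T, ξ (t - s) (u - s) (shift s T) - ζ (t - s) (u - s) (shift s T) =
      ξ t u T - ζ t u T) : IsCovariantOn ξ S := by
  intro s hs t ht u hu
  have h1 := h s hs t ht u hu
  have h2 := hc s t u S
  linarith

lemma grad_coord_sub (G : Plane → Config → Plane) (i : Fin 2) (s t : Plane) (S : Config) :
    grad (coord G i) s t S - grad (correctorCoord G i) s t S = cond s t S * (t i - s i) := by
  simp only [grad, coord, correctorCoord, PiLp.sub_apply]
  ring

lemma covariant_coord_iff (G : Plane → Config → Plane) (i : Fin 2) (S : Config) :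
    IsCovariantOn (grad (coord G i)) S ↔ IsCovariantOn (grad (correctorCoord G i)) S := by
  constructor <;> intro h <;> refine h.congr_mul fun s t u T => ?_
  · have h1 := grad_coord_sub G i (t - s) (u - s) (shift s T)
    have h2 := grad_coord_sub G i t u T
    rw [cond_shift, PiLp.sub_apply, PiLp.sub_apply, sub_sub_sub_cancel_right] at h1
    linarith
  · have h1 := grad_coord_sub G i (t - s) (u - s) (shift s T)
    have h2 := grad_coord_sub G i t u T
    rw [cond_shift, PiLp.sub_apply, PiLp.sub_apply, sub_sub_sub_cancel_right] at h1
    linarith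

/-- The two gradients differ by that of the identity map, which is covariant and square integrable
because the edges have a second moment. -/
lemma StandingAssumptions.memH_coord_iff (hP : StandingAssumptions P)
    (G : Plane → Config → Plane) (i : Fin 2) :
    MemH P (grad (coord G i)) ↔ MemH P (grad (correctorCoord G i)) := by
  have hm : Measurable fun p : Config × Plane => p.2 i := measurable_snd.plane_apply i
  constructor
  · intro h
    obtain ⟨f, hf⟩ := hP.exists_isRep h
    refine hP.memH_of_isRep (f := fun p => f p - p.2 i)
      ⟨hf.measurable.sub hm, ?_, hf.memLp.sub (hP.memLp_coord i)⟩ ?_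
    · filter_upwards [hf.eq] with S hS t ht
      have h2 := grad_coord_sub G i 0 t S
      rw [cond_of_isNeighbor ht] at h2
      rw [← hS t ht]
      simp at h2
      linarith
    · filter_upwards [h.covariant] with S hS using (covariant_coord_iff G i S).1 hS
  · intro h
    obtain ⟨f, hf⟩ := hP.exists_isRep h
    refine hP.memH_of_isRep (f := fun p => f p + p.2 i)
      ⟨hf.measurable.add hm, ?_, hf.memLp.add (hP.memLp_coord i)⟩ ?_
    · filter_upwards [hf.eq] with S hS t ht
      have h2 := grad_coord_sub G i 0 t S
      rw [cond_of_isNeighbor ht] at h2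
      rw [← hS t ht]
      simp at h2
      linarith
    · filter_upwards [h.covariant] with S hS using (covariant_coord_iff G i S).2 hS

lemma StandingAssumptions.isDeformation (hP : StandingAssumptions P)
    {H : Plane → Config → Plane} (hH : IsHarmonicDeformation P H) : IsDeformation P H :=
  ⟨hH.zero, fun i => (hP.memH_coord_iff H i).1 (hH.gradient i), hH.tilt⟩

/-! ### The star sum and the Dirichlet energy -/

lemma Good.alphaPlus_left {S : Config} (hS : Good S) {s : Plane} (h : IsNeighbor 0 s S) :
    IsNeighbor 0 (alphaPlus 0 s S) S ∧ IsNeighbor s (alphaPlus 0 s S) S ∧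
      alphaPlus (alphaPlus 0 s S) 0 S = s := by
  have ht := tri_alphaPlus hS.gp hS.spread h
  exact ⟨(ht.rotate.rotate.isNeighbor hS.gp).symm, ht.rotate.isNeighbor hS.gp,
    ht.rotate.rotate.alphaPlus_eq hS.gp⟩

lemma Good.alphaPlus_right {S : Config} (hS : Good S) {s : Plane} (h : IsNeighbor 0 s S) :
    IsNeighbor 0 (alphaPlus s 0 S) S ∧ alphaPlus 0 (alphaPlus s 0 S) S = s := by
  have ht := tri_alphaPlus hS.gp hS.spread h.symm
  exact ⟨ht.rotate.isNeighbor hS.gp, ht.rotate.alphaPlus_eq hS.gp⟩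

/-- Rotating around the origin, from each triangle to the next, permutes the neighbors: `s ↦ α₊(0,
s)` and `s ↦ α₊(s, 0)` are inverse to each other. -/
lemma Regular.sum_alphaPlus_left {S : Config} (hS : Regular S) (h0 : 0 ∈ S) {M : Type*}
    [AddCommMonoid M] (f : Plane → M) :
    ∑ s ∈ nbrs S, f (alphaPlus 0 s S) = ∑ s ∈ nbrs S, f s := by
  refine Finset.sum_nbij' (fun s => alphaPlus 0 s S) (fun s => alphaPlus s 0 S) ?_ ?_ ?_ ?_ ?_
  all_goals intro s hs
  all_goals try rw [hS.mem_nbrs h0] at *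
  · exact (hS.good.alphaPlus_left hs).1
  · exact (hS.good.alphaPlus_right hs).1
  · exact (hS.good.alphaPlus_left hs).2.2
  · exact (hS.good.alphaPlus_right hs).2

lemma Regular.sum_alphaPlus_right {S : Config} (hS : Regular S) (h0 : 0 ∈ S) {M : Type*}
    [AddCommMonoid M] (f : Plane → M) :
    ∑ s ∈ nbrs S, f (alphaPlus s 0 S) = ∑ s ∈ nbrs S, f s := by
  refine Finset.sum_nbij' (fun s => alphaPlus s 0 S) (fun s => alphaPlus 0 s S) ?_ ?_ ?_ ?_ ?_
  all_goals intro s hs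
  all_goals try rw [hS.mem_nbrs h0] at *
  · exact (hS.good.alphaPlus_right hs).1
  · exact (hS.good.alphaPlus_left hs).1
  · exact (hS.good.alphaPlus_right hs).2
  · exact (hS.good.alphaPlus_left hs).2.2

/-- A measurable version of `α₊(0, s)`. -/
noncomputable def alphaMeas (p : Config × Plane) : Plane :=
  ∫ v, {v | Tri 0 p.2 v p.1}.indicator id v ∂p.1.points

lemma measurable_alphaMeas : Measurable alphaMeas := by
  refine measurable_fst.integral_points
    (F := fun (p : Config × Plane) v => {v | Tri 0 p.2 v p.1}.indicator id v) ?_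
  have hm := measurableSet_tri (T := fun q : (Config × Plane) × Plane => q.1.1)
    measurable_fst.fst measurable_const measurable_fst.snd measurable_snd (f := fun _ => 0)
  exact measurable_snd.indicator hm

lemma Good.alphaMeas_eq {S : Config} (hS : Good S) {t : Plane} (h : IsNeighbor 0 t S) :
    alphaMeas (S, t) = alphaPlus 0 t S := by
  have ht := tri_alphaPlus hS.gp hS.spread h
  have hset : {v | Tri 0 t v S} = (({alphaPlus 0 t S} : Finset Plane) : Set Plane) := by
    ext v
    simp only [Set.mem_ofPred_eq, Finset.coe_singleton, Set.mem_singleton_iff]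
    exact ⟨fun hv => ht.unique hS.gp hv, fun hv => hv ▸ ht⟩
  rw [alphaMeas, hset, integral_points_finset]
  · simp
  · simpa using ht.2.2.1

/-- The increment of the represented field along the edge opposite to the origin. -/
noncomputable def opposite (f : Config × Plane → ℝ) (p : Config × Plane) : ℝ :=
  f (shift p.2 p.1, alphaMeas p - p.2)

lemma measurable_opposite {f : Config × Plane → ℝ} (hf : Measurable f) :
    Measurable (opposite f) :=
  hf.comp ((measurable_fst.shift measurable_snd).prodMk (measurable_alphaMeas.sub measurable_snd))

/-- Seen from `s`, the triangle on the clockwise side of the edge to `0` has third vertex `α₊(s,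
0)`; the edge opposite to `s` then starts at the true origin. -/
lemma opposite_exchange {f : Config × Plane → ℝ} {S : Config} (hS : Good S) {s : Plane}
    (h : IsNeighbor 0 s S) : opposite f (exchange (S, s)) = f (S, alphaPlus s 0 S) := by
  have hg := hS.shift s
  have hn : IsNeighbor 0 (-s) (shift s S) := isNeighbor_neg_shift.2 h.symm
  have ht := tri_alphaPlus hS.gp hS.spread h.symm
  have ht' : Tri 0 (-s) (alphaPlus s 0 S - s) (shift s S) := by
    rw [← tri_shift (z := s), sub_self, zero_sub] at ht
    exact ht
  simp only [opposite, exchange, shift_shift, neg_add_cancel, shift_zero]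
  rw [hg.alphaMeas_eq hn, ht'.alphaPlus_eq hg.gp, sub_neg_eq_add, sub_add_cancel]

/-- After the exchange, the opposite edges become the edges from the origin to `α₊(s, 0)`, and these
run once through all neighbors. -/
lemma StandingAssumptions.opposite_sq (hP : StandingAssumptions P) {f : Config × Plane → ℝ}
    (hf : Measurable f) (hL : MemLp f 2 (edgeMeasure P)) :
    MemLp (opposite f) 2 (edgeMeasure P) ∧
      ∫ p, opposite f p ^ 2 ∂edgeMeasure P = ∫ p, f p ^ 2 ∂edgeMeasure P := by
  have hm := measurable_opposite hf
  have key : ∫⁻ p, ENNReal.ofReal (opposite f p ^ 2) ∂edgeMeasure P =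
      ∫⁻ p, ENNReal.ofReal (f p ^ 2) ∂edgeMeasure P := by
    have hm1 : Measurable fun p => ENNReal.ofReal (opposite f p ^ 2) :=
      (hm.pow_const 2).ennreal_ofReal
    have hm2 : Measurable fun p => ENNReal.ofReal (f p ^ 2) := (hf.pow_const 2).ennreal_ofReal
    rw [← hP.exchange_edge.lintegral_comp hm1,
      hP.lintegral_edgeMeasure (F := fun p => ENNReal.ofReal (opposite f (exchange p) ^ 2))
        (hm1.comp measurable_exchange), hP.lintegral_edgeMeasure hm2]
    refine lintegral_congr_ae ?_
    filter_upwards [hP.ae_palm_regular, ae_zero_mem_palm] with S hS h0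
    rw [← hS.sum_alphaPlus_right h0 fun t => ENNReal.ofReal (f (S, t) ^ 2)]
    refine Finset.sum_congr rfl fun s hs => ?_
    rw [opposite_exchange hS.good ((hS.mem_nbrs h0).1 hs)]
  refine ⟨?_, ?_⟩
  · rw [memLp_two_iff_lintegral hm, key]
    exact (memLp_two_iff_lintegral hf).1 hL
  · rw [integral_eq_lintegral_of_nonneg_ae (Eventually.of_forall fun p => sq_nonneg _)
      (hm.pow_const 2).aestronglyMeasurable,
      integral_eq_lintegral_of_nonneg_ae (Eventually.of_forall fun p => sq_nonneg _)
      (hf.pow_const 2).aestronglyMeasurable, key]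

/-- The mean star sum of a deformation is half its Dirichlet energy. -/
lemma StandingAssumptions.integral_starSum (hP : StandingAssumptions P)
    {G : Plane → Config → Plane} (hG : IsDeformation P G) {g : Fin 2 → Config × Plane → ℝ}
    (hg : ∀ i, IsRep P (grad (coord G i)) (g i)) :
    Integrable (starSum G) (palm P) ∧
      ∫ S, starSum G S ∂palm P = 2⁻¹ * ∑ i, ∫ p, g i p ^ 2 ∂edgeMeasure P := by
  have hcov : ∀ i, ∀ᵐ S ∂palm P, IsCovariantOn (grad (coord G i)) S := fun i =>
    ((hP.memH_coord_iff G i).2 (hG.corrector i)).covariant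
  have hopp := fun i => hP.opposite_sq (hg i).measurable (hg i).memLp
  have hFi : ∀ i, Integrable (fun p => g i p ^ 2 - 2⁻¹ * opposite (g i) p ^ 2) (edgeMeasure P) :=
    fun i => (hg i).memLp.integrable_sq.sub ((hopp i).1.integrable_sq.const_mul _)
  have hF : Integrable (fun p => ∑ i, (g i p ^ 2 - 2⁻¹ * opposite (g i) p ^ 2)) (edgeMeasure P) :=
    integrable_finsetSum _ fun i _ => hFi i
  obtain ⟨h1, h2⟩ := hP.integral_edgeMeasure hF
  have hae : (fun S => ∑ t ∈ nbrs S, ∑ i, (g i (S, t) ^ 2 - 2⁻¹ * opposite (g i) (S, t) ^ 2))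
      =ᵐ[palm P] starSum G := by
    filter_upwards [hP.ae_palm_regular, ae_zero_mem_palm, hG.zero, ae_all_iff.2 hcov,
      ae_all_iff.2 fun i => (hg i).eq_coord i hG.zero,
      ae_all_iff.2 fun i => hP.isStationary.ae_palm_forall_shift (hg i).eq]
      with S hS h0 hz hc he hes
    rw [starSum, hS.tsum_cond h0 fun s => inner ℝ (G s S) (G (alphaPlus 0 s S) S)]
    -- Covariance identifies the representative, evaluated from `s`, with the increment of `G` in
    -- the original configuration.
    have hterm : ∀ s ∈ nbrs S, ∀ i, opposite (g i) (S, s) =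
        G (alphaPlus 0 s S) S i - G s S i := by
      intro s hs i
      have hn := (hS.mem_nbrs h0).1 hs
      obtain ⟨ha, hb, -⟩ := hS.good.alphaPlus_left hn
      have hb' := isNeighbor_shift (z := s).2 hb
      rw [sub_self] at hb'
      rw [opposite, hS.good.alphaMeas_eq hn, ← hes i s hn.2.1 _ hb']
      have := hc i s hn.2.1 s hn.2.1 _ ha.2.1
      rw [sub_self] at this
      rw [this, grad, cond_of_isNeighbor hb, one_mul]
      rfl
    have hinner : ∀ x y : Plane, inner ℝ x y = x 0 * y 0 + x 1 * y 1 := by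
      intro x y
      rw [PiLp.inner_apply, Fin.sum_univ_two]
      simp [mul_comm]
    have hsum := hS.sum_alphaPlus_left h0 fun s => G s S 0 ^ 2 + G s S 1 ^ 2
    -- Polarization leaves `½ |G(s)|² - ½ |G(α₊(0, s))|²`, which cancels in the sum since `α₊(0, ·)`
    -- permutes the neighbors.
    have hrew : ∀ s ∈ nbrs S, ∑ i, (g i (S, s) ^ 2 - 2⁻¹ * opposite (g i) (S, s) ^ 2) =
        inner ℝ (G s S) (G (alphaPlus 0 s S) S) + 2⁻¹ * (G s S 0 ^ 2 + G s S 1 ^ 2) -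
          2⁻¹ * (G (alphaPlus 0 s S) S 0 ^ 2 + G (alphaPlus 0 s S) S 1 ^ 2) := by
      intro s hs
      have hn := (hS.mem_nbrs h0).1 hs
      rw [Fin.sum_univ_two, hterm s hs, hterm s hs, ← he 0 s hn, ← he 1 s hn, hinner]
      ring
    rw [Finset.sum_congr rfl hrew, Finset.sum_sub_distrib, Finset.sum_add_distrib,
      ← Finset.mul_sum, ← Finset.mul_sum, hsum]
    ring
  refine ⟨h1.congr hae, ?_⟩
  rw [← integral_congr_ae hae, ← h2, integral_finsetSum _ fun i _ => hFi i,
    Finset.mul_sum]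
  refine Finset.sum_congr rfl fun i _ => ?_
  rw [integral_sub (hg i).memLp.integrable_sq ((hopp i).1.integrable_sq.const_mul _),
    integral_const_mul, (hopp i).2]
  ring

/-! ### Centers of cells -/

lemma exists_isCenter {S : Config} (hS : ∃ s, s ∈ S) (x : Plane) : ∃ c, IsCenter x S c := by
  obtain ⟨s, hs⟩ := hS
  obtain ⟨t, ⟨htS, hts⟩, hmin⟩ := Set.exists_min_image _ (fun t => dist x t)
    (S.finite_inter_coe (Metric.isBounded_closedBall (x := x) (r := dist x s)))
    ⟨s, hs, by rw [Metric.mem_closedBall, dist_comm]⟩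
  have ht : x ∈ vor t S := by
    intro v hv
    by_cases h : dist x v ≤ dist x s
    · exact hmin v ⟨hv, by rwa [Metric.mem_closedBall, dist_comm]⟩
    · rw [Metric.mem_closedBall, dist_comm] at hts
      exact hts.trans (not_le.1 h).le
  have hfin : {c | c ∈ S ∧ x ∈ vor c S}.Finite := by
    refine (S.finite_inter_coe (Metric.isBounded_closedBall (x := x) (r := dist x t))).subset ?_
    rintro c ⟨hc, hxc⟩
    refine ⟨hc, ?_⟩
    rw [Metric.mem_closedBall, dist_comm]
    exact hxc t htS
  obtain ⟨c, ⟨hc, hxc⟩, hcmin⟩ := Set.exists_min_image _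
    (fun c : Plane => toLex (c 0, c 1)) hfin ⟨t, htS, ht⟩
  exact ⟨c, hc, hxc, fun v hv hxv => hcmin v ⟨hv, hxv⟩⟩

lemma IsCenter.unique {S : Config} {x c d : Plane} (hc : IsCenter x S c) (hd : IsCenter x S d) :
    c = d := by
  have h := le_antisymm (hc.2.2 d hd.1 hd.2.1) (hd.2.2 c hc.1 hc.2.1)
  have h' : ((c 0, c 1) : ℝ × ℝ) = (d 0, d 1) := toLex.injective h
  exact plane_ext (congrArg Prod.fst h') (congrArg Prod.snd h')

lemma IsCenter.cen_eq {S : Config} {x c : Plane} (hc : IsCenter x S c) : cen x S = c := by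
  have h : ∃ c, IsCenter x S c := ⟨c, hc⟩
  rw [cen, dif_pos h]
  exact h.choose_spec.unique hc

lemma isCenter_cen {S : Config} (hS : ∃ s, s ∈ S) (x : Plane) : IsCenter x S (cen x S) := by
  obtain ⟨c, hc⟩ := exists_isCenter hS x
  rwa [hc.cen_eq]

lemma cen_mem {S : Config} (hS : ∃ s, s ∈ S) (x : Plane) : cen x S ∈ S := (isCenter_cen hS x).1

lemma cen_self {S : Config} {s : Plane} (hs : s ∈ S) : cen s S = s := by
  have h := (isCenter_cen ⟨s, hs⟩ s).2.1 s hs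
  rw [dist_self] at h
  exact (dist_le_zero.1 h).symm

lemma cen_shift {S : Config} (hS : ∃ s, s ∈ S) (x z : Plane) :
    cen (x - z) (shift z S) = cen x S - z := by
  obtain ⟨h1, h2, h3⟩ := isCenter_cen hS x
  refine IsCenter.cen_eq ⟨mem_shift_sub.2 h1, mem_vor_shift.2 h2, fun t ht hxt => ?_⟩
  have hxt' : x ∈ vor (t + z) S := by
    rw [← mem_vor_shift (z := z), add_sub_cancel_right]; exact hxt
  have := h3 (t + z) ht hxt'
  rw [Prod.Lex.toLex_le_toLex] at this ⊢
  simp only [PiLp.add_apply, PiLp.sub_apply] at this ⊢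
  rcases this with h | ⟨h, h'⟩
  · left; linarith
  · right; exact ⟨by linarith, by linarith⟩

lemma measurable_cen : Measurable fun p : Plane × Config => cen p.1 p.2 := by
  have heq : ∀ p : Plane × Config, cen p.1 p.2 =
      ∫ c, {c | IsCenter p.1 p.2 c}.indicator id c ∂p.2.points := by
    rintro ⟨x, S⟩
    by_cases h : ∃ c, IsCenter x S c
    · obtain ⟨c, hc⟩ := h
      have hset : {c | IsCenter x S c} = (({c} : Finset Plane) : Set Plane) := by
        ext d
        simp only [Set.mem_ofPred_eq, Finset.coe_singleton, Set.mem_singleton_iff]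
        exact ⟨fun hd => hd.unique hc, fun hd => hd ▸ hc⟩
      simp only
      rw [hc.cen_eq, hset, integral_points_finset]
      · simp
      · simpa using hc.1
    -- Without a center the integral is zero, which agrees with the default value of `cen`.
    · have hset : {c | IsCenter x S c} = ∅ := by
        ext d
        simpa using fun hd => h ⟨d, hd⟩
      simp only
      rw [cen, dif_neg h, hset]
      simp
  simp only [heq]
  refine measurable_snd.integral_points
    (F := fun (p : Plane × Config) c => {c | IsCenter p.1 p.2 c}.indicator id c) ?_
  have hm : MeasurableSet {q : (Plane × Config) × Plane | IsCenter q.1.1 q.1.2 q.2} := by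
    refine (measurable_fst.snd.mem_config measurable_snd).inter
      ((measurableSet_vor measurable_fst.snd measurable_fst.fst measurable_snd).inter ?_)
    refine Measurable.forall_mem (T := fun q : (Plane × Config) × Plane => q.1.2)
      measurable_fst.snd (p := fun q t => q.1.1 ∈ vor t q.1.2 →
        toLex (q.2 0, q.2 1) ≤ toLex (t 0, t 1)) ?_
    simp only [Prod.Lex.toLex_le_toLex, imp_iff_not_or]
    have c0 := (measurable_fst (α := (Plane × Config) × Plane) (β := Plane)).snd.plane_apply 0
    have c1 := (measurable_fst (α := (Plane × Config) × Plane) (β := Plane)).snd.plane_apply 1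
    have t0 := (measurable_snd (α := (Plane × Config) × Plane) (β := Plane)).plane_apply 0
    have t1 := (measurable_snd (α := (Plane × Config) × Plane) (β := Plane)).plane_apply 1
    exact (measurableSet_vor measurable_fst.fst.snd measurable_fst.fst.fst
      measurable_snd).compl.union ((measurableSet_lt c0 t0).union
        ((measurableSet_eq_fun c0 t0).inter (measurableSet_le c1 t1)))
  exact measurable_snd.indicator hm

/-! ### Measurable potentials -/

variable {f : Config × Plane → ℝ}

/-- `v` is a potential on `S` of the field represented by `f`. -/
def IsPotential (f : Config × Plane → ℝ) (S : Config) (v : Plane → ℝ) : Prop :=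
  ∀ w t, IsNeighbor w t S → v t - v w = f (shift w S, t - w)

lemma IsPotential.shift {S : Config} {v : Plane → ℝ} (h : IsPotential f S v) (z : Plane) :
    IsPotential f (shift z S) fun x => v (x + z) := by
  intro w t hn
  have hn' : IsNeighbor (w + z) (t + z) S := by
    rw [← isNeighbor_shift (z := z)]; simpa using hn
  rw [h _ _ hn', shift_shift, add_sub_add_right_eq_sub]

/-- The sum of the products of the weights `φ` over the paths of `n` edges from the origin. -/
noncomputable def pathSum (φ : Config × Plane → ℝ≥0∞) : ℕ → Config × Plane → ℝ≥0∞
  | 0 => fun p => ({0} : Set Plane).indicator 1 p.2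
  | n + 1 => fun p => ∫⁻ w, edgeSet.indicator φ (shift w p.1, p.2 - w) * pathSum φ n (p.1, w)
      ∂p.1.points

lemma measurable_pathSum {φ : Config × Plane → ℝ≥0∞} (hφ : Measurable φ) (n : ℕ) :
    Measurable (pathSum φ n) := by
  induction n with
  | zero => exact (measurable_one.indicator (measurableSet_singleton 0)).comp measurable_snd
  | succ n ih =>
    refine measurable_fst.lintegral_points (F := fun (p : Config × Plane) w =>
      edgeSet.indicator φ (shift w p.1, p.2 - w) * pathSum φ n (p.1, w)) ?_
    exact ((hφ.indicator measurableSet_edgeSet).comp ((measurable_fst.fst.shift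
      measurable_snd).prodMk (measurable_fst.snd.sub measurable_snd))).mul
      (ih.comp (measurable_fst.fst.prodMk measurable_snd))

lemma Good.edge_shift {S : Config} (hS : Good S) {w t : Plane} :
    (Config.shift w S, t - w) ∈ edgeSet ↔ IsNeighbor w t S := by
  rw [(hS.shift w).mem_edgeSet, ← isNeighbor_shift (s := w) (z := w), sub_self]

/-- Exponentials turn increments into multiplicative weights; along every path from `0` to `t` their
product telescopes to `exp (v t - v 0)`. Dividing by the number of paths isolates the potential
while using only measurable sums. -/
lemma IsPotential.pathSum_exp {S : Config} (hS : Good S) {v : Plane → ℝ} (h : IsPotential f S v)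
    (n : ℕ) (t : Plane) :
    pathSum (fun p => ENNReal.ofReal (Real.exp (f p))) n (S, t) =
      pathSum 1 n (S, t) * ENNReal.ofReal (Real.exp (v t - v 0)) := by
  induction n generalizing t with
  | zero =>
    by_cases ht : t = 0
    · subst ht; simp [pathSum]
    · simp [pathSum, ht]
  | succ n ih =>
    simp only [pathSum]
    rw [← lintegral_mul_const' _ _ ENNReal.ofReal_ne_top]
    refine lintegral_congr fun w => ?_
    by_cases hw : IsNeighbor w t S
    · rw [Set.indicator_of_mem (hS.edge_shift.2 hw), Set.indicator_of_mem (hS.edge_shift.2 hw),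
        ih, ← h w t hw, Pi.one_apply, one_mul,
        show v t - v 0 = (v t - v w) + (v w - v 0) by ring, Real.exp_add,
        ENNReal.ofReal_mul (Real.exp_pos _).le]
      ring
    · rw [Set.indicator_of_notMem (fun h => hw (hS.edge_shift.1 h)),
        Set.indicator_of_notMem (fun h => hw (hS.edge_shift.1 h))]
      simp

lemma Regular.pathSum_ne_top {S : Config} (hS : Regular S) (n : ℕ) {t : Plane} (ht : t ∈ S) :
    pathSum 1 n (S, t) ≠ ∞ := by
  induction n generalizing t with
  | zero =>
    by_cases h : t = 0
    · subst h; simp [pathSum]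
    · simp [pathSum, h]
  | succ n ih =>
    simp only [pathSum]
    have hfin : {w | IsNeighbor w t S}.Finite :=
      (hS.finite t ht).subset fun w hw => IsNeighbor.symm hw
    have heq : ∀ w, edgeSet.indicator 1 (Config.shift w S, t - w) * pathSum 1 n (S, w) =
        (hfin.toFinset : Set Plane).indicator (fun w => pathSum 1 n (S, w)) w := by
      intro w
      by_cases hw : IsNeighbor w t S
      · rw [Set.indicator_of_mem (hS.good.edge_shift.2 hw), Set.indicator_of_mem (by simpa using hw)]
        simp
      · rw [Set.indicator_of_notMem (fun h => hw (hS.good.edge_shift.1 h)),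
          Set.indicator_of_notMem (by simpa using hw)]
        simp
    rw [lintegral_congr heq, lintegral_indicator hfin.toFinset.measurableSet, lintegral_finset]
    refine ENNReal.sum_ne_top.2 fun w hw => ?_
    have hw' : IsNeighbor w t S := by simpa using hw
    rw [points_singleton hw'.1, mul_one]
    exact ih hw'.1

lemma Good.exists_pathSum_ne_zero {S : Config} (hS : Good S) (h0 : 0 ∈ S) {t : Plane}
    (ht : t ∈ S) : ∃ n, pathSum 1 n (S, t) ≠ 0 := by
  have hc := hS.gp.connected h0 ht
  induction hc with
  | refl => exact ⟨0, by simp [pathSum]⟩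
  | @tail b c _ hbc ih =>
    obtain ⟨n, hn⟩ := ih hbc.1
    refine ⟨n + 1, fun hz => hn ?_⟩
    simp only [pathSum] at hz
    rw [lintegral_points, ENNReal.tsum_eq_zero] at hz
    have := hz ⟨b, hbc.1⟩
    rw [Set.indicator_of_mem (by exact hS.edge_shift.2 hbc), Pi.one_apply, one_mul] at this
    exact this

/-- A measurable version of the increments from the origin of the potentials of `f`. -/
noncomputable def potential (f : Config × Plane → ℝ) (p : Config × Plane) : ℝ :=
  Real.log (⨆ n, pathSum (fun p => ENNReal.ofReal (Real.exp (f p))) n p / pathSum 1 n p).toReal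

lemma measurable_potential (hf : Measurable f) : Measurable (potential f) := by
  have h1 : Measurable fun p => ENNReal.ofReal (Real.exp (f p)) := hf.exp.ennreal_ofReal
  exact (Measurable.iSup fun n => (measurable_pathSum h1 n).div
    (measurable_pathSum measurable_one n)).ennreal_toReal.log

/-- Every ratio is at most `exp (v t - v 0)`, and it is equal to it for a length `n` with at least
one path; connectivity gives such a length and finite degrees make the count finite. -/
lemma IsPotential.potential_eq_zero {S : Config} (hS : Regular S) (h0 : 0 ∈ S) {v : Plane → ℝ}
    (h : IsPotential f S v) {t : Plane} (ht : t ∈ S) : potential f (S, t) = v t - v 0 := by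
  have hsup : (⨆ n, pathSum (fun p => ENNReal.ofReal (Real.exp (f p))) n (S, t) /
      pathSum 1 n (S, t)) = ENNReal.ofReal (Real.exp (v t - v 0)) := by
    refine le_antisymm (iSup_le fun n => ?_) ?_
    · rw [h.pathSum_exp hS.good]
      refine ENNReal.div_le_of_le_mul ?_
      rw [mul_comm]
    · obtain ⟨n, hn⟩ := hS.good.exists_pathSum_ne_zero h0 ht
      refine le_iSup_of_le n ?_
      rw [h.pathSum_exp hS.good, mul_comm,
        ENNReal.mul_div_cancel_right hn (hS.pathSum_ne_top n ht)]
  rw [potential, hsup, ENNReal.toReal_ofReal (Real.exp_pos _).le, Real.log_exp]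

lemma IsPotential.potential_eq {S : Config} (hS : Regular S) {v : Plane → ℝ}
    (h : IsPotential f S v) {s t : Plane} (hs : s ∈ S) (ht : t ∈ S) :
    potential f (Config.shift s S, t - s) = v t - v s := by
  have h0 : (0 : Plane) ∈ Config.shift s S := by rw [mem_shift, zero_add]; exact hs
  rw [(h.shift s).potential_eq_zero (hS.shift s) h0 (mem_shift_sub.2 ht)]
  simp

/-- The increment of the potential of `f` between the cells containing two sites. -/
noncomputable def increment (f : Config × Plane → ℝ) (x y : Plane) (S : Config) : ℝ :=
  potential f (shift (cen x S) S, cen y S - cen x S)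

lemma measurable_increment (hf : Measurable f) {α : Type*} [MeasurableSpace α] {x y : α → Plane}
    {T : α → Config} (hx : Measurable x) (hy : Measurable y) (hT : Measurable T) :
    Measurable fun a => increment f (x a) (y a) (T a) := by
  have h1 : Measurable fun a => cen (x a) (T a) := measurable_cen.comp (hx.prodMk hT)
  have h2 : Measurable fun a => cen (y a) (T a) := measurable_cen.comp (hy.prodMk hT)
  exact (measurable_potential hf).comp ((hT.shift h1).prodMk (h2.sub h1))

lemma IsPotential.increment_eq {S : Config} (hS : Regular S) (hne : ∃ s, s ∈ S) {v : Plane → ℝ}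
    (h : IsPotential f S v) (x y : Plane) : increment f x y S = v (cen y S) - v (cen x S) :=
  h.potential_eq hS (cen_mem hne x) (cen_mem hne y)

lemma increment_shift {S : Config} (hne : ∃ s, s ∈ S) (x y z : Plane) :
    increment f (x - z) (y - z) (shift z S) = increment f x y S := by
  simp only [increment, cen_shift hne, shift_shift, sub_add_cancel, sub_sub_sub_cancel_right]

/-- The coordinate directions. -/
noncomputable abbrev dir (i : Fin 2) : Plane := EuclideanSpace.single i (1 : ℝ)

/-- On `S` the field represented by `f` has a potential, with zero tilt. -/
structure ZeroTilt (f : Config × Plane → ℝ) (S : Config) : Prop where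
  regular : Regular S
  nonempty : ∃ s, s ∈ S
  potential : ∃ v, IsPotential f S v
  tilt : ∀ᵐ x : Plane, ∀ i : Fin 2,
    Tendsto (fun K : ℝ => increment f x (x + K • dir i) S / K) atTop (𝓝 0) ∧
    Tendsto (fun K : ℝ => increment f x (x + K • dir i) S / K) atBot (𝓝 0)

lemma ZeroTilt.shift {S : Config} (h : ZeroTilt f S) (z : Plane) : ZeroTilt f (shift z S) := by
  obtain ⟨v, hv⟩ := h.potential
  obtain ⟨s, hs⟩ := h.nonempty
  refine ⟨h.regular.shift z, ⟨s - z, mem_shift_sub.2 hs⟩, ⟨_, hv.shift z⟩, ?_⟩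
  have := (measurePreserving_add_right (volume : Measure Plane) z).quasiMeasurePreserving.ae h.tilt
  filter_upwards [this] with x hx i
  have he : ∀ K : ℝ, increment f x (x + K • dir i) (Config.shift z S) =
      increment f (x + z) (x + z + K • dir i) S := by
    intro K
    rw [← increment_shift ⟨s, hs⟩ (x + z) (x + z + K • dir i) z]
    congr 1 <;> abel
  simpa only [he] using hx i

lemma ZeroTilt.increment_add {S : Config} (h : ZeroTilt f S) (x y z : Plane) :
    increment f x y S + increment f y z S = increment f x z S := by
  obtain ⟨v, hv⟩ := h.potential
  simp only [hv.increment_eq h.regular h.nonempty]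
  ring

lemma ZeroTilt.increment_self {S : Config} (h : ZeroTilt f S) (x : Plane) :
    increment f x x S = 0 := by
  have := h.increment_add x x x
  linarith

lemma ZeroTilt.increment_edge {S : Config} (h : ZeroTilt f S) (t : Plane)
    (ht : IsNeighbor 0 t S) : increment f 0 t S = f (S, t) := by
  obtain ⟨v, hv⟩ := h.potential
  rw [hv.increment_eq h.regular h.nonempty, cen_self ht.1, cen_self ht.2.1, hv 0 t ht, shift_zero,
    sub_zero]

/-- The surface itself is a potential: covariance transfers its values on edges at the origin to all
edges. Thus `increment` reproduces its increments and inherits the tilt. -/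
lemma StandingAssumptions.ae_zeroTilt_palm (hP : StandingAssumptions P) {u : Surface}
    (hf : IsRep P (grad u) f) (hc : ∀ᵐ S ∂palm P, IsCovariantOn (grad u) S)
    (ht : ∀ᵐ S ∂palm P, HasTilt u S 0) : ∀ᵐ S ∂palm P, ZeroTilt f S := by
  filter_upwards [hP.ae_palm_regular, ae_zero_mem_palm, hc, ht,
    hP.isStationary.ae_palm_forall_shift hf.eq] with S hS h0 hcS htS he
  have hpot : IsPotential f S fun s => u s S := by
    intro w t hn
    have hn' := isNeighbor_shift (z := w).2 hn
    rw [sub_self] at hn'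
    have h1 := hcS w hn.1 w hn.1 t hn.2.1
    rw [sub_self] at h1
    rw [← he w hn.1 _ hn', h1, grad, cond_of_isNeighbor hn, one_mul]
  refine ⟨hS, ⟨0, h0⟩, ⟨_, hpot⟩, ?_⟩
  filter_upwards [htS] with x hx i
  simp only [hpot.increment_eq hS ⟨0, h0⟩]
  exact hx i

lemma StandingAssumptions.ae_zeroTilt (hP : StandingAssumptions P)
    (h : ∀ᵐ S ∂palm P, ZeroTilt f S) : ∀ᵐ S ∂P, ZeroTilt f S := by
  filter_upwards [hP.ae_nonempty, hP.isStationary.ae_forall_shift h] with S h1 h2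
  obtain ⟨s, hs⟩ := h1
  have := (h2 s hs).shift (-s)
  rwa [shift_shift, neg_add_cancel, shift_zero] at this

/-! ### Sublinearity on average -/

lemma _root_.Measurable.const_smul_plane {α : Type*} [MeasurableSpace α] {x : α → Plane}
    (hx : Measurable x) (c : ℝ) : Measurable fun a => c • x a := hx.const_smul c

/-- The indicator of the event that `|r|` exceeds `c`. -/
noncomputable def exceeds (c r : ℝ) : ℝ≥0∞ := (Set.Ioi c).indicator 1 |r|

lemma exceeds_le_one (c r : ℝ) : exceeds c r ≤ 1 := Set.indicator_le_self' (by simp) _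

lemma exceeds_eq_one {c r : ℝ} (h : c < |r|) : exceeds c r = 1 :=
  Set.indicator_of_mem (by exact h) _

lemma exceeds_eq_zero {c r : ℝ} (h : |r| ≤ c) : exceeds c r = 0 :=
  Set.indicator_of_notMem (by exact not_lt.2 h) _

lemma measurable_exceeds (c : ℝ) : Measurable (exceeds c) :=
  (measurable_one.indicator measurableSet_Ioi).comp continuous_abs.measurable

lemma exceeds_add_three (c r s t : ℝ) :
    exceeds c (r + s + t) ≤ exceeds (c / 3) r + exceeds (c / 3) s + exceeds (c / 3) t := by
  by_cases h : c < |r + s + t|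
  · rw [exceeds_eq_one h]
    have h1 := abs_add_three r s t
    by_cases hr : c / 3 < |r|
    · rw [exceeds_eq_one hr, add_assoc]; exact le_self_add
    by_cases hs : c / 3 < |s|
    · rw [exceeds_eq_one hs, add_right_comm]; exact le_add_self
    by_cases ht : c / 3 < |t|
    · rw [exceeds_eq_one ht]; exact le_add_self
    linarith
  · rw [exceeds_eq_zero (not_lt.1 h)]; exact zero_le

lemma tendsto_exceeds {r : ℕ → ℝ} (h : Tendsto (fun n : ℕ => r n / n) atTop (𝓝 0)) {δ : ℝ}
    (hδ : 0 < δ) : Tendsto (fun n : ℕ => exceeds (δ * n) (r n)) atTop (𝓝 0) := by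
  refine tendsto_const_nhds.congr' ?_
  have h2 := (tendsto_order.1 (by simpa using h.abs)).2 δ hδ
  filter_upwards [h2, eventually_gt_atTop 0] with n hn hn0
  have hnp : (0 : ℝ) < n := by exact_mod_cast hn0
  rw [exceeds_eq_zero]
  rw [abs_div, abs_of_pos hnp, div_lt_iff₀ hnp] at hn
  exact hn.le

lemma tendsto_exceeds_const (r : ℝ) {δ : ℝ} (hδ : 0 < δ) :
    Tendsto (fun n : ℕ => exceeds (δ * n) r) atTop (𝓝 0) :=
  tendsto_exceeds (r := fun _ => r) (tendsto_const_div_atTop_nhds_zero_nat r) hδ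

lemma ZeroTilt.ae_tendsto_nat {S : Config} (h : ZeroTilt f S) (i : Fin 2) (a : ℝ) :
    ∀ᵐ x : Plane, Tendsto (fun n : ℕ => increment f x (x + (n * a) • dir i) S / n) atTop (𝓝 0) := by
  filter_upwards [h.tilt] with x hx
  have key : ∀ K : ℕ → ℝ, (∀ n, K n = n * a) → a ≠ 0 →
      Tendsto (fun n => increment f x (x + K n • dir i) S / K n) atTop (𝓝 0) →
      Tendsto (fun n : ℕ => increment f x (x + (n * a) • dir i) S / n) atTop (𝓝 0) := by
    intro K hK ha hlim
    have := hlim.const_mul a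
    rw [mul_zero] at this
    refine this.congr fun n => ?_
    rw [hK]
    by_cases hn : (n : ℝ) = 0
    · simp [hn]
    · field_simp
  rcases lt_trichotomy a 0 with ha | rfl | ha
  · exact key (fun n => n * a) (fun _ => rfl) ha.ne ((hx i).2.comp
      (tendsto_natCast_atTop_atTop.atTop_mul_const_of_neg ha))
  · simp [h.increment_self]
  · exact key (fun n => n * a) (fun _ => rfl) ha.ne' ((hx i).1.comp
      (tendsto_natCast_atTop_atTop.atTop_mul_const ha))

lemma increment_eq_shift {S : Config} (hne : ∃ s, s ∈ S) (x z : Plane) :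
    increment f x (x + z) S = increment f 0 z (shift x S) := by
  rw [← increment_shift hne x (x + z) x, sub_self, add_sub_cancel_left]

lemma measurableSet_tendsto_zero {α : Type*} [MeasurableSpace α] {r : ℕ → α → ℝ}
    (hr : ∀ n, Measurable (r n)) : MeasurableSet {a | Tendsto (fun n => r n a) atTop (𝓝 0)} := by
  exact measurableSet_tendsto (𝓝 0) hr

/-- The tilt vanishes almost surely along the axes through the origin. -/
lemma StandingAssumptions.ae_tendsto_axis (hP : StandingAssumptions P) (hf : Measurable f)
    (h : ∀ᵐ S ∂P, ZeroTilt f S) (i : Fin 2) (a : ℝ) :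
    ∀ᵐ S ∂P, Tendsto (fun n : ℕ => increment f 0 ((n * a) • dir i) S / n) atTop (𝓝 0) := by
  have := hP.prob
  have h1 : ∀ᵐ S ∂P, ∀ᵐ x : Plane,
      Tendsto (fun n : ℕ => increment f x (x + (n * a) • dir i) S / n) atTop (𝓝 0) := by
    filter_upwards [h] with S hS using hS.ae_tendsto_nat i a
  have hm : MeasurableSet {q : Config × Plane | Tendsto (fun n : ℕ =>
      increment f q.2 (q.2 + (n * a) • dir i) q.1 / n) atTop (𝓝 0)} :=
    measurableSet_tendsto_zero fun n => (measurable_increment hf measurable_snd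
      (measurable_snd.add_const _) measurable_fst).div_const _
  rw [Measure.ae_ae_comm hm] at h1
  obtain ⟨x, hx⟩ := h1.exists
  -- Fubini provides one deterministic site `x` at which the tilt vanishes almost surely;
  -- stationarity carries it to the origin.
  have h2 := (hP.stationary (-x)).quasiMeasurePreserving.ae (hx.and h)
  filter_upwards [h2] with S hS
  have e := fun z => increment_eq_shift (f := f) hS.2.nonempty x z
  simpa only [e, shift_shift, add_neg_cancel, shift_zero] using hS.1

/-- The proportion of the sites `n y`, `|y| < 1`, where the increment from the origin exceeds
`δ n`. -/
noncomputable def badFraction (f : Config × Plane → ℝ) (δ : ℝ) (n : ℕ) (S : Config) : ℝ≥0∞ :=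
  ∫⁻ y in Metric.ball (0 : Plane) 1, exceeds (δ * n) (increment f 0 ((n : ℝ) • y) S)

lemma measurable_badFraction (hf : Measurable f) (δ : ℝ) (n : ℕ) :
    Measurable (badFraction f δ n) := by
  have : Measurable fun q : Config × Plane =>
      exceeds (δ * n) (increment f 0 ((n : ℝ) • q.2) q.1) :=
    (measurable_exceeds _).comp (measurable_increment hf measurable_const
      (measurable_snd.const_smul_plane _) measurable_fst)
  exact this.lintegral_prod_right'

lemma norm_lt_of_mem_unitSquare {x : Plane} (hx : x ∈ unitSquare) : ‖x‖ < 2 := by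
  have h := dist_sq x 0
  rw [dist_zero_right] at h
  have h0 := hx 0
  have h1 := hx 1
  simp only [PiLp.zero_apply, sub_zero] at h
  nlinarith [norm_nonneg x]

/-- The increment from `s` to `n y` splits into three legs: from `s` to `0`, along the first axis,
and parallel to the second axis. If the sum exceeds `δ n`, one leg exceeds `δ n / 3`. -/
lemma StandingAssumptions.tendsto_site (hP : StandingAssumptions P) (hf : Measurable f)
    (h : ∀ᵐ S ∂P, ZeroTilt f S) {F : Config → ℝ≥0∞} (hF : Measurable F)
    (hfin : ∫⁻ S, F S ∂palm P ≠ ∞) {δ : ℝ} (hδ : 0 < δ) (y : Plane) :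
    Tendsto (fun n : ℕ => ∫⁻ S, ∫⁻ s, unitSquare.indicator 1 s * F (shift s S) *
      exceeds (δ * n) (increment f s ((n : ℝ) • y) S) ∂S.points ∂P) atTop (𝓝 0) := by
  have := hP.prob
  have hδ3 : 0 < δ / 3 := by positivity
  set g : Config × Plane → ℝ≥0∞ := fun q => unitSquare.indicator 1 q.2 * F (shift q.2 q.1) with hg
  have hgm : Measurable g := (measurable_indicator_unitSquare measurable_snd).mul
    (hF.comp (measurable_fst.shift measurable_snd))
  set Y : Config → ℝ≥0∞ := fun S => ∫⁻ s, g (S, s) ∂S.points with hY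
  have hYm : Measurable Y := measurable_palm_sum hF
  have hYfin : ∫⁻ S, Y S ∂P ≠ ∞ := by rwa [← lintegral_palm P hF]
  have hcomp : ∀ {φ : Config × Plane → ℝ≥0∞}, Measurable φ →
      ∫⁻ q, φ q ∂(P ⊗ₘ pointsKernel) = ∫⁻ S, ∫⁻ s, φ (S, s) ∂S.points ∂P :=
    fun hφ => Measure.lintegral_compProd hφ
  -- the three legs of the path from `s` to `n y`
  set A : ℕ → Config → ℝ := fun n S => increment f 0 ((n * y 0) • dir 0) S with hA
  set B : ℕ → Config → ℝ := fun n S =>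
    increment f ((n * y 0) • dir 0) ((n * y 0) • dir 0 + (n * y 1) • dir 1) S with hB
  have hAm : ∀ n, Measurable (A n) := fun n =>
    measurable_increment hf measurable_const measurable_const measurable_id
  have hBm : ∀ n, Measurable (B n) := fun n =>
    measurable_increment hf measurable_const measurable_const measurable_id
  have hCm : Measurable fun q : Config × Plane => increment f q.2 0 q.1 :=
    measurable_increment hf measurable_snd measurable_const measurable_fst
  have hny : ∀ n : ℕ, (n : ℝ) • y = (n * y 0) • dir 0 + (n * y 1) • dir 1 := by
    intro n
    apply plane_ext <;> simp
  have l1 : Tendsto (fun n : ℕ => ∫⁻ q, g q * exceeds (δ / 3 * n) (increment f q.2 0 q.1)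
      ∂(P ⊗ₘ pointsKernel)) atTop (𝓝 0) := by
    rw [← lintegral_zero (μ := P ⊗ₘ pointsKernel)]
    refine tendsto_lintegral_of_dominated_convergence g (fun n => hgm.mul
      ((measurable_exceeds _).comp hCm)) (fun n => Eventually.of_forall fun q =>
        mul_le_of_le_one_right' (exceeds_le_one _ _)) (by rwa [hcomp hgm]) ?_
    have hgfin : ∀ᵐ q ∂(P ⊗ₘ pointsKernel), g q < ∞ :=
      ae_lt_top hgm (by rwa [hcomp hgm])
    filter_upwards [hgfin] with q hq
    have := ENNReal.Tendsto.const_mul (tendsto_exceeds_const (increment f q.2 0 q.1) hδ3)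
      (Or.inr hq.ne) (a := g q)
    rwa [mul_zero] at this
  -- Absolute continuity of the integral of `Y`: convergence in probability suffices under an
  -- integrable weight.
  have lY : ∀ D : ℕ → Config → ℝ, (∀ n, Measurable (D n)) →
      Tendsto (fun n : ℕ => ∫⁻ S, exceeds (δ / 3 * n) (D n S) ∂P) atTop (𝓝 0) →
      Tendsto (fun n : ℕ => ∫⁻ S, Y S * exceeds (δ / 3 * n) (D n S) ∂P) atTop (𝓝 0) := by
    intro D hD hlim
    have hset : ∀ n : ℕ, MeasurableSet {S | δ / 3 * n < |D n S|} := fun n =>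
      measurableSet_lt measurable_const (continuous_abs.measurable.comp (hD n))
    have e1 : ∀ n : ℕ, ∀ S, exceeds (δ / 3 * n) (D n S) =
        {S | δ / 3 * n < |D n S|}.indicator 1 S := fun n S => rfl
    have e2 : ∀ n : ℕ, ∫⁻ S, Y S * exceeds (δ / 3 * n) (D n S) ∂P =
        ∫⁻ S in {S | δ / 3 * n < |D n S|}, Y S ∂P := by
      intro n
      rw [← lintegral_indicator (hset n)]
      refine lintegral_congr fun S => ?_
      rw [e1]
      by_cases hS : S ∈ {S | δ / 3 * n < |D n S|}
      · rw [Set.indicator_of_mem hS, Set.indicator_of_mem hS, Pi.one_apply, mul_one]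
      · rw [Set.indicator_of_notMem hS, Set.indicator_of_notMem hS, mul_zero]
    simp only [e2]
    refine tendsto_setLIntegral_zero hYfin ?_
    simp only [e1, lintegral_indicator_one (hset _)] at hlim
    exact hlim
  have lD : ∀ D : ℕ → Config → ℝ, (∀ n, Measurable (D n)) →
      (∀ᵐ S ∂P, Tendsto (fun n : ℕ => D n S / n) atTop (𝓝 0)) →
      Tendsto (fun n : ℕ => ∫⁻ S, exceeds (δ / 3 * n) (D n S) ∂P) atTop (𝓝 0) := by
    intro D hD hlim
    rw [← lintegral_zero (μ := P)]
    refine tendsto_lintegral_of_dominated_convergence (fun _ => 1) (fun n =>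
      (measurable_exceeds _).comp (hD n)) (fun n => Eventually.of_forall fun q =>
        exceeds_le_one _ _) (by simp) ?_
    filter_upwards [hlim] with S hS using tendsto_exceeds hS hδ3
  have l2 := lY A hAm (lD A hAm (hP.ae_tendsto_axis hf h 0 (y 0)))
  -- This leg starts at a site moving with `n`. For each `n` it has the law of a leg from the
  -- origin, which yields convergence in probability.
  have l3 : Tendsto (fun n : ℕ => ∫⁻ S, Y S * exceeds (δ / 3 * n) (B n S) ∂P) atTop (𝓝 0) := by
    refine lY B hBm ?_
    have hm' : ∀ n : ℕ, Measurable fun S => increment f 0 ((n * y 1) • dir 1) S := fun n =>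
      measurable_increment hf measurable_const measurable_const measurable_id
    refine (lD _ hm' (hP.ae_tendsto_axis hf h 1 (y 1))).congr fun n => ?_
    rw [← hP.isStationary.lintegral_shift ((n * y 0) • dir 0)
      (F := fun S => exceeds (δ / 3 * n) (increment f 0 ((n * y 1) • dir 1) S))
      ((measurable_exceeds _).comp (hm' n))]
    refine lintegral_congr_ae ?_
    filter_upwards [hP.ae_nonempty] with S hS
    simp only [hB]
    rw [increment_eq_shift hS]
  have hsum := (l1.add l2).add l3
  simp only [add_zero] at hsum
  refine tendsto_of_tendsto_of_tendsto_of_le_of_le tendsto_const_nhds hsum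
    (fun n => zero_le) fun n => ?_
  have m1 : Measurable fun q : Config × Plane =>
      g q * exceeds (δ / 3 * n) (increment f q.2 0 q.1) :=
    hgm.mul ((measurable_exceeds _).comp hCm)
  have m2 : Measurable fun S => Y S * exceeds (δ / 3 * n) (A n S) :=
    hYm.mul ((measurable_exceeds _).comp (hAm n))
  have m3 : Measurable fun S => Y S * exceeds (δ / 3 * n) (B n S) :=
    hYm.mul ((measurable_exceeds _).comp (hBm n))
  simp only
  rw [hcomp m1, ← lintegral_add_right _ m2, ← lintegral_add_right _ m3]
  refine lintegral_mono_ae ?_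
  filter_upwards [h] with S hS
  have hgS : Measurable fun s => g (S, s) := hgm.comp measurable_prodMk_left
  have e1 : ∀ c : ℝ≥0∞, Y S * c = ∫⁻ s, g (S, s) * c ∂S.points := fun c =>
    (lintegral_mul_const _ hgS).symm
  rw [e1, e1, ← lintegral_add_right _ (hgS.mul_const _), ← lintegral_add_right _ (hgS.mul_const _)]
  refine lintegral_mono fun s => ?_
  rw [← mul_add, ← mul_add]
  refine mul_le_mul_right ?_ _
  have hdec : increment f s ((n : ℝ) • y) S = increment f s 0 S + A n S + B n S := by
    rw [hA, hB, hny]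
    simp only
    rw [hS.increment_add, hS.increment_add]
  rw [hdec, show δ / 3 * n = δ * n / 3 by ring]
  exact exceeds_add_three _ _ _ _

/-- The potential is sublinear on average, under any integrable weight. -/
lemma StandingAssumptions.tendsto_badFraction (hP : StandingAssumptions P) (hf : Measurable f)
    (h : ∀ᵐ S ∂P, ZeroTilt f S) {F : Config → ℝ≥0∞} (hF : Measurable F)
    (hfin : ∫⁻ S, F S ∂palm P ≠ ∞) {δ : ℝ} (hδ : 0 < δ) :
    Tendsto (fun n : ℕ => ∫⁻ S, F S * badFraction f δ n S ∂palm P) atTop (𝓝 0) := by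
  have := hP.prob
  set J : ℕ → Plane → ℝ≥0∞ := fun n y => ∫⁻ S, ∫⁻ s, unitSquare.indicator 1 s * F (shift s S) *
      exceeds (δ * n) (increment f s ((n : ℝ) • y) S) ∂S.points ∂P with hJ
  have hqm : ∀ n : ℕ, Measurable fun q : (Config × Plane) × Plane =>
      unitSquare.indicator 1 q.2 * F (shift q.2 q.1.1) *
      exceeds (δ * n) (increment f q.2 ((n : ℝ) • q.1.2) q.1.1) := fun n =>
    ((measurable_indicator_unitSquare measurable_snd).mul
      (hF.comp (measurable_fst.fst.shift measurable_snd))).mul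
      ((measurable_exceeds _).comp (measurable_increment hf measurable_snd
        (measurable_fst.snd.const_smul_plane _) measurable_fst.fst))
  have hJ2 : ∀ n : ℕ, Measurable fun q : Config × Plane => ∫⁻ s,
      unitSquare.indicator 1 s * F (shift s q.1) *
      exceeds (δ * n) (increment f s ((n : ℝ) • q.2) q.1) ∂q.1.points := fun n =>
    measurable_fst.lintegral_points (F := fun (q : Config × Plane) s =>
      unitSquare.indicator 1 s * F (shift s q.1) *
      exceeds (δ * n) (increment f s ((n : ℝ) • q.2) q.1)) (hqm n)
  have hJm : ∀ n, Measurable (J n) := fun n => (hJ2 n).lintegral_prod_left'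
  -- Viewing the unit disc from a point `s` of the unit square displaces it by `s / n`, of norm less
  -- than `2` for `n ≥ 1`; radius `3` contains all these discs.
  have hlim : Tendsto (fun n => ∫⁻ y in Metric.ball (0 : Plane) 3, J n y) atTop (𝓝 0) := by
    rw [← lintegral_zero (μ := volume.restrict (Metric.ball (0 : Plane) 3))]
    refine tendsto_lintegral_of_dominated_convergence (fun _ => ∫⁻ S, F S ∂palm P) hJm
      (fun n => Eventually.of_forall fun y => ?_) ?_
      (Eventually.of_forall fun y => hP.tendsto_site hf h hF hfin hδ y)
    · rw [lintegral_palm P hF]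
      exact lintegral_mono fun S => lintegral_mono fun s =>
        mul_le_of_le_one_right' (exceeds_le_one _ _)
    · rw [setLIntegral_const]
      exact ENNReal.mul_ne_top hfin measure_ball_lt_top.ne
  refine tendsto_of_tendsto_of_tendsto_of_le_of_le' tendsto_const_nhds hlim
    (Eventually.of_forall fun n => zero_le) ?_
  filter_upwards [eventually_ge_atTop 1] with n hn
  have hn1 : (1 : ℝ) ≤ n := by exact_mod_cast hn
  have hn0 : (0 : ℝ) < n := by linarith
  rw [lintegral_palm P (F := fun S => F S * badFraction f δ n S)
    (hF.mul (measurable_badFraction hf δ n)), hJ]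
  simp only
  rw [lintegral_lintegral_swap (μ := volume.restrict (Metric.ball (0 : Plane) 3))
    (f := fun y S => ∫⁻ s, unitSquare.indicator 1 s * F (shift s S) *
      exceeds (δ * n) (increment f s ((n : ℝ) • y) S) ∂S.points)
    (by exact ((hJ2 n).comp measurable_swap).aemeasurable)]
  refine lintegral_mono_ae ?_
  filter_upwards [hP.ae_nonempty] with S hS
  have hq2 : Measurable fun q : Plane × Plane => unitSquare.indicator 1 q.2 * F (shift q.2 S) *
      exceeds (δ * n) (increment f q.2 ((n : ℝ) • q.1) S) :=
    (hqm n).comp ((measurable_const.prodMk measurable_fst).prodMk measurable_snd)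
  rw [lintegral_lintegral_swap (μ := volume.restrict (Metric.ball (0 : Plane) 3))
    (f := fun y s => unitSquare.indicator 1 s * F (shift s S) *
      exceeds (δ * n) (increment f s ((n : ℝ) • y) S)) (by exact hq2.aemeasurable)]
  refine lintegral_mono fun s => ?_
  by_cases hs : s ∈ unitSquare
  swap
  · simp [hs]
  have hmy : Measurable fun y => exceeds (δ * n) (increment f s ((n : ℝ) • y) S) :=
    (measurable_exceeds _).comp (measurable_increment hf measurable_const
        (measurable_id.const_smul_plane _) measurable_const)
  rw [lintegral_const_mul _ hmy]
  rw [← mul_assoc]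
  refine mul_le_mul_right ?_ _
  have e : ∀ y : Plane, increment f 0 ((n : ℝ) • y) (shift s S) =
      increment f s ((n : ℝ) • (y + (n : ℝ)⁻¹ • s)) S := by
    intro y
    rw [← increment_eq_shift hS, smul_add, smul_smul, mul_inv_cancel₀ hn0.ne', one_smul, add_comm]
  rw [badFraction, ← lintegral_indicator measurableSet_ball,
    ← lintegral_indicator measurableSet_ball,
    ← lintegral_add_right_eq_self (μ := volume) ((Metric.ball (0 : Plane) 3).indicator
      fun y => exceeds (δ * n) (increment f s ((n : ℝ) • y) S)) ((n : ℝ)⁻¹ • s)]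
  refine lintegral_mono fun y => ?_
  by_cases hy : y ∈ Metric.ball (0 : Plane) 1
  · rw [Set.indicator_of_mem hy, Set.indicator_of_mem, e]
    have h2 := norm_lt_of_mem_unitSquare hs
    have h3 : ‖(n : ℝ)⁻¹ • s‖ ≤ ‖s‖ := by
      rw [norm_smul, norm_inv, Real.norm_of_nonneg hn0.le]
      exact mul_le_of_le_one_left (norm_nonneg _) (inv_le_one_of_one_le₀ hn1)
    rw [mem_ball_zero_iff] at hy ⊢
    linarith [norm_add_le y ((n : ℝ)⁻¹ • s)]
  · rw [Set.indicator_of_notMem hy]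
    exact zero_le

/-! ### Approximation by gradients of stationary surfaces -/

/-- Truncation at the levels `±c`. -/
noncomputable def clamp (c r : ℝ) : ℝ := max (-c) (min r c)

lemma continuous_clamp (c : ℝ) : Continuous (clamp c) :=
  continuous_const.max (continuous_id.min continuous_const)

lemma abs_clamp_le {c : ℝ} (hc : 0 ≤ c) (r : ℝ) : |clamp c r| ≤ c :=
  abs_le.2 ⟨le_max_left _ _, max_le (by linarith) (min_le_right _ _)⟩

lemma clamp_eq_self {c r : ℝ} (h : |r| ≤ c) : clamp c r = r := by
  rw [abs_le] at h
  rw [clamp, min_eq_left h.2, max_eq_right h.1]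

lemma clamp_mono (c : ℝ) : Monotone (clamp c) :=
  fun _ _ h => max_le_max le_rfl (min_le_min h le_rfl)

lemma clamp_sub_le {c r s : ℝ} (h : s ≤ r) : clamp c r - clamp c s ≤ r - s := by
  have : clamp c r ≤ clamp c s + (r - s) := by
    have h0 : -c ≤ clamp c s := le_max_left _ _
    refine max_le (by linarith) ?_
    have h1 : min r c ≤ min s c + (r - s) := by
      rcases le_total s c with h2 | h2
      · rw [min_eq_left h2]; linarith [min_le_left r c]
      · rw [min_eq_right h2]; linarith [min_le_right r c]
    have h2 : min s c ≤ clamp c s := le_max_right _ _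
    linarith
  linarith

/-- Truncation is monotone and 1-Lipschitz, so the truncated difference lies between `0` and `g`. -/
lemma abs_sub_clamp_le (c g w : ℝ) : |g - (clamp c (g - w) - clamp c (-w))| ≤ |g| := by
  rcases le_total 0 g with h | h
  · have h1 := clamp_mono c (show -w ≤ g - w by linarith)
    have h2 := clamp_sub_le (c := c) (show -w ≤ g - w by linarith)
    rw [abs_of_nonneg h, abs_le]
    constructor <;> linarith
  · have h1 := clamp_mono c (show g - w ≤ -w by linarith)
    have h2 := clamp_sub_le (c := c) (show g - w ≤ -w by linarith)
    rw [abs_of_nonpos h, abs_le]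
    constructor <;> linarith

/-- Truncation has no effect when `|w|` and `|g|` are at most `c / 2`; otherwise the error is still
at most `|g|`. -/
lemma enorm_sub_clamp_le (c g w : ℝ) : ‖g - (clamp c (g - w) - clamp c (-w))‖ₑ ≤
    ‖g‖ₑ * (exceeds (c / 2) w + exceeds (c / 2) g) := by
  have h1 : ‖g - (clamp c (g - w) - clamp c (-w))‖ₑ ≤ ‖g‖ₑ := by
    rw [Real.enorm_eq_ofReal_abs, Real.enorm_eq_ofReal_abs]
    exact ENNReal.ofReal_le_ofReal (abs_sub_clamp_le c g w)
  by_cases hw : c / 2 < |w|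
  · rw [exceeds_eq_one hw]
    exact h1.trans (le_mul_of_one_le_right' le_self_add)
  by_cases hg : c / 2 < |g|
  · rw [exceeds_eq_one hg]
    exact h1.trans (le_mul_of_one_le_right' le_add_self)
  · have h2 := abs_le.1 (not_lt.1 hw)
    have h3 := abs_le.1 (not_lt.1 hg)
    rw [clamp_eq_self (abs_le.2 ⟨by linarith, by linarith⟩),
      clamp_eq_self (abs_le.2 ⟨by linarith, by linarith⟩)]
    simp

/-- A Lipschitz cutoff on the unit disc. -/
noncomputable def bump (y : Plane) : ℝ := max 0 (1 - ‖y‖)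

lemma continuous_bump : Continuous bump :=
  continuous_const.max (continuous_const.sub continuous_norm)

/-- The indicator of the unit disc. -/
noncomputable def disc (y : Plane) : ℝ≥0∞ := (Metric.ball (0 : Plane) 1).indicator 1 y

lemma measurable_disc : Measurable disc := measurable_one.indicator measurableSet_ball

lemma enorm_bump_le (y : Plane) : ‖bump y‖ₑ ≤ disc y := by
  by_cases hy : y ∈ Metric.ball (0 : Plane) 1
  · rw [disc, Set.indicator_of_mem hy, Pi.one_apply, Real.enorm_eq_ofReal (show 0 ≤ bump y from le_max_left _ _),
      ENNReal.ofReal_le_one]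
    exact max_le zero_le_one (by linarith [norm_nonneg y])
  · have : bump y = 0 := by
      rw [mem_ball_zero_iff, not_lt] at hy
      exact max_eq_left (by linarith)
    simp [this]

lemma enorm_bump_sub_le (y a : Plane) :
    ‖bump (y - a) - bump y‖ₑ ≤ ‖a‖ₑ * (disc y + disc (y - a)) := by
  by_cases hy : y ∈ Metric.ball (0 : Plane) 1 ∨ y - a ∈ Metric.ball (0 : Plane) 1
  · have h1 : 1 ≤ disc y + disc (y - a) := by
      rcases hy with hy | hy
      · rw [disc, Set.indicator_of_mem hy]; exact le_self_add
      · rw [add_comm, disc, Set.indicator_of_mem hy]; exact le_self_add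
    refine le_trans ?_ (le_mul_of_one_le_right' h1)
    rw [← enorm_norm a, Real.enorm_eq_ofReal_abs, Real.enorm_eq_ofReal_abs,
      abs_of_nonneg (norm_nonneg a)]
    refine ENNReal.ofReal_le_ofReal ((abs_max_sub_max_le_max _ _ _ _).trans (max_le ?_ ?_))
    · simp
    · rw [show 1 - ‖y - a‖ - (1 - ‖y‖) = ‖y‖ - ‖y - a‖ by ring]
      simpa using abs_norm_sub_norm_le y (y - a)
  · rw [not_or] at hy
    have h1 : ∀ z : Plane, z ∉ Metric.ball (0 : Plane) 1 → bump z = 0 := by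
      intro z hz
      rw [mem_ball_zero_iff, not_lt] at hz
      exact max_eq_left (by linarith)
    rw [h1 _ hy.1, h1 _ hy.2]
    simp

lemma lintegral_disc_sub (a : Plane) :
    ∫⁻ y, disc (y - a) = volume (Metric.ball (0 : Plane) 1) := by
  rw [lintegral_sub_right_eq_self]
  exact lintegral_indicator_one measurableSet_ball

lemma lintegral_disc : ∫⁻ y, disc y = volume (Metric.ball (0 : Plane) 1) := by
  simpa using lintegral_disc_sub 0

lemma integrable_bump_mul {g : Plane → ℝ} (hg : Measurable g) {c : ℝ} (hc : ∀ y, |g y| ≤ c)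
    (a : Plane) : Integrable fun y => bump (y - a) * g y := by
  refine ⟨((continuous_bump.measurable.comp (measurable_id.sub_const a)).mul
    hg).aestronglyMeasurable, ?_⟩
  have : ∀ y, ‖bump (y - a) * g y‖ₑ ≤ disc (y - a) * ENNReal.ofReal c := by
    intro y
    rw [enorm_mul]
    refine mul_le_mul' (enorm_bump_le _) ?_
    rw [Real.enorm_eq_ofReal_abs]
    exact ENNReal.ofReal_le_ofReal (hc y)
  refine (lintegral_mono this).trans_lt ?_
  have hd : Measurable fun y => disc (y - a) := measurable_disc.comp (measurable_id.sub_const a)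
  rw [lintegral_mul_const _ hd, lintegral_disc_sub]
  exact ENNReal.mul_lt_top measure_ball_lt_top ENNReal.ofReal_lt_top

lemma integral_bump_pos : 0 < ∫ y, bump y := by
  have hi : Integrable bump := by
    have := integrable_bump_mul (g := fun _ => 1) measurable_const (c := 1) (by simp) 0
    simpa using this
  rw [integral_pos_iff_support_of_nonneg (show 0 ≤ bump from fun y => le_max_left _ _) hi]
  refine (Metric.measure_ball_pos volume (0 : Plane) one_pos).trans_le (measure_mono ?_)
  intro y hy
  rw [mem_ball_zero_iff] at hy
  rw [Function.mem_support, bump, max_eq_right (by linarith)]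
  linarith

/-- The mean around the origin of the truncated increments of the potential: a stationary
surface. -/
noncomputable def smoothed (f : Config × Plane → ℝ) (c : ℝ) (n : ℕ) (S : Config) : ℝ :=
  ∫ y, bump y * clamp c (-increment f 0 ((n : ℝ) • y) S)

lemma measurable_smoothed (hf : Measurable f) (c : ℝ) (n : ℕ) : Measurable (smoothed f c n) := by
  have : Measurable fun q : Config × Plane =>
      bump q.2 * clamp c (-increment f 0 ((n : ℝ) • q.2) q.1) :=
    (continuous_bump.measurable.comp measurable_snd).mul
      ((continuous_clamp c).measurable.comp (measurable_increment hf measurable_const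
        (measurable_snd.const_smul_plane _) measurable_fst).neg)
  exact this.stronglyMeasurable.integral_prod_right'.measurable

lemma abs_smoothed_le {c : ℝ} (hc : 0 ≤ c) (f : Config × Plane → ℝ) (n : ℕ) (S : Config) :
    |smoothed f c n S| ≤ c * ∫ y, bump y := by
  have hi : Integrable bump := by
    have := integrable_bump_mul (g := fun _ => 1) measurable_const (c := 1) (by simp) 0
    simpa using this
  rw [← integral_const_mul, ← Real.norm_eq_abs]
  refine norm_integral_le_of_norm_le (hi.const_mul c) (Eventually.of_forall fun y => ?_)
  rw [norm_mul, Real.norm_of_nonneg (show 0 ≤ bump y from le_max_left _ _), mul_comm]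
  exact mul_le_mul_of_nonneg_right (abs_clamp_le hc _) (le_max_left _ _)

/-- Changing the base point from `0` to `t` adds `f (S, t)` to every averaged quantity before
truncation and displaces the cutoff by `t / n`. The right-hand side bounds the truncation error,
then the cutoff error. -/
lemma ZeroTilt.enorm_sub_smoothed_le {S : Config} (h : ZeroTilt f S) (hf : Measurable f) {n : ℕ}
    (hn : 1 ≤ n) {ε : ℝ} (hε : 0 < ε) {t : Plane} (ht : IsNeighbor 0 t S) :
    ‖(∫ y, bump y) * f (S, t) - (smoothed f (ε * n) n (Config.shift t S) - smoothed f (ε * n) n S)‖ₑ ≤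
      ‖f (S, t)‖ₑ * (badFraction f (ε / 2) n S +
        volume (Metric.ball (0 : Plane) 1) * exceeds (ε / 2 * n) (f (S, t))) +
      ENNReal.ofReal ε * (‖t‖ₑ * (2 * volume (Metric.ball (0 : Plane) 1))) := by
  have hn0 : (0 : ℝ) < n := by exact_mod_cast hn
  have hc0 : 0 ≤ ε * n := by positivity
  set c := ε * n with hc
  set g := f (S, t) with hg
  set a := (n : ℝ)⁻¹ • t with ha
  set W : Plane → ℝ := fun y => increment f 0 ((n : ℝ) • y) S with hW
  have hWm : Measurable W := measurable_increment hf measurable_const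
    (measurable_id.const_smul_plane _) measurable_const
  have hcl : Measurable fun y => clamp c (-W y) := (continuous_clamp c).measurable.comp hWm.neg
  have hcg : Measurable fun y => clamp c (g - W y) :=
    (continuous_clamp c).measurable.comp (hWm.const_sub g)
  -- Substituting `y - t / n` for `y` makes both averages refer to the same sites `n y`, reached
  -- from `t` with increment `W y - g`.
  have e1 : smoothed f c n (Config.shift t S) = ∫ y, bump (y - a) * clamp c (g - W y) := by
    rw [smoothed, ← integral_sub_right_eq_self _ a]
    refine integral_congr_ae (Eventually.of_forall fun y => ?_)
    have h1 : increment f 0 ((n : ℝ) • (y - a)) (Config.shift t S) = W y - g := by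
      rw [← increment_eq_shift h.nonempty, smul_sub, ha, smul_smul, mul_inv_cancel₀ hn0.ne',
        one_smul, add_sub_cancel]
      have := h.increment_add 0 t ((n : ℝ) • y)
      rw [h.increment_edge t ht] at this
      simp only [hW, hg]
      linarith
    simp only [h1, neg_sub]
  have i1 : Integrable fun y => bump (y - a) * clamp c (g - W y) :=
    integrable_bump_mul hcg (fun y => abs_clamp_le hc0 _) a
  have i2 : Integrable fun y => bump y * clamp c (-W y) := by
    simpa using integrable_bump_mul hcl (fun y => abs_clamp_le hc0 _) 0
  have i3 : Integrable fun y => bump y * g := by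
    simpa using integrable_bump_mul (g := fun _ => g) measurable_const (fun y => le_rfl) 0
  have i4 : Integrable fun y => bump (y - a) * clamp c (g - W y) - bump y * clamp c (-W y) :=
    i1.sub i2
  have e2 : (∫ y, bump y) * g - (smoothed f c n (Config.shift t S) - smoothed f c n S) =
      ∫ y, (bump y * (g - (clamp c (g - W y) - clamp c (-W y))) -
        (bump (y - a) - bump y) * clamp c (g - W y)) := by
    rw [e1, smoothed, ← integral_mul_const, ← integral_sub i1 i2, ← integral_sub i3 i4]
    refine integral_congr_ae (Eventually.of_forall fun y => ?_)
    simp only [hW]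
    ring
  rw [e2]
  refine (enorm_integral_le_lintegral_enorm _).trans ?_
  have hex : Measurable fun y => exceeds (c / 2) (W y) := (measurable_exceeds _).comp hWm
  have hd : Measurable fun y => disc (y - a) := measurable_disc.comp (measurable_id.sub_const a)
  have hbound : ∀ y, ‖bump y * (g - (clamp c (g - W y) - clamp c (-W y))) -
      (bump (y - a) - bump y) * clamp c (g - W y)‖ₑ ≤
      ‖g‖ₑ * (disc y * exceeds (c / 2) (W y) + disc y * exceeds (c / 2) g) +
        ENNReal.ofReal ε * (‖t‖ₑ * (disc y + disc (y - a))) := by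
    intro y
    refine (enorm_sub_le).trans (add_le_add ?_ ?_)
    · rw [enorm_mul]
      refine (mul_le_mul' (enorm_bump_le y) (enorm_sub_clamp_le c g (W y))).trans_eq ?_
      ring
    · rw [enorm_mul]
      have h1 : ‖clamp c (g - W y)‖ₑ ≤ ENNReal.ofReal c := by
        rw [Real.enorm_eq_ofReal_abs]
        exact ENNReal.ofReal_le_ofReal (abs_clamp_le hc0 _)
      refine (mul_le_mul' (enorm_bump_sub_le y a) h1).trans_eq ?_
      -- The displacement `|t| / n` of the Lipschitz cutoff meets values of size at most `ε n`; the
      -- factors `n` cancel.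
      have h2 : ‖a‖ₑ * ENNReal.ofReal c = ENNReal.ofReal ε * ‖t‖ₑ := by
        rw [← ofReal_norm, ← ofReal_norm, ← ENNReal.ofReal_mul (norm_nonneg _),
          ← ENNReal.ofReal_mul hε.le, ha, norm_smul, norm_inv, Real.norm_of_nonneg hn0.le, hc]
        congr 1
        field_simp
      rw [mul_right_comm, h2]
      ring
  refine (lintegral_mono hbound).trans_eq ?_
  have hs : Measurable fun y => disc y + disc (y - a) := measurable_disc.add hd
  have hA : Measurable fun y => disc y * exceeds (c / 2) (W y) := measurable_disc.mul hex
  have hB : Measurable fun y => disc y * exceeds (c / 2) g := measurable_disc.mul_const _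
  have hAB : Measurable fun y => disc y * exceeds (c / 2) (W y) + disc y * exceeds (c / 2) g :=
    hA.add hB
  have hs1 : Measurable fun y => ‖t‖ₑ * (disc y + disc (y - a)) := hs.const_mul _
  have hs2 : Measurable fun y => ENNReal.ofReal ε * (‖t‖ₑ * (disc y + disc (y - a))) :=
    hs1.const_mul _
  rw [lintegral_add_right _ hs2, lintegral_const_mul _ hAB, lintegral_add_right _ hB,
    lintegral_mul_const _ measurable_disc, lintegral_const_mul _ hs1, lintegral_const_mul _ hs,
    lintegral_add_right _ hd, lintegral_disc, lintegral_disc_sub, ← two_mul]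
  have e3 : c / 2 = ε / 2 * n := by rw [hc]; ring
  have e4 : ∫⁻ y, disc y * exceeds (c / 2) (W y) = badFraction f (ε / 2) n S := by
    rw [badFraction, ← lintegral_indicator measurableSet_ball, e3]
    refine lintegral_congr fun y => ?_
    by_cases hy : y ∈ Metric.ball (0 : Plane) 1 <;> simp [disc, hy, hW]
  rw [e4, e3]

/-! ### Orthogonality of harmonic fields and fields of zero tilt -/

/-- A divergence free odd field is orthogonal to the gradients of bounded stationary surfaces. -/
lemma StandingAssumptions.integral_mul_gradient (hP : StandingAssumptions P)
    {h : Config × Plane → ℝ} (hi : Integrable h (edgeMeasure P))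
    (hodd : ∀ᵐ p ∂edgeMeasure P, h (exchange p) = -h p)
    (hdiv : ∀ᵐ S ∂palm P, ∑ t ∈ nbrs S, h (S, t) = 0)
    {Φ : Config → ℝ} (hΦ : Measurable Φ) {C : ℝ} (hC : ∀ S, |Φ S| ≤ C) :
    Integrable (fun p => h p * (Φ (shift p.2 p.1) - Φ p.1)) (edgeMeasure P) ∧
      ∫ p, h p * (Φ (shift p.2 p.1) - Φ p.1) ∂edgeMeasure P = 0 := by
  have m1 : Measurable fun p : Config × Plane => Φ p.1 := hΦ.comp measurable_fst
  have m2 : Measurable fun p : Config × Plane => Φ (shift p.2 p.1) :=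
    hΦ.comp (measurable_fst.shift measurable_snd)
  have i1 : Integrable (fun p => h p * Φ p.1) (edgeMeasure P) :=
    hi.mul_bdd (c := C) m1.aestronglyMeasurable (Eventually.of_forall fun p => hC _)
  have i2 : Integrable (fun p => h p * Φ (shift p.2 p.1)) (edgeMeasure P) :=
    hi.mul_bdd (c := C) m2.aestronglyMeasurable (Eventually.of_forall fun p => hC _)
  have z1 : ∫ p, h p * Φ p.1 ∂edgeMeasure P = 0 := by
    rw [(hP.integral_edgeMeasure i1).2, ← integral_zero Config ℝ (μ := palm P)]
    refine integral_congr_ae ?_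
    filter_upwards [hdiv] with S hS
    rw [← Finset.sum_mul, hS, zero_mul]
  -- The exchange turns `Φ` at the far end into `Φ` at the origin and reverses the sign of `h`,
  -- which reduces to the divergence free case.
  have z2 : ∫ p, h p * Φ (shift p.2 p.1) ∂edgeMeasure P = 0 := by
    have hex : MeasurePreserving exchangeEquiv (edgeMeasure P) (edgeMeasure P) := hP.exchange_edge
    rw [← hex.integral_comp']
    have : (fun p => h (exchangeEquiv p) * Φ (shift (exchangeEquiv p).2 (exchangeEquiv p).1))
        =ᵐ[edgeMeasure P] fun p => -(h p * Φ p.1) := by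
      filter_upwards [hodd] with p hp
      change h (exchange p) * Φ (exchange (exchange p)).1 = _
      rw [exchange_exchange, hp]
      ring
    rw [integral_congr_ae this, integral_neg, z1, neg_zero]
  have e : ∀ p : Config × Plane, h p * (Φ (shift p.2 p.1) - Φ p.1) =
      h p * Φ (shift p.2 p.1) - h p * Φ p.1 := fun p => mul_sub _ _ _
  simp only [e]
  refine ⟨i2.sub i1, ?_⟩
  rw [integral_sub i2 i1, z1, z2, sub_zero]

/-- The pairing with `κ f` equals the pairing with `κ f` minus the gradient of `smoothed f (ε n) n`.
For fixed `ε` the truncation errors vanish as `n → ∞`, leaving a multiple of `ε 𝓔 ∑ |h| |t|`, which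
is finite by Cauchy–Schwarz; then `ε → 0`. -/
lemma StandingAssumptions.integral_mul_eq_zero (hP : StandingAssumptions P)
    {h : Config × Plane → ℝ} (hm : Measurable h) (hL : MemLp h 2 (edgeMeasure P))
    (hodd : ∀ᵐ p ∂edgeMeasure P, h (exchange p) = -h p)
    (hdiv : ∀ᵐ S ∂palm P, ∑ t ∈ nbrs S, h (S, t) = 0)
    (hf : Measurable f) (hfL : MemLp f 2 (edgeMeasure P))
    (hz : ∀ᵐ S ∂palm P, ZeroTilt f S) : ∫ p, h p * f p ∂edgeMeasure P = 0 := by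
  have := hP.isFiniteMeasure_edge
  have := hP.isStationary.palm_prob
  set κ := ∫ y, bump y with hκ
  have hκ0 : 0 < κ := integral_bump_pos
  set V := volume (Metric.ball (0 : Plane) 1) with hV
  have hVfin : V ≠ ∞ := measure_ball_lt_top.ne
  have hi : Integrable h (edgeMeasure P) := hL.integrable (by norm_num)
  have hhf : Integrable (fun p => h p * f p) (edgeMeasure P) := hL.integrable_mul hfL
  have hht : Integrable (fun p => h p * ‖p.2‖) (edgeMeasure P) := hL.integrable_mul hP.memLp_norm
  set w : Config × Plane → ℝ≥0∞ := fun p => ‖h p * f p‖ₑ with hw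
  have hwm : Measurable w := (hm.mul hf).enorm
  have hwfin : ∫⁻ p, w p ∂edgeMeasure P ≠ ∞ := hhf.2.ne
  set M := (∫⁻ p, ‖h p‖ₑ * ‖p.2‖ₑ ∂edgeMeasure P) * (2 * V) with hM
  have hMfin : M ≠ ∞ := by
    refine ENNReal.mul_ne_top ?_ (ENNReal.mul_ne_top (by simp) hVfin)
    have := hht.2.ne
    simpa only [HasFiniteIntegral, enorm_mul, enorm_norm] using this
  have key : ∀ ε : ℝ, 0 < ε → ‖κ * ∫ p, h p * f p ∂edgeMeasure P‖ₑ ≤ ENNReal.ofReal ε * M := by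
    intro ε hε
    have hε2 : 0 < ε / 2 := by positivity
    -- the three error terms
    have l1 : Tendsto (fun n : ℕ => ∫⁻ p, w p * badFraction f (ε / 2) n p.1 ∂edgeMeasure P)
        atTop (𝓝 0) := by
      -- The bad fraction depends on the configuration alone, so the weight `|h f|` can first be
      -- summed over the edges at the origin; the result is integrable.
      set F : Config → ℝ≥0∞ := fun S => ∫⁻ t, edgeSet.indicator w (S, t) ∂S.points with hF
      have hwi : Measurable (edgeSet.indicator w) := hwm.indicator measurableSet_edgeSet
      have hFm : Measurable F := measurable_palmPair_integrand hwi
      have hFfin : ∫⁻ S, F S ∂palm P ≠ ∞ := by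
        rw [hF, ← hP.isStationary.lintegral_palmPair hwi,
          lintegral_indicator measurableSet_edgeSet]
        exact hwfin
      refine (hP.tendsto_badFraction hf (hP.ae_zeroTilt hz) hFm hFfin hε2).congr fun n => ?_
      have hb : Measurable fun p : Config × Plane => badFraction f (ε / 2) n p.1 :=
        (measurable_badFraction hf _ n).comp measurable_fst
      have hm2 : Measurable (edgeSet.indicator fun p => w p * badFraction f (ε / 2) n p.1) :=
        (hwm.mul hb).indicator measurableSet_edgeSet
      rw [edgeMeasure, ← lintegral_indicator measurableSet_edgeSet,
        hP.isStationary.lintegral_palmPair hm2]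
      refine lintegral_congr fun S => ?_
      have hwS : Measurable fun t => edgeSet.indicator w (S, t) := hwi.comp measurable_prodMk_left
      rw [hF]
      simp only
      rw [← lintegral_mul_const _ hwS]
      refine lintegral_congr fun t => ?_
      by_cases ht : (S, t) ∈ edgeSet
      · rw [Set.indicator_of_mem ht, Set.indicator_of_mem ht]
      · rw [Set.indicator_of_notMem ht, Set.indicator_of_notMem ht, zero_mul]
    have l2 : Tendsto (fun n : ℕ => ∫⁻ p, w p * (V * exceeds (ε / 2 * n) (f p)) ∂edgeMeasure P)
        atTop (𝓝 0) := by
      rw [← lintegral_zero (μ := edgeMeasure P)]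
      refine tendsto_lintegral_of_dominated_convergence (fun p => w p * V) (fun n => hwm.mul
        (((measurable_exceeds _).comp hf).const_mul _)) (fun n => Eventually.of_forall fun p =>
          mul_le_mul_right (mul_le_of_le_one_right' (exceeds_le_one _ _)) _) ?_ ?_
      · rw [lintegral_mul_const _ hwm]
        exact ENNReal.mul_ne_top hwfin hVfin
      · refine Eventually.of_forall fun p => ?_
        have h1 := ENNReal.Tendsto.const_mul (tendsto_exceeds_const (f p) hε2)
          (Or.inr hVfin) (a := V)
        rw [mul_zero] at h1
        have h2 := ENNReal.Tendsto.const_mul h1 (Or.inr (show w p ≠ ∞ from enorm_ne_top))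
          (a := w p)
        rwa [mul_zero] at h2
    have lim := (l1.add l2).add_const (ENNReal.ofReal ε * M)
    rw [add_zero, zero_add] at lim
    refine ge_of_tendsto lim ?_
    filter_upwards [eventually_ge_atTop 1] with n hn
    set Φ := smoothed f (ε * n) n with hΦ
    obtain ⟨j1, j2⟩ := hP.integral_mul_gradient hi hodd hdiv
      (measurable_smoothed hf (ε * n) n) (fun S => abs_smoothed_le (by positivity) f n S)
    have e1 : κ * ∫ p, h p * f p ∂edgeMeasure P =
        ∫ p, h p * (κ * f p - (Φ (shift p.2 p.1) - Φ p.1)) ∂edgeMeasure P := by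
      have e2 : ∀ p : Config × Plane, h p * (κ * f p - (Φ (shift p.2 p.1) - Φ p.1)) =
          κ * (h p * f p) - h p * (Φ (shift p.2 p.1) - Φ p.1) := fun p => by ring
      simp only [e2]
      rw [integral_sub (hhf.const_mul κ) j1, j2, sub_zero, integral_const_mul]
    rw [e1]
    refine (enorm_integral_le_lintegral_enorm _).trans ?_
    have hb : Measurable fun p : Config × Plane => w p * badFraction f (ε / 2) n p.1 :=
      hwm.mul ((measurable_badFraction hf _ n).comp measurable_fst)
    have hb2 : Measurable fun p : Config × Plane => w p * (V * exceeds (ε / 2 * n) (f p)) :=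
      hwm.mul (((measurable_exceeds _).comp hf).const_mul _)
    have hb3 : Measurable fun p : Config × Plane => ‖h p‖ₑ * ‖p.2‖ₑ :=
      hm.enorm.mul measurable_snd.enorm
    have e3 : ENNReal.ofReal ε * M =
        ∫⁻ p, ENNReal.ofReal ε * (‖h p‖ₑ * ‖p.2‖ₑ * (2 * V)) ∂edgeMeasure P := by
      rw [lintegral_const_mul _ (hb3.mul_const _), lintegral_mul_const _ hb3]
    rw [e3, ← lintegral_add_right _ hb2, ← lintegral_add_right _ ((hb3.mul_const _).const_mul _)]
    refine lintegral_mono_ae ?_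
    filter_upwards [ae_edgeMeasure_of_ae hz, hP.ae_edge] with p hp1 hp2
    rw [enorm_mul]
    refine (mul_le_mul_right (hp1.enorm_sub_smoothed_le hf hn hε hp2.2) _).trans_eq ?_
    simp only [hw, enorm_mul]
    ring
  have hzero : ‖κ * ∫ p, h p * f p ∂edgeMeasure P‖ₑ = 0 := by
    have lim : Tendsto (fun ε : ℝ => ENNReal.ofReal ε * M) (𝓝[>] 0) (𝓝 0) := by
      have h1 : Tendsto (fun ε : ℝ => ENNReal.ofReal ε) (𝓝[>] 0) (𝓝 0) := by
        have := (ENNReal.continuous_ofReal.tendsto 0).mono_left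
          (nhdsWithin_le_nhds (s := Set.Ioi (0 : ℝ)))
        rwa [ENNReal.ofReal_zero] at this
      have := ENNReal.Tendsto.mul_const h1 (Or.inr hMfin)
      rwa [zero_mul] at this
    refine le_antisymm (ge_of_tendsto lim ?_) zero_le
    filter_upwards [self_mem_nhdsWithin] with ε hε using key ε hε
  rw [enorm_eq_zero] at hzero
  exact (mul_eq_zero.1 hzero).resolve_left hκ0.ne'

/-- By covariance the exchange evaluates the gradient on the same edge traversed backwards. -/
lemma StandingAssumptions.exchange_rep (hP : StandingAssumptions P) {u : Surface}
    (hf : IsRep P (grad u) f) (hc : ∀ᵐ S ∂palm P, IsCovariantOn (grad u) S) :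
    ∀ᵐ p ∂edgeMeasure P, f (exchange p) = -f p := by
  refine hP.ae_edge_of_ae (q := fun S t => f (exchange (S, t)) = -f (S, t)) ?_
  filter_upwards [hP.isStationary.ae_palm_forall_shift hf.eq, hf.eq, hc] with S h1 h2 h3 t ht
  have hn := isNeighbor_neg_shift.2 ht.symm
  have h4 := h3 t ht.2.1 t ht.2.1 0 ht.1
  rw [sub_self, zero_sub] at h4
  rw [exchange, ← h1 t ht.2.1 _ hn, h4, ← h2 t ht, grad, grad, cond_of_isNeighbor ht,
    cond_of_isNeighbor ht.symm]
  ring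

/-- Harmonic deformations minimize the Dirichlet energy, coordinate by coordinate. -/
lemma StandingAssumptions.dirichlet_le (hP : StandingAssumptions P)
    {H G : Plane → Config → Plane} (hH : IsHarmonicDeformation P H) (hG : IsDeformation P G)
    (i : Fin 2) {h g : Config × Plane → ℝ} (hh : IsRep P (grad (coord H i)) h)
    (hg : IsRep P (grad (coord G i)) g) :
    ∫ p, h p ^ 2 ∂edgeMeasure P ≤ ∫ p, g p ^ 2 ∂edgeMeasure P := by
  -- Both coordinates have tilt `e_i`, so their difference has zero tilt and its gradient is
  -- orthogonal to that of `H`.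
  set u : Surface := fun s S => coord G i s S - coord H i s S with hu
  have hgrad : ∀ s t S, grad u s t S = grad (coord G i) s t S - grad (coord H i) s t S := by
    intro s t S
    simp only [grad, hu]
    ring
  have hcG : ∀ᵐ S ∂palm P, IsCovariantOn (grad (coord G i)) S :=
    ((hP.memH_coord_iff G i).2 (hG.corrector i)).covariant
  have hcH := (hH.gradient i).covariant
  have hrep : IsRep P (grad u) fun p => g p - h p := by
    refine ⟨hg.measurable.sub hh.measurable, ?_, hg.memLp.sub hh.memLp⟩
    filter_upwards [hg.eq, hh.eq] with S h1 h2 t ht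
    rw [hgrad, h1 t ht, h2 t ht]
  have hcu : ∀ᵐ S ∂palm P, IsCovariantOn (grad u) S := by
    filter_upwards [hcG, hcH] with S h1 h2 s hs t ht v hv
    rw [hgrad, hgrad, h1 s hs t ht v hv, h2 s hs t ht v hv]
  have htu : ∀ᵐ S ∂palm P, HasTilt u S 0 := by
    filter_upwards [hG.tilt, hH.tilt] with S h1 h2
    filter_upwards [h1 i, h2 i] with x hx1 hx2 j
    have e : ∀ K : ℝ, (u (cen (x + K • dir j) S) S - u (cen x S) S) / K =
        (coord G i (cen (x + K • dir j) S) S - coord G i (cen x S) S) / K -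
          (coord H i (cen (x + K • dir j) S) S - coord H i (cen x S) S) / K := by
      intro K
      simp only [hu]
      ring
    simp only [e]
    have k1 := (hx1 j).1.sub (hx2 j).1
    have k2 := (hx1 j).2.sub (hx2 j).2
    rw [sub_self] at k1 k2
    exact ⟨k1, k2⟩
  have hdiv : ∀ᵐ S ∂palm P, ∑ t ∈ nbrs S, h (S, t) = 0 := by
    filter_upwards [hP.ae_palm_regular, ae_zero_mem_palm, hH.harmonic, hh.eq] with S hS h0 h1 h2
    have h3 := h1 0 h0 i
    rw [laplacian, hS.tsum_cond h0 fun t => coord H i t S - coord H i 0 S] at h3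
    rw [← h3]
    refine Finset.sum_congr rfl fun t ht => ?_
    have ht' := (hS.mem_nbrs h0).1 ht
    rw [← h2 t ht', grad, cond_of_isNeighbor ht', one_mul]
  have horth := hP.integral_mul_eq_zero hh.measurable hh.memLp (hP.exchange_rep hh hcH) hdiv
    hrep.measurable hrep.memLp (hP.ae_zeroTilt_palm hrep hcu htu)
  have i1 := hh.memLp.integrable_sq
  have i2 := hrep.memLp.integrable_sq
  have i3 : Integrable (fun p => h p * (g p - h p)) (edgeMeasure P) :=
    hh.memLp.integrable_mul hrep.memLp
  have e : ∀ p, g p ^ 2 = h p ^ 2 + 2 * (h p * (g p - h p)) + (g p - h p) ^ 2 := fun p => by ring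
  simp only [e]
  have i12 : Integrable (fun p => h p ^ 2 + 2 * (h p * (g p - h p))) (edgeMeasure P) :=
    i1.add (i3.const_mul 2)
  rw [integral_add i12 i2, integral_add i1 (i3.const_mul 2),
    integral_const_mul, horth]
  have : 0 ≤ ∫ p, (g p - h p) ^ 2 ∂edgeMeasure P := integral_nonneg fun p => sq_nonneg _
  linarith

end HarmonicDeformation

/-! ### The minimization theorem -/

open HarmonicDeformation
theorem mainTheorem6 (P : Measure Config) (hP : StandingAssumptions P)
    (H : Plane → Config → Plane) (hH : IsHarmonicDeformation P H) :
    IsDeformation P H ∧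
    (∀ G : Plane → Config → Plane, IsDeformation P G → Integrable (starSum G) (palm P)) ∧
    (∀ G : Plane → Config → Plane, IsDeformation P G →
      ∫ S, starSum H S ∂(palm P) ≤ ∫ S, starSum G S ∂(palm P)) := by
  have hHd := hP.isDeformation hH
  have hrep : ∀ G : Plane → Config → Plane, IsDeformation P G →
      ∃ g : Fin 2 → Config × Plane → ℝ, ∀ i, IsRep P (grad (coord G i)) (g i) := fun G hG =>
    Classical.axiomOfChoice fun i =>
      hP.exists_isRep ((hP.memH_coord_iff G i).2 (hG.corrector i))
  obtain ⟨h, hh⟩ := hrep H hHd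
  refine ⟨hHd, fun G hG => ?_, fun G hG => ?_⟩
  · obtain ⟨g, hg⟩ := hrep G hG
    exact (hP.integral_starSum hG hg).1
  · obtain ⟨g, hg⟩ := hrep G hG
    -- Both means are Dirichlet energies, compared coordinate by coordinate.
    rw [(hP.integral_starSum hHd hh).2, (hP.integral_starSum hG hg).2]
    exact mul_le_mul_of_nonneg_left
      (Finset.sum_le_sum fun i _ => hP.dirichlet_le hH hG i (hh i) (hg i)) (by norm_num)
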